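/- Let $X$ be a compact complex manifold and let $E$ be a holomorphic vector bundle over $X$, that is, a smooth complex vector bundle of finite rank together with a holomorphic structure $D_E$: a $\mathbb{C}$-linear map $D_E\colon A^{0,0}(E)\to A^{0,1}(E)$ with $D_E(fs)=(\bar\partial f)s+f\,D_Es$ for $f\in C^\infty(X)$, whose extension to $E$-valued $(0,q)$-forms satisfies $D_E\circ D_E=0$. Let $D_E$ also denote the induced operators $A^{0,q}(\operatorname{End}E)\to A^{0,q+1}(\operatorname{End}E)$, let $\wedge$ denote the product of $\operatorname{End}E$-valued forms given by the wedge product of forms and the composition of endomorphisms, and put $[\phi,\psi]=\phi\wedge\psi-(-1)^{pq}\psi\wedge\phi$ for $\phi\in A^{0,p}(\operatorname{End}E)$, $\psi\in A^{0,q}(\operatorname{End}E)$. Let $\mathbf{Art}_{\mathbb C}$ be the category of local Artinian $\mathbb{C}$-algebras $A$ with residue field $\mathbb{C}$; write $\mathfrak m_A$ for the maximal ideal, and extend $D_E$, $\wedge$ and $[\cdot,\cdot]$ $A$-linearly. Define two functors $\mathbf{Art}_{\mathbb C}\to\mathbf{Set}$. * $\operatorname{Def}_E(A)$ is the set of all $\alpha\in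 A^{0,1}(\operatorname{End}E)\otimes\mathfrak m_A$ with $D_E\alpha+\alpha\wedge\alpha=0$, modulo the relation: $\alpha_1\sim\alpha_2$ if there is an invertible $\rho\in A^{0,0}(\operatorname{End}E)\otimes A$ with $\rho\in \mathrm{Id}_E+A^{0,0}(\operatorname{End}E)\otimes\mathfrak m_A$ and $\rho^{-1}\circ(D_E+\alpha_2)\circ\rho=D_E+\alpha_1$ as operators $A^{0,0}(E)\otimes A\to A^{0,1}(E)\otimes A$. * $\mathbf{MC}_{\mathfrak g_*}(A)$ is the set of all $x\in A^{0,1}(\operatorname{End}E)\otimes\mathfrak m_A$ with $D_Ex+\tfrac12[x,x]=0$, modulo the gauge action $e^a*x=x+\sum_{n\ge0}\frac{(\operatorname{ad}a)^n}{(n+1)!}\bigl([a,x]-D_Ea\bigr)$, $a\in A^{0,0}(\operatorname{End}E)\otimes\mathfrak m_A$. Then: 1. $\mathfrak g_*=\bigl(A^{0,*}(\operatorname{End}E),D_E,[\cdot,\cdot]\bigr)$ is a differential graded Lie algebra. 2. For every $A$, each transformation $e^a*$ preserves the Maurer–Cartan equation; for all $a,b$ there is $c$ with $e^a*(e^b*x)=e^c*x$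 for all $x$; and both relations above (gauge equivalence and $\sim$) are equivalence relations. 3. There is an isomorphism $\mathbf{MC}_{\mathfrak g_*}\cong\operatorname{Def}_E$ of functors on $\mathbf{Art}_{\mathbb C}$, sending the class of $\alpha$ to the class of $\alpha$. In this sense the differential graded Lie algebra $\mathfrak g_*$ controls the deformations of $E$. -/

import Mathlib

open scoped TensorProduct Manifold ContDiff CategoryTheory

universe u₁ u₂ u₃ u₄ u₅

noncomputable section

set_option linter.unusedSectionVars false

namespace DolbeaultDeformation

theorem update_fin_one {α : Type*} (v : Fin 1 → α) (x : α) :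
    Function.update v 0 x = fun _ => x := by
  funext i
  rw [Subsingleton.elim i 0, Function.update_self]

/-! ### Forms on a Lie–Rinehart algebra -/

section Forms

variable {R : Type u₁} [CommRing R] [Algebra ℂ R]
  {L : Type u₂} [LieRing L] [Module R L] [LieRingModule L R] [LieRinehartRing R L]
  [LieAlgebra ℂ L] [LieRinehartAlgebra ℂ R L]
  {W : Type u₃} [AddCommGroup W] [Module R W] [Module ℂ W] [IsScalarTower ℂ R W]

variable (R L W) in
/-- Alternating `R`-multilinear `q`-forms on `L` with values in the `R`-module `W`. -/
abbrev Form (q : ℕ) : Type _ := L [⋀^Fin q]→ₗ[R] W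

variable (R L W) in
/-- A `ℂ`-linear map `D : W → A¹(W)` such that `D (f s) = (df) s + f D s`, where `df (Z) = Z f`. -/
structure SemiConnection where
  toFun : W →ₗ[ℂ] Form R L W 1
  leibniz : ∀ (f : R) (s : W) (Z : L),
    toFun (f • s) (fun _ => Z) = ⁅Z, f⁆ • s + f • toFun s (fun _ => Z)

namespace SemiConnection

variable (D : SemiConnection R L W)

/-- The derivative `∇_Z s = (D s)(Z)`. -/
def nabla : L →ₗ[ℂ] W →ₗ[ℂ] W where
  toFun Z :=
    { toFun := fun s => D.toFun s (fun _ => Z)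
      map_add' := fun s t => by simp
      map_smul' := fun c s => by simp }
  map_add' Z Z' := by
    ext s
    have := (D.toFun s).map_update_add (fun _ => Z) 0 Z Z'
    rwa [update_fin_one, update_fin_one, update_fin_one] at this
  map_smul' c Z := by
    ext s
    have := (D.toFun s).map_update_smul (fun _ => Z) 0 (algebraMap ℂ R c) Z
    rwa [update_fin_one, update_fin_one, algebraMap_smul, algebraMap_smul] at this

theorem nabla_apply (Z : L) (s : W) : D.nabla Z s = D.toFun s (fun _ => Z) := rfl

theorem nabla_smul (Z : L) (f : R) (s : W) :
    D.nabla Z (f • s) = ⁅Z, f⁆ • s + f • D.nabla Z s := D.leibniz f s Z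

theorem nabla_smul_left (Z : L) (f : R) (s : W) : D.nabla (f • Z) s = f • D.nabla Z s := by
  have := (D.toFun s).map_update_smul (fun _ => Z) 0 f Z
  rwa [update_fin_one, update_fin_one] at this

end SemiConnection

/-- A form seen as a `ℂ`-multilinear form. -/
def Form.overC {q : ℕ} (θ : Form R L W q) : L [⋀^Fin q]→ₗ[ℂ] W :=
  { θ.toMultilinearMap.restrictScalars ℂ with
    map_eq_zero_of_eq' := θ.map_eq_zero_of_eq' }

@[simp] theorem Form.overC_apply {q : ℕ} (θ : Form R L W q) (v : Fin q → L) :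
    θ.overC v = θ v := rfl

/-- `(Z, Z₁, …, Z_q) ↦ ∇_Z (θ (Z₁, …, Z_q))`. -/
def nablaForm (D : SemiConnection R L W) {q : ℕ} (θ : Form R L W q) :
    L →ₗ[ℂ] L [⋀^Fin q]→ₗ[ℂ] W where
  toFun Z := (D.nabla Z).compAlternatingMap θ.overC
  map_add' Z Z' := by ext; simp
  map_smul' c Z := by ext; simp

/-- `(Z, Z₁, …, Z_q) ↦ ∑ⱼ θ (Z₁, …, [Z, Zⱼ], …, Z_q)`. -/
def bracketForm {q : ℕ} (θ : Form R L W q) : L →ₗ[ℂ] L [⋀^Fin q]→ₗ[ℂ] W where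
  toFun Z :=
    { toFun := fun v => ∑ j, θ (Function.update v j ⁅Z, v j⁆)
      map_update_add' := by
        intro hd v m x y
        obtain rfl : hd = instDecidableEqFin q := Subsingleton.elim _ _
        rw [← Finset.sum_add_distrib]
        refine Finset.sum_congr rfl fun j _ => ?_
        rcases eq_or_ne j m with rfl | h
        · simp
        · simp only [Function.update_of_ne h, Function.update_comm h.symm,
            AlternatingMap.map_update_add]
      map_update_smul' := by
        intro hd v m c x
        obtain rfl : hd = instDecidableEqFin q := Subsingleton.elim _ _
        rw [Finset.smul_sum]
        refine Finset.sum_congr rfl fun j _ => ?_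
        rcases eq_or_ne j m with rfl | h
        · simp only [Function.update_self, Function.update_idem, lie_smul]
          exact θ.overC.map_update_smul v j c ⁅Z, x⁆
        · simp only [Function.update_of_ne h, Function.update_comm h.symm]
          exact θ.overC.map_update_smul (Function.update v j ⁅Z, v j⁆) m c x
      map_eq_zero_of_eq' := by
        intro v i j hv hij
        change ∑ k, θ (Function.update v k ⁅Z, v k⁆) = 0
        rw [Fintype.sum_eq_add i j hij]
        · have h : Function.update v j ⁅Z, v j⁆ =
              Function.update v i ⁅Z, v i⁆ ∘ Equiv.swap i j := by
            funext k
            rcases eq_or_ne k i with rfl | hki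
            · simp [Function.update_of_ne hij, Function.update_of_ne hij.symm, hv]
            · rcases eq_or_ne k j with rfl | hkj
              · simp [hv]
              · simp [Equiv.swap_apply_of_ne_of_ne hki hkj, Function.update_of_ne hki,
                  Function.update_of_ne hkj]
          rw [h, AlternatingMap.map_swap _ _ hij, add_neg_cancel]
        · rintro k ⟨hki, hkj⟩
          refine θ.map_eq_zero_of_eq _ ?_ hij
          rw [Function.update_of_ne hki.symm, Function.update_of_ne hkj.symm, hv] }
  map_add' Z Z' := by
    ext v
    simp [Finset.sum_add_distrib]
  map_smul' c Z := by
    ext v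
    simp only [smul_lie, AlternatingMap.coe_mk, MultilinearMap.coe_mk, RingHom.id_apply,
      AlternatingMap.smul_apply, Finset.smul_sum]
    refine Finset.sum_congr rfl fun j _ => ?_
    exact θ.overC.map_update_smul v j c _

/-- The function
`(Z₀, …, Z_q) ↦ ∑ᵢ (-1)ⁱ ∇_{Zᵢ} (θ (…, Ẑᵢ, …)) - ½ ∑ᵢ (-1)ⁱ ∑_{j ≠ i} θ (…, Ẑᵢ, …, [Zᵢ, Zⱼ], …)`,
where `[Zᵢ, Zⱼ]` stands in the place of `Zⱼ`; each unordered pair occurs twice in the last sum. -/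
def koszul (D : SemiConnection R L W) {q : ℕ} (θ : Form R L W q) :
    L [⋀^Fin (q + 1)]→ₗ[ℂ] W :=
  AlternatingMap.alternatizeUncurryFin (nablaForm D θ)
    - (1 / 2 : ℂ) • AlternatingMap.alternatizeUncurryFin (bracketForm θ)

theorem koszul_apply (D : SemiConnection R L W) {q : ℕ} (θ : Form R L W q)
    (v : Fin (q + 1) → L) :
    koszul D θ v = ∑ i : Fin (q + 1), (-1) ^ (i : ℕ) • D.nabla (v i) (θ (i.removeNth v))
      - (1 / 2 : ℂ) • ∑ i : Fin (q + 1), (-1) ^ (i : ℕ) •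
          ∑ j, θ (Function.update (i.removeNth v) j ⁅v i, i.removeNth v j⁆) := by
  simp only [koszul, AlternatingMap.sub_apply, AlternatingMap.smul_apply,
    AlternatingMap.alternatizeUncurryFin_apply]
  rfl

theorem Form.map_update_eq {q : ℕ} (θ : Form R L W (q + 1)) (x : L) (t : Fin (q + 1) → L)
    (j : Fin (q + 1)) :
    θ (Function.update t j x) = (-1) ^ (j : ℕ) • θ (Fin.cons x (j.removeNth t)) := by
  rw [← Fin.insertNth_removeNth, AlternatingMap.map_insertNth]
  rfl

theorem Form.map_cons_smul {q : ℕ} (θ : Form R L W (q + 1)) (f : R) (x : L) (t : Fin q → L) :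
    θ (Fin.cons (f • x) t) = f • θ (Fin.cons x t) := by
  have := θ.map_update_smul (Fin.cons x t) 0 f x
  rwa [Fin.update_cons_zero, Fin.update_cons_zero] at this

theorem Form.map_cons_add {q : ℕ} (θ : Form R L W (q + 1)) (x y : L) (t : Fin q → L) :
    θ (Fin.cons (x + y) t) = θ (Fin.cons x t) + θ (Fin.cons y t) := by
  have := θ.map_update_add (Fin.cons x t) 0 x y
  rwa [Fin.update_cons_zero, Fin.update_cons_zero, Fin.update_cons_zero] at this

theorem removeNth_succ_cons {α : Type*} {q : ℕ} (x : α) (t : Fin (q + 1) → α)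
    (k : Fin (q + 1)) :
    k.succ.removeNth (Fin.cons x t : Fin (q + 2) → α) = Fin.cons x (k.removeNth t) := by
  funext l
  refine Fin.cases ?_ (fun l => ?_) l
  · simp [Fin.removeNth_apply]
  · simp [Fin.removeNth_apply]

theorem removeNth_zero_cons {α : Type*} {q : ℕ} (x : α) (t : Fin q → α) :
    (0 : Fin (q + 1)).removeNth (Fin.cons x t : Fin (q + 1) → α) = t := by
  funext l
  simp [Fin.removeNth_apply]

theorem koszul_cons_smul (D : SemiConnection R L W) {q : ℕ} (θ : Form R L W q)
    (t : Fin q → L) (f : R) (x : L) :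
    koszul D θ (Fin.cons (f • x) t) = f • koszul D θ (Fin.cons x t) := by
  have hlie : ∀ y : L, ⁅f • x, y⁆ = f • ⁅x, y⁆ + (-⁅y, f⁆) • x := by
    intro y
    rw [← lie_skew, LieRinehartRing.leibniz_smul_right, neg_add, ← smul_neg, lie_skew, neg_smul]
  rw [koszul_apply, koszul_apply]
  cases q with
  | zero =>
    simp [SemiConnection.nabla_smul_left, Subsingleton.elim _ t]
  | succ q =>
    set C : W := ∑ k : Fin (q + 1),
      (-1) ^ (k.succ : ℕ) • ⁅t k, f⁆ • θ (Fin.cons x (k.removeNth t)) with hC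
    have h1 : ∑ i : Fin (q + 2), (-1) ^ (i : ℕ) •
          D.nabla ((Fin.cons (f • x) t : Fin (q + 2) → L) i)
            (θ (i.removeNth (Fin.cons (f • x) t : Fin (q + 2) → L))) =
        f • ∑ i : Fin (q + 2), (-1) ^ (i : ℕ) •
          D.nabla ((Fin.cons x t : Fin (q + 2) → L) i)
            (θ (i.removeNth (Fin.cons x t : Fin (q + 2) → L))) + C := by
      rw [Fin.sum_univ_succ (n := q + 1), Fin.sum_univ_succ (n := q + 1)]
      simp only [removeNth_succ_cons, removeNth_zero_cons, Fin.cons_zero, Fin.cons_succ,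
        Form.map_cons_smul, SemiConnection.nabla_smul, SemiConnection.nabla_smul_left, smul_add,
        Finset.sum_add_distrib, Finset.smul_sum, smul_comm f, hC]
      abel
    have h2 : ∑ i : Fin (q + 2), (-1) ^ (i : ℕ) •
          ∑ j, θ (Function.update (i.removeNth (Fin.cons (f • x) t : Fin (q + 2) → L)) j
            ⁅(Fin.cons (f • x) t : Fin (q + 2) → L) i,
              i.removeNth (Fin.cons (f • x) t : Fin (q + 2) → L) j⁆) =
        f • ∑ i : Fin (q + 2), (-1) ^ (i : ℕ) •
          ∑ j, θ (Function.update (i.removeNth (Fin.cons x t : Fin (q + 2) → L)) j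
            ⁅(Fin.cons x t : Fin (q + 2) → L) i,
              i.removeNth (Fin.cons x t : Fin (q + 2) → L) j⁆) + (C + C) := by
      rw [Fin.sum_univ_succ (n := q + 1), Fin.sum_univ_succ (n := q + 1)]
      simp only [removeNth_succ_cons, removeNth_zero_cons, Fin.cons_zero, Fin.cons_succ]
      have e0 : ∑ j, θ (Function.update t j ⁅f • x, t j⁆) =
          f • ∑ j, θ (Function.update t j ⁅x, t j⁆) + C := by
        rw [hC, Finset.smul_sum, ← Finset.sum_add_distrib]
        refine Finset.sum_congr rfl fun j _ => ?_
        rw [hlie, AlternatingMap.map_update_add, AlternatingMap.map_update_smul,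
          AlternatingMap.map_update_smul, Form.map_update_eq θ x t j, Fin.val_succ, pow_succ,
          mul_neg_one, neg_smul, neg_smul, smul_comm ⁅t j, f⁆]
      have e1 : ∀ k : Fin (q + 1), ∑ j, θ (Function.update (Fin.cons (f • x) (k.removeNth t) :
              Fin (q + 1) → L) j
            ⁅t k, (Fin.cons (f • x) (k.removeNth t) : Fin (q + 1) → L) j⁆) =
          f • ∑ j, θ (Function.update (Fin.cons x (k.removeNth t) : Fin (q + 1) → L) j
            ⁅t k, (Fin.cons x (k.removeNth t) : Fin (q + 1) → L) j⁆)
          + ⁅t k, f⁆ • θ (Fin.cons x (k.removeNth t)) := by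
        intro k
        rw [Fin.sum_univ_succ, Fin.sum_univ_succ]
        simp only [Fin.cons_zero, Fin.cons_succ, Fin.update_cons_zero, ← Fin.cons_update,
          Form.map_cons_smul, LieRinehartRing.leibniz_smul_right, Form.map_cons_add, smul_add,
          Finset.smul_sum]
        abel
      simp only [e0, e1, Fin.val_zero, pow_zero, one_smul, smul_add, Finset.sum_add_distrib,
        Finset.smul_sum, smul_comm f, hC]
      abel
    rw [h1, h2, smul_sub, smul_add, ← two_smul ℂ C, smul_smul, smul_comm f]
    norm_num

theorem koszul_smul_zero (D : SemiConnection R L W) {q : ℕ} (θ : Form R L W q)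
    (v : Fin (q + 1) → L) (f : R) (x : L) :
    koszul D θ (Function.update v 0 (f • x)) = f • koszul D θ (Function.update v 0 x) := by
  have h : ∀ y : L, Function.update v 0 y = Fin.cons y (Fin.tail v) := by
    intro y
    rw [← Fin.update_cons_zero (v 0) (Fin.tail v) y, Fin.cons_self_tail]
  rw [h, h, koszul_cons_smul]

theorem koszul_smul (D : SemiConnection R L W) {q : ℕ} (θ : Form R L W q)
    (v : Fin (q + 1) → L) (m : Fin (q + 1)) (f : R) (x : L) :
    koszul D θ (Function.update v m (f • x)) = f • koszul D θ (Function.update v m x) := by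
  rcases eq_or_ne m 0 with rfl | hm
  · exact koszul_smul_zero D θ v f x
  · have key : ∀ y : L, koszul D θ (Function.update v m y) =
        - koszul D θ (Function.update (v ∘ Equiv.swap 0 m) 0 y) := by
      intro y
      rw [← AlternatingMap.map_swap _ _ hm.symm]
      congr 1
      funext k
      rcases eq_or_ne k 0 with rfl | hk
      · simp [Function.update_of_ne hm.symm, Function.update_of_ne hm]
      · rcases eq_or_ne k m with rfl | hkm
        · simp
        · simp [Equiv.swap_apply_of_ne_of_ne hk hkm, Function.update_of_ne hk,
            Function.update_of_ne hkm]
    rw [key, key, koszul_smul_zero, smul_neg]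

/-- The extension `D : A^q(W) → A^{q+1}(W)` of a semi-connection, by the Koszul formula. -/
def SemiConnection.d (D : SemiConnection R L W) (q : ℕ) :
    Form R L W q →ₗ[ℂ] Form R L W (q + 1) where
  toFun θ :=
    { toFun := koszul D θ
      map_update_add' := by
        intro hd v m x y
        exact (koszul D θ).map_update_add v m x y
      map_update_smul' := by
        intro hd v m c x
        obtain rfl : hd = instDecidableEqFin (q + 1) := Subsingleton.elim _ _
        exact koszul_smul D θ v m c x
      map_eq_zero_of_eq' := (koszul D θ).map_eq_zero_of_eq' }
  map_add' θ η := by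
    ext v
    change koszul D (θ + η) v = koszul D θ v + koszul D η v
    simp only [koszul_apply, AlternatingMap.add_apply, map_add, smul_add, Finset.sum_add_distrib]
    abel
  map_smul' c θ := by
    ext v
    change koszul D (c • θ) v = c • koszul D θ v
    simp only [koszul_apply, AlternatingMap.smul_apply, map_smul, smul_sub, Finset.smul_sum,
      smul_comm c]

/-- Integrability: `D ∘ D = 0` on `A⁰(W) = W`. -/
def SemiConnection.IsIntegrable (D : SemiConnection R L W) : Prop :=
  ∀ s : W, D.d 1 (D.toFun s) = 0

/-- The semi-connection `φ ↦ (Z ↦ ∇_Z ∘ φ - φ ∘ ∇_Z)` induced on endomorphisms. -/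
def SemiConnection.onEnd (D : SemiConnection R L W) :
    SemiConnection R L (Module.End R W) where
  toFun :=
    { toFun := fun φ =>
        AlternatingMap.ofSubsingleton R L (Module.End R W) (0 : Fin 1)
          { toFun := fun Z =>
              { toFun := fun s => D.nabla Z (φ s) - φ (D.nabla Z s)
                map_add' := fun s t => by simp only [map_add]; abel
                map_smul' := fun f s => by
                  simp only [map_smul, SemiConnection.nabla_smul, map_add, RingHom.id_apply,
                    smul_sub]
                  abel }
            map_add' := fun Z Z' => by
              ext s
              simp only [map_add, LinearMap.add_apply, LinearMap.coe_mk, AddHom.coe_mk]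
              abel
            map_smul' := fun f Z => by
              ext s
              simp [SemiConnection.nabla_smul_left, smul_sub] }
      map_add' := fun φ ψ => by
        ext v s
        simp only [AlternatingMap.ofSubsingleton_apply_apply, AlternatingMap.add_apply,
          LinearMap.add_apply, LinearMap.coe_mk, AddHom.coe_mk, map_add]
        abel
      map_smul' := fun c φ => by
        ext v s
        simp [smul_sub] }
  leibniz f φ Z := by
    ext s
    simp [SemiConnection.nabla_smul, smul_sub, add_sub_assoc]

section Wedge

variable {W₁ : Type u₃} [AddCommGroup W₁] [Module R W₁] [Module ℂ W₁] [IsScalarTower ℂ R W₁]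
  {W₂ : Type u₄} [AddCommGroup W₂] [Module R W₂] [Module ℂ W₂] [IsScalarTower ℂ R W₂]
  {W₃ : Type u₅} [AddCommGroup W₃] [Module R W₃] [Module ℂ W₃] [IsScalarTower ℂ R W₃]

instance {q : ℕ} : IsScalarTower ℂ R (Form R L W q) :=
  ⟨fun c f θ => by ext v; exact smul_assoc c f (θ v)⟩

/-- The wedge product of forms with respect to a pairing of the coefficients:
`(θ ∧ η)(Z₁, …, Z_{p+q})` is the sum over `(p,q)`-shuffles `σ` of
`sign σ • μ (θ (Z_{σ 1}, …, Z_{σ p})) (η (Z_{σ (p+1)}, …, Z_{σ (p+q)}))`. -/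
def wedgeR (μ : W₁ →ₗ[R] W₂ →ₗ[R] W₃) {p q n : ℕ} (h : p + q = n) :
    Form R L W₁ p →ₗ[R] Form R L W₂ q →ₗ[R] Form R L W₃ n :=
  TensorProduct.curry
    ((AlternatingMap.domDomCongrₗ R (finSumFinEquiv.trans (finCongr h))).toLinearMap ∘ₗ
      LinearMap.compAlternatingMapₗ (S := R) (TensorProduct.lift μ) ∘ₗ AlternatingMap.domCoprod')

theorem wedgeR_apply (μ : W₁ →ₗ[R] W₂ →ₗ[R] W₃) {p q n : ℕ} (h : p + q = n)
    (θ : Form R L W₁ p) (η : Form R L W₂ q) :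
    wedgeR μ h θ η = ((TensorProduct.lift μ).compAlternatingMap (θ.domCoprod η)).domDomCongr
      (finSumFinEquiv.trans (finCongr h)) := rfl

/-- The wedge product as a `ℂ`-bilinear map. -/
def wedge (μ : W₁ →ₗ[R] W₂ →ₗ[R] W₃) {p q n : ℕ} (h : p + q = n) :
    Form R L W₁ p →ₗ[ℂ] Form R L W₂ q →ₗ[ℂ] Form R L W₃ n :=
  LinearMap.mk₂ ℂ (fun θ η => wedgeR μ h θ η)
    (fun θ θ' η => by rw [map_add, LinearMap.add_apply])
    (fun c θ η => by
      rw [← algebraMap_smul R c θ, map_smul, LinearMap.smul_apply, algebraMap_smul])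
    (fun θ η η' => by rw [map_add])
    (fun c θ η => by
      rw [← algebraMap_smul R c η, map_smul, algebraMap_smul])

end Wedge

end Forms

/-! ### Local Artinian algebras -/

/-- A local Artinian `ℂ`-algebra with residue field `ℂ`. -/
structure ArtAlg : Type (u₁ + 1) where
  carrier : Type u₁
  [commRing : CommRing carrier]
  [algebra : Algebra ℂ carrier]
  [isLocalRing : IsLocalRing carrier]
  [isArtinianRing : IsArtinianRing carrier]
  residue_bijective :
    Function.Bijective (algebraMap ℂ (IsLocalRing.ResidueField carrier))

namespace ArtAlg

attribute [instance] commRing algebra isLocalRing isArtinianRing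

instance : CoeSort ArtAlg.{u₁} (Type u₁) := ⟨carrier⟩

/-- Morphisms are the homomorphisms of `ℂ`-algebras; they are automatically local. -/
instance : CategoryTheory.Category ArtAlg.{u₁} where
  Hom A B := A →ₐ[ℂ] B
  id A := AlgHom.id ℂ A
  comp f g := AlgHom.comp g f

/-- The underlying algebra homomorphism of a morphism. -/
def toAlgHom {A B : ArtAlg.{u₁}} (f : A ⟶ B) : A →ₐ[ℂ] B := f

/-- The maximal ideal `𝔪_A`. -/
abbrev maxIdeal (A : ArtAlg.{u₁}) : Ideal A := IsLocalRing.maximalIdeal A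

theorem isNilpotent_maxIdeal (A : ArtAlg.{u₁}) : IsNilpotent A.maxIdeal :=
  (isArtinianRing_iff_isNilpotent_maximalIdeal A).mp inferInstance

theorem map_mem_maxIdeal {A B : ArtAlg.{u₁}} (f : A →ₐ[ℂ] B) {a : A} (ha : a ∈ A.maxIdeal) :
    f a ∈ B.maxIdeal := by
  obtain ⟨n, hn⟩ := A.isNilpotent_maxIdeal
  have h : a ^ n = 0 := by
    have := Ideal.pow_mem_pow ha n
    rwa [hn, Ideal.zero_eq_bot, Ideal.mem_bot] at this
  rw [IsLocalRing.mem_maximalIdeal, mem_nonunits_iff]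
  intro hu
  have h0 : IsUnit (f a ^ n) := hu.pow n
  rw [← map_pow, h, map_zero] at h0
  exact not_isUnit_zero h0

/-- The map `𝔪_A → 𝔪_B` induced by a homomorphism `A → B`. -/
def mapMax {A B : ArtAlg.{u₁}} (f : A →ₐ[ℂ] B) : A.maxIdeal →ₗ[ℂ] B.maxIdeal where
  toFun a := ⟨f a, map_mem_maxIdeal f a.2⟩
  map_add' a b := by ext; simp
  map_smul' c a := by ext; simp

/-- The inclusion `𝔪_A → A`. -/
def inclMax (A : ArtAlg.{u₁}) : A.maxIdeal →ₗ[ℂ] A where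
  toFun a := a
  map_add' _ _ := rfl
  map_smul' _ _ := rfl

/-- The multiplication of `𝔪_A`. -/
def mulMax (A : ArtAlg.{u₁}) : A.maxIdeal →ₗ[ℂ] A.maxIdeal →ₗ[ℂ] A.maxIdeal :=
  LinearMap.mk₂ ℂ (fun a b => ⟨a * b, Ideal.mul_mem_left _ _ b.2⟩)
    (fun a a' b => by ext; simp [add_mul])
    (fun c a b => by ext; simp)
    (fun a b b' => by ext; simp [mul_add])
    (fun c a b => by ext; simp)

@[simp] theorem coe_mulMax (A : ArtAlg.{u₁}) (a b : A.maxIdeal) :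
    (A.mulMax a b : A) = a * b := rfl

@[simp] theorem coe_mapMax {A B : ArtAlg.{u₁}} (f : A →ₐ[ℂ] B) (a : A.maxIdeal) :
    (mapMax f a : B) = f a := rfl

theorem mapMax_mulMax {A B : ArtAlg.{u₁}} (f : A →ₐ[ℂ] B) (a b : A.maxIdeal) :
    mapMax f (A.mulMax a b) = B.mulMax (mapMax f a) (mapMax f b) := by
  ext; simp

theorem mapMax_id (A : ArtAlg.{u₁}) : mapMax (AlgHom.id ℂ A) = LinearMap.id := by
  ext; simp

theorem mapMax_comp {A B C : ArtAlg.{u₁}} (g : B →ₐ[ℂ] C) (f : A →ₐ[ℂ] B) :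
    mapMax (g.comp f) = mapMax g ∘ₗ mapMax f := by
  ext; simp

end ArtAlg

/-- `M ⊗ 𝔪_A`. -/
abbrev TensorMax (M : Type u₂) [AddCommGroup M] [Module ℂ M] (A : ArtAlg.{u₁}) : Type _ :=
  M ⊗[ℂ] A.maxIdeal

section Extension

variable {M : Type u₂} [AddCommGroup M] [Module ℂ M]
  {N : Type u₃} [AddCommGroup N] [Module ℂ N]
  {P : Type u₄} [AddCommGroup P] [Module ℂ P]

/-- The map `M ⊗ 𝔪_A → M ⊗ 𝔪_B` induced by `A → B`. -/
def baseMap (M : Type u₂) [AddCommGroup M] [Module ℂ M] {A B : ArtAlg.{u₁}} (f : A →ₐ[ℂ] B) :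
    TensorMax M A →ₗ[ℂ] TensorMax M B :=
  (ArtAlg.mapMax f).lTensor M

/-- The `A`-linear extension `M ⊗ 𝔪_A → N ⊗ 𝔪_A` of a linear map. -/
def extMax (A : ArtAlg.{u₁}) (φ : M →ₗ[ℂ] N) : TensorMax M A →ₗ[ℂ] TensorMax N A :=
  φ.rTensor A.maxIdeal

/-- The `A`-bilinear extension of a bilinear map: `(m ⊗ a, n ⊗ b) ↦ β (m, n) ⊗ a b`. -/
def extMax₂ (A : ArtAlg.{u₁}) (β : M →ₗ[ℂ] N →ₗ[ℂ] P) :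
    TensorMax M A →ₗ[ℂ] TensorMax N A →ₗ[ℂ] TensorMax P A :=
  TensorProduct.map₂ β A.mulMax

theorem baseMap_id (A : ArtAlg.{u₁}) (x : TensorMax M A) : baseMap M (AlgHom.id ℂ A) x = x := by
  simp [baseMap, ArtAlg.mapMax_id]

theorem baseMap_comp {A B C : ArtAlg.{u₁}} (g : B →ₐ[ℂ] C) (f : A →ₐ[ℂ] B) (x : TensorMax M A) :
    baseMap M (g.comp f) x = baseMap M g (baseMap M f x) := by
  simp [baseMap, ArtAlg.mapMax_comp, LinearMap.lTensor_comp]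

theorem baseMap_extMax {A B : ArtAlg.{u₁}} (f : A →ₐ[ℂ] B) (φ : M →ₗ[ℂ] N) (x : TensorMax M A) :
    baseMap N f (extMax A φ x) = extMax B φ (baseMap M f x) := by
  induction x using TensorProduct.induction_on with
  | zero => simp
  | add x y hx hy => simp only [map_add, hx, hy]
  | tmul m a => simp [baseMap, extMax]

theorem baseMap_extMax₂ {A B : ArtAlg.{u₁}} (f : A →ₐ[ℂ] B) (β : M →ₗ[ℂ] N →ₗ[ℂ] P)
    (x : TensorMax M A) (y : TensorMax N A) :
    baseMap P f (extMax₂ A β x y) = extMax₂ B β (baseMap M f x) (baseMap N f y) := by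
  induction x using TensorProduct.induction_on with
  | zero => simp
  | add x x' hx hx' => simp only [map_add, LinearMap.add_apply, hx, hx']
  | tmul m a =>
    induction y using TensorProduct.induction_on with
    | zero => simp
    | add y y' hy hy' => simp only [map_add, hy, hy']
    | tmul n b => simp [baseMap, extMax₂, TensorProduct.map₂_apply_tmul, ArtAlg.mapMax_mulMax]

/-- The elements of `M ⊗ 𝔪_A` that come from `M ⊗ 𝔪_A ^ (k + 1)`. -/
def filt (M : Type u₂) [AddCommGroup M] [Module ℂ M] (A : ArtAlg.{u₁}) (k : ℕ) :
    Submodule ℂ (TensorMax M A) :=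
  Submodule.span ℂ {t | ∃ (m : M) (a : A.maxIdeal), (a : A) ∈ A.maxIdeal ^ (k + 1) ∧ m ⊗ₜ[ℂ] a = t}

theorem mem_filt_zero (A : ArtAlg.{u₁}) (x : TensorMax M A) : x ∈ filt M A 0 := by
  induction x using TensorProduct.induction_on with
  | zero => exact zero_mem _
  | add x y hx hy => exact add_mem hx hy
  | tmul m a => exact Submodule.subset_span ⟨m, a, by simp, rfl⟩

theorem extMax₂_mem_filt (A : ArtAlg.{u₁}) (β : M →ₗ[ℂ] N →ₗ[ℂ] P) (x : TensorMax M A)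
    {k : ℕ} {y : TensorMax N A} (hy : y ∈ filt N A k) : extMax₂ A β x y ∈ filt P A (k + 1) := by
  induction hy using Submodule.span_induction with
  | zero => simp
  | add y y' _ _ hy hy' => rw [map_add]; exact add_mem hy hy'
  | smul c y _ hy => rw [map_smul]; exact Submodule.smul_mem _ c hy
  | mem y hy =>
    obtain ⟨n, b, hb, rfl⟩ := hy
    induction x using TensorProduct.induction_on with
    | zero => simp
    | add x x' hx hx' => rw [map_add, LinearMap.add_apply]; exact add_mem hx hx'
    | tmul m a =>
      refine Submodule.subset_span ⟨β m n, A.mulMax a b, ?_, rfl⟩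
      rw [ArtAlg.coe_mulMax, pow_succ']
      exact Ideal.mul_mem_mul a.2 hb

theorem exists_filt_eq_bot (M : Type u₂) [AddCommGroup M] [Module ℂ M] (A : ArtAlg.{u₁}) :
    ∃ n, ∀ k, n ≤ k → filt M A k = ⊥ := by
  obtain ⟨n, hn⟩ := A.isNilpotent_maxIdeal
  refine ⟨n, fun k hk => ?_⟩
  rw [filt, Submodule.span_eq_bot]
  rintro _ ⟨m, a, ha, rfl⟩
  have h : A.maxIdeal ^ (k + 1) = ⊥ := by
    rw [← Ideal.zero_eq_bot]
    exact pow_eq_zero_of_le (by omega) hn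
  rw [h, Ideal.mem_bot] at ha
  have : a = 0 := Subtype.ext ha
  rw [this, TensorProduct.tmul_zero]

end Extension

/-! ### Differential graded Lie algebras and the Maurer–Cartan functor -/

/-- A family `V⁰, V¹, …` of complex vector spaces with a map of degree one and a
bilinear bracket of degree zero. -/
structure GradedLieData where
  V : ℕ → Type u₂
  [addCommGroup : ∀ n, AddCommGroup (V n)]
  [module : ∀ n, Module ℂ (V n)]
  d : ∀ n, V n →ₗ[ℂ] V (n + 1)
  bracket : ∀ {p q n : ℕ}, p + q = n → V p →ₗ[ℂ] V q →ₗ[ℂ] V n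

namespace GradedLieData

attribute [instance] addCommGroup module

/-- The axioms of a differential graded Lie algebra. -/
structure IsDGLA (g : GradedLieData.{u₂}) : Prop where
  d_d : ∀ (n : ℕ) (x : g.V n), g.d (n + 1) (g.d n x) = 0
  antisymm : ∀ {p q n : ℕ} (h : p + q = n) (h' : q + p = n) (x : g.V p) (y : g.V q),
    g.bracket h x y = -((-1 : ℂ) ^ (p * q) • g.bracket h' y x)
  jacobi : ∀ {p q r pq qr pr n : ℕ} (hpq : p + q = pq) (hqr : q + r = qr) (hpr : p + r = pr)
    (h₁ : p + qr = n) (h₂ : pq + r = n) (h₃ : q + pr = n)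
    (x : g.V p) (y : g.V q) (z : g.V r),
    g.bracket h₁ x (g.bracket hqr y z) =
      g.bracket h₂ (g.bracket hpq x y) z +
        (-1 : ℂ) ^ (p * q) • g.bracket h₃ y (g.bracket hpr x z)
  leibniz : ∀ {p q n : ℕ} (h : p + q = n) (h₁ : p + 1 + q = n + 1) (h₂ : p + (q + 1) = n + 1)
    (x : g.V p) (y : g.V q),
    g.d n (g.bracket h x y) =
      g.bracket h₁ (g.d p x) y + (-1 : ℂ) ^ p • g.bracket h₂ x (g.d q y)

variable (g : GradedLieData.{u₂})

/-- The Maurer–Cartan equation `d x + ½ [x, x] = 0` in `V² ⊗ 𝔪_A`. -/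
def IsMaurerCartan (A : ArtAlg.{u₁}) (x : TensorMax (g.V 1) A) : Prop :=
  extMax A (g.d 1) x + (1 / 2 : ℂ) • extMax₂ A (g.bracket (rfl : 1 + 1 = 1 + 1)) x x = 0

/-- `ad a = [a, -]` on `V¹ ⊗ 𝔪_A`, for `a ∈ V⁰ ⊗ 𝔪_A`. -/
def ad (A : ArtAlg.{u₁}) (a : TensorMax (g.V 0) A) :
    TensorMax (g.V 1) A →ₗ[ℂ] TensorMax (g.V 1) A :=
  extMax₂ A (g.bracket (zero_add 1)) a

/-- The gauge transformation
`e^a * x = x + ∑_{n ≥ 0} (ad a)ⁿ ([a, x] - d a) / (n + 1)!`; the sum is finite because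
`𝔪_A` is nilpotent. -/
def gauge (A : ArtAlg.{u₁}) (a : TensorMax (g.V 0) A) (x : TensorMax (g.V 1) A) :
    TensorMax (g.V 1) A :=
  x + ∑ᶠ n : ℕ, ((n + 1).factorial : ℂ)⁻¹ • (g.ad A a ^ n) (g.ad A a x - extMax A (g.d 0) a)

theorem ad_pow_mem (A : ArtAlg.{u₁}) (a : TensorMax (g.V 0) A) (y : TensorMax (g.V 1) A)
    (n : ℕ) : (g.ad A a ^ n) y ∈ filt (g.V 1) A n := by
  induction n with
  | zero => exact mem_filt_zero A _
  | succ n ih => rw [pow_succ']; exact extMax₂_mem_filt A _ a ih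

theorem gauge_support_finite (A : ArtAlg.{u₁}) (a : TensorMax (g.V 0) A)
    (y : TensorMax (g.V 1) A) :
    (Function.support fun n : ℕ => ((n + 1).factorial : ℂ)⁻¹ • (g.ad A a ^ n) y).Finite := by
  obtain ⟨N, hN⟩ := exists_filt_eq_bot (g.V 1) A
  refine (Set.finite_lt_nat N).subset fun n hn => ?_
  by_contra h
  refine hn ?_
  have := g.ad_pow_mem A a y n
  rw [hN n (not_lt.mp h), Submodule.mem_bot] at this
  simp only [this, smul_zero]

theorem baseMap_ad_pow {A B : ArtAlg.{u₁}} (f : A →ₐ[ℂ] B) (a : TensorMax (g.V 0) A)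
    (y : TensorMax (g.V 1) A) (n : ℕ) :
    baseMap _ f ((g.ad A a ^ n) y) = (g.ad B (baseMap _ f a) ^ n) (baseMap _ f y) := by
  induction n with
  | zero => rfl
  | succ n ih =>
    rw [pow_succ', pow_succ', Module.End.mul_apply, Module.End.mul_apply, ← ih]
    exact baseMap_extMax₂ f _ _ _

theorem baseMap_gauge {A B : ArtAlg.{u₁}} (f : A →ₐ[ℂ] B) (a : TensorMax (g.V 0) A)
    (x : TensorMax (g.V 1) A) :
    baseMap _ f (g.gauge A a x) = g.gauge B (baseMap _ f a) (baseMap _ f x) := by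
  have h : baseMap (g.V 1) f (g.ad A a x - extMax A (g.d 0) a) =
      g.ad B (baseMap _ f a) (baseMap _ f x) - extMax B (g.d 0) (baseMap _ f a) := by
    rw [map_sub, baseMap_extMax]
    congr 1
    exact baseMap_extMax₂ f _ _ _
  rw [gauge, gauge, map_add, map_finsum _ (g.gauge_support_finite A a _), ← h]
  simp only [map_smul, baseMap_ad_pow]

/-- The set of Maurer–Cartan elements over `A`. -/
def MCSet (A : ArtAlg.{u₁}) : Type _ := {x : TensorMax (g.V 1) A // g.IsMaurerCartan A x}

/-- Two Maurer–Cartan elements are gauge equivalent if some `e^a`, `a ∈ V⁰ ⊗ 𝔪_A`, carries the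
first to the second. -/
def GaugeRel (A : ArtAlg.{u₁}) (x y : g.MCSet A) : Prop :=
  ∃ a : TensorMax (g.V 0) A, y.1 = g.gauge A a x.1

theorem IsMaurerCartan.baseMap {g : GradedLieData.{u₂}} {A B : ArtAlg.{u₁}} (f : A →ₐ[ℂ] B)
    {x : TensorMax (g.V 1) A} (hx : g.IsMaurerCartan A x) :
    g.IsMaurerCartan B (baseMap _ f x) := by
  unfold IsMaurerCartan at *
  rw [← baseMap_extMax, ← baseMap_extMax₂, ← map_smul, ← map_add, hx, map_zero]

/-- The deformation functor `A ↦ {Maurer–Cartan elements over A} / gauge equivalence`. -/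
def mcFunctor : CategoryTheory.Functor ArtAlg.{u₁} (Type (max u₂ u₁)) where
  obj A := Quot (g.GaugeRel A)
  map {A B} f := TypeCat.ofHom (Quot.map
    (fun x => ⟨baseMap _ (ArtAlg.toAlgHom f) x.1, x.2.baseMap _⟩)
    (by
      rintro x y ⟨a, ha⟩
      exact ⟨baseMap _ (ArtAlg.toAlgHom f) a,
        (congrArg (baseMap _ (ArtAlg.toAlgHom f)) ha).trans (baseMap_gauge g _ a x.1)⟩))
  map_id A := by
    ext x
    induction x using Quot.ind with
    | mk x => exact congrArg (Quot.mk _) (Subtype.ext (baseMap_id A x.1))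
  map_comp {A B C} f g' := by
    ext x
    induction x using Quot.ind with
    | mk x =>
      exact congrArg (Quot.mk _)
        (Subtype.ext (baseMap_comp (ArtAlg.toAlgHom g') (ArtAlg.toAlgHom f) x.1))

end GradedLieData

/-! ### The dgLa of endomorphism-valued forms and the functor of deformations -/

section Extension

variable {M : Type u₂} [AddCommGroup M] [Module ℂ M]
  {N : Type u₃} [AddCommGroup N] [Module ℂ N]
  {P : Type u₄} [AddCommGroup P] [Module ℂ P]

/-- The inclusion `M ⊗ 𝔪_A → M ⊗ A`. -/
def incl (M : Type u₂) [AddCommGroup M] [Module ℂ M] (A : ArtAlg.{u₁}) :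
    TensorMax M A →ₗ[ℂ] M ⊗[ℂ] A :=
  A.inclMax.lTensor M

/-- The map `M ⊗ A → M ⊗ B` induced by `A → B`. -/
def baseAlg (M : Type u₂) [AddCommGroup M] [Module ℂ M] {A B : ArtAlg.{u₁}} (f : A →ₐ[ℂ] B) :
    M ⊗[ℂ] A →ₗ[ℂ] M ⊗[ℂ] B :=
  f.toLinearMap.lTensor M

/-- The `A`-linear extension `M ⊗ A → N ⊗ A` of a linear map. -/
def extAlg (A : ArtAlg.{u₁}) (φ : M →ₗ[ℂ] N) : M ⊗[ℂ] A →ₗ[ℂ] N ⊗[ℂ] A :=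
  φ.rTensor A

/-- The `A`-bilinear extension of a bilinear map: `(m ⊗ a, n ⊗ b) ↦ β (m, n) ⊗ a b`. -/
def extAlg₂ (A : ArtAlg.{u₁}) (β : M →ₗ[ℂ] N →ₗ[ℂ] P) :
    M ⊗[ℂ] A →ₗ[ℂ] N ⊗[ℂ] A →ₗ[ℂ] P ⊗[ℂ] A :=
  TensorProduct.map₂ β (LinearMap.mul ℂ A)

/-- Multiplication by `b` on `M ⊗ B`. -/
def scale (M : Type u₂) [AddCommGroup M] [Module ℂ M] {B : ArtAlg.{u₁}} (b : B) :
    M ⊗[ℂ] B →ₗ[ℂ] M ⊗[ℂ] B :=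
  (LinearMap.mulLeft ℂ b).lTensor M

theorem baseAlg_incl {A B : ArtAlg.{u₁}} (f : A →ₐ[ℂ] B) (x : TensorMax M A) :
    baseAlg M f (incl M A x) = incl M B (baseMap M f x) := by
  induction x using TensorProduct.induction_on with
  | zero => simp
  | add x y hx hy => simp only [map_add, hx, hy]
  | tmul m a => simp [baseMap, baseAlg, incl, ArtAlg.inclMax]

theorem baseAlg_extAlg {A B : ArtAlg.{u₁}} (f : A →ₐ[ℂ] B) (φ : M →ₗ[ℂ] N) (x : M ⊗[ℂ] A) :
    baseAlg N f (extAlg A φ x) = extAlg B φ (baseAlg M f x) := by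
  induction x using TensorProduct.induction_on with
  | zero => simp
  | add x y hx hy => simp only [map_add, hx, hy]
  | tmul m a => simp [baseAlg, extAlg]

theorem baseAlg_extAlg₂ {A B : ArtAlg.{u₁}} (f : A →ₐ[ℂ] B) (β : M →ₗ[ℂ] N →ₗ[ℂ] P)
    (x : M ⊗[ℂ] A) (y : N ⊗[ℂ] A) :
    baseAlg P f (extAlg₂ A β x y) = extAlg₂ B β (baseAlg M f x) (baseAlg N f y) := by
  induction x using TensorProduct.induction_on with
  | zero => simp
  | add x x' hx hx' => simp only [map_add, LinearMap.add_apply, hx, hx']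
  | tmul m a =>
    induction y using TensorProduct.induction_on with
    | zero => simp
    | add y y' hy hy' => simp only [map_add, hy, hy']
    | tmul n b => simp [baseAlg, extAlg₂, TensorProduct.map₂_apply_tmul]

theorem extAlg_scale {B : ArtAlg.{u₁}} (b : B) (φ : M →ₗ[ℂ] N) (x : M ⊗[ℂ] B) :
    extAlg B φ (scale M b x) = scale N b (extAlg B φ x) := by
  induction x using TensorProduct.induction_on with
  | zero => simp
  | add x y hx hy => simp only [map_add, hx, hy]
  | tmul m a => simp [scale, extAlg]

theorem extAlg₂_scale {B : ArtAlg.{u₁}} (b : B) (β : M →ₗ[ℂ] N →ₗ[ℂ] P)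
    (x : M ⊗[ℂ] B) (y : N ⊗[ℂ] B) :
    extAlg₂ B β x (scale N b y) = scale P b (extAlg₂ B β x y) := by
  induction x using TensorProduct.induction_on with
  | zero => simp
  | add x x' hx hx' => simp only [map_add, LinearMap.add_apply, hx, hx']
  | tmul m a =>
    induction y using TensorProduct.induction_on with
    | zero => simp
    | add y y' hy hy' => simp only [map_add, hy, hy']
    | tmul n c => simp [scale, extAlg₂, TensorProduct.map₂_apply_tmul, mul_left_comm]

end Extension

namespace SemiConnection

variable {R : Type u₁} [CommRing R] [Algebra ℂ R]
  {L : Type u₂} [LieRing L] [Module R L] [LieRingModule L R] [LieRinehartRing R L]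
  [LieAlgebra ℂ L] [LieRinehartAlgebra ℂ R L]
  {W : Type u₃} [AddCommGroup W] [Module R W] [Module ℂ W] [IsScalarTower ℂ R W]
  (D : SemiConnection R L W)

variable (R L W) in
/-- The product of endomorphism-valued forms: wedge product of forms and composition. -/
def mulForm {p q n : ℕ} (h : p + q = n) :
    Form R L (Module.End R W) p →ₗ[ℂ] Form R L (Module.End R W) q →ₗ[ℂ]
      Form R L (Module.End R W) n :=
  wedge (LinearMap.mul R (Module.End R W)) h

variable (R L W) in
/-- The action of endomorphism-valued forms on `W`-valued forms: wedge product of forms and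
evaluation. -/
def actForm {p q n : ℕ} (h : p + q = n) :
    Form R L (Module.End R W) p →ₗ[ℂ] Form R L W q →ₗ[ℂ] Form R L W n :=
  wedge (LinearMap.id : Module.End R W →ₗ[R] W →ₗ[R] W) h

variable (R L W) in
/-- The identity of `W` as an endomorphism-valued form of degree zero. -/
def oneForm : Form R L (Module.End R W) 0 := AlternatingMap.constOfIsEmpty R L (Fin 0) 1

variable (R L W) in
/-- The graded commutator `[φ, ψ] = φ ∧ ψ - (-1)^{pq} ψ ∧ φ` of endomorphism-valued forms. -/
def gradedCommutator {p q n : ℕ} (h : p + q = n) :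
    Form R L (Module.End R W) p →ₗ[ℂ] Form R L (Module.End R W) q →ₗ[ℂ]
      Form R L (Module.End R W) n :=
  LinearMap.mk₂ ℂ
    (fun φ ψ => mulForm R L W h φ ψ -
      (-1 : ℂ) ^ (p * q) • mulForm R L W ((add_comm q p).trans h) ψ φ)
    (fun φ φ' ψ => by simp only [map_add, LinearMap.add_apply, smul_add]; abel)
    (fun c φ ψ => by
      simp only [map_smul, LinearMap.smul_apply, smul_sub, smul_comm c])
    (fun φ ψ ψ' => by simp only [map_add, LinearMap.add_apply, smul_add]; abel)
    (fun c φ ψ => by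
      simp only [map_smul, LinearMap.smul_apply, smul_sub, smul_comm c])

/-- The complex `A⁰(End W) → A¹(End W) → …` with the differential induced by `D` and the graded
commutator. -/
def endForms : GradedLieData where
  V q := Form R L (Module.End R W) q
  d q := D.onEnd.d q
  bracket h := gradedCommutator R L W h

/-- A deformation over `A`: an element `α` of `A¹(End W) ⊗ 𝔪_A` with `D α + α ∧ α = 0`. -/
def IsDeformation {A : ArtAlg.{u₄}} (α : TensorMax (Form R L (Module.End R W) 1) A) : Prop :=
  extMax A (D.onEnd.d 1) α + extMax₂ A (mulForm R L W (rfl : 1 + 1 = 1 + 1)) α α = 0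

/-- The operator `D + α : A⁰(W) ⊗ A → A¹(W) ⊗ A`. -/
def perturb {A : ArtAlg.{u₄}} (α : TensorMax (Form R L (Module.End R W) 1) A) :
    Form R L W 0 ⊗[ℂ] A →ₗ[ℂ] Form R L W (0 + 1) ⊗[ℂ] A :=
  extAlg A (D.d 0) + extAlg₂ A (actForm R L W (add_comm 1 0)) (incl _ A α)

/-- The deformations over `A`. -/
def Deformation (A : ArtAlg.{u₄}) : Type _ :=
  {α : TensorMax (Form R L (Module.End R W) 1) A // D.IsDeformation α}

/-- Two deformations are equivalent if there is an invertible `ρ` in `A⁰(End W) ⊗ A` (with inverse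
`ρ'`) that reduces to the identity modulo `𝔪_A`, such that
`ρ⁻¹ ∘ (D + α₂) ∘ ρ = D + α₁`. -/
def DefRel (A : ArtAlg.{u₄}) (α₁ α₂ : D.Deformation A) : Prop :=
  ∃ ρ ρ' : Form R L (Module.End R W) 0 ⊗[ℂ] A,
    (∃ r : TensorMax (Form R L (Module.End R W) 0) A,
      ρ = oneForm R L W ⊗ₜ[ℂ] (1 : A) + incl _ A r) ∧
    extAlg₂ A (mulForm R L W (add_zero 0)) ρ ρ' = oneForm R L W ⊗ₜ[ℂ] (1 : A) ∧
    extAlg₂ A (mulForm R L W (add_zero 0)) ρ' ρ = oneForm R L W ⊗ₜ[ℂ] (1 : A) ∧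
    ∀ s : Form R L W 0 ⊗[ℂ] A,
      extAlg₂ A (actForm R L W (zero_add (0 + 1))) ρ'
        (D.perturb α₂.1 (extAlg₂ A (actForm R L W (add_zero 0)) ρ s)) = D.perturb α₁.1 s

theorem baseAlg_perturb {A B : ArtAlg.{u₄}} (f : A →ₐ[ℂ] B)
    (α : TensorMax (Form R L (Module.End R W) 1) A) (s : Form R L W 0 ⊗[ℂ] A) :
    baseAlg _ f (D.perturb α s) = D.perturb (baseMap _ f α) (baseAlg _ f s) := by
  simp only [perturb, LinearMap.add_apply, map_add, baseAlg_extAlg, baseAlg_extAlg₂,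
    baseAlg_incl]

theorem perturb_scale {B : ArtAlg.{u₄}} (b : B)
    (α : TensorMax (Form R L (Module.End R W) 1) B) (s : Form R L W 0 ⊗[ℂ] B) :
    D.perturb α (scale _ b s) = scale _ b (D.perturb α s) := by
  simp only [perturb, LinearMap.add_apply, map_add, extAlg_scale, extAlg₂_scale]

theorem IsDeformation.baseMap {D : SemiConnection R L W} {A B : ArtAlg.{u₄}} (f : A →ₐ[ℂ] B)
    {α : TensorMax (Form R L (Module.End R W) 1) A} (h : D.IsDeformation α) :
    D.IsDeformation (baseMap _ f α) := by
  unfold IsDeformation at *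
  rw [← baseMap_extMax, ← baseMap_extMax₂, ← map_add, h, map_zero]

/-- The deformation over `B` induced by a deformation over `A` and a homomorphism `A → B`. -/
def Deformation.map {D : SemiConnection R L W} {A B : ArtAlg.{u₄}} (f : A →ₐ[ℂ] B)
    (α : D.Deformation A) : D.Deformation B :=
  ⟨baseMap _ f α.1, IsDeformation.baseMap f α.2⟩

theorem DefRel.map {D : SemiConnection R L W} {A B : ArtAlg.{u₄}} (f : A →ₐ[ℂ] B)
    {α₁ α₂ : D.Deformation A} (h : D.DefRel A α₁ α₂) :
    D.DefRel B (α₁.map f) (α₂.map f) := by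
  obtain ⟨ρ, ρ', ⟨r, hr⟩, h₁, h₂, h₃⟩ := h
  have hone : baseAlg _ f (oneForm R L W ⊗ₜ[ℂ] (1 : A)) = oneForm R L W ⊗ₜ[ℂ] (1 : B) := by
    simp [baseAlg]
  refine ⟨baseAlg _ f ρ, baseAlg _ f ρ', ⟨baseMap _ f r, ?_⟩, ?_, ?_, ?_⟩
  · rw [hr, map_add, hone, baseAlg_incl]
  · rw [← baseAlg_extAlg₂, h₁, hone]
  · rw [← baseAlg_extAlg₂, h₂, hone]
  · intro s
    induction s using TensorProduct.induction_on with
    | zero => simp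
    | add s t hs ht => simp only [map_add, hs, ht]
    | tmul s b =>
      have hs : s ⊗ₜ[ℂ] b = scale _ b (baseAlg _ f (s ⊗ₜ[ℂ] (1 : A))) := by
        simp [scale, baseAlg]
      simp only [Deformation.map, hs, extAlg₂_scale, perturb_scale, ← baseAlg_perturb,
        ← baseAlg_extAlg₂, h₃]

/-- The functor `Def : A ↦ {deformations over A} / equivalence`. -/
def defFunctor : CategoryTheory.Functor ArtAlg.{u₄} (Type (max u₂ u₃ u₄)) where
  obj A := Quot (D.DefRel A)
  map {A B} f := TypeCat.ofHom (Quot.map (Deformation.map (ArtAlg.toAlgHom f))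
    (fun _ _ h => h.map (ArtAlg.toAlgHom f)))
  map_id A := by
    ext x
    induction x using Quot.ind with
    | mk x => exact congrArg (Quot.mk _) (Subtype.ext (baseMap_id A x.1))
  map_comp {A B C} f g := by
    ext x
    induction x using Quot.ind with
    | mk x =>
      exact congrArg (Quot.mk _)
        (Subtype.ext (baseMap_comp (ArtAlg.toAlgHom g) (ArtAlg.toAlgHom f) x.1))

end SemiConnection

/-! ### Holomorphic vector bundles over complex manifolds -/

section Geometry

variable (V : Type u₁) [NormedAddCommGroup V] [NormedSpace ℂ V]
  (X : Type u₂) [TopologicalSpace X] [ChartedSpace V X]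

/-- The smooth complex-valued functions on `X` (smooth in the real sense), as a subalgebra. -/
def smoothFunSubalgebra : Subalgebra ℂ (X → ℂ) where
  carrier := {f | ContMDiff 𝓘(ℝ, V) 𝓘(ℝ, ℂ) ∞ f}
  mul_mem' hf hg := (contDiff_mul (𝕜 := ℝ) (𝔸 := ℂ)).contMDiff.comp (hf.prodMk_space hg)
  add_mem' hf hg := ContMDiff.add hf hg
  algebraMap_mem' _ := contMDiff_const

/-- The algebra `C^∞(X)` of smooth complex-valued functions on `X`. -/
def SmoothFun : Type u₂ := smoothFunSubalgebra V X

namespace SmoothFun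

instance : CommRing (SmoothFun V X) := inferInstanceAs (CommRing (smoothFunSubalgebra V X))

instance : Algebra ℂ (SmoothFun V X) := inferInstanceAs (Algebra ℂ (smoothFunSubalgebra V X))

instance : CoeFun (SmoothFun V X) (fun _ => X → ℂ) := ⟨fun f => f.1⟩

variable {V X}

theorem contMDiff (f : SmoothFun V X) : ContMDiff 𝓘(ℝ, V) 𝓘(ℝ, ℂ) ∞ f := f.2

@[simp] theorem add_apply (f g : SmoothFun V X) (x : X) : (f + g) x = f x + g x := rfl
@[simp] theorem mul_apply (f g : SmoothFun V X) (x : X) : (f * g) x = f x * g x := rfl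
@[simp] theorem sub_apply (f g : SmoothFun V X) (x : X) : (f - g) x = f x - g x := rfl
@[simp] theorem one_apply (x : X) : (1 : SmoothFun V X) x = 1 := rfl
@[simp] theorem zero_apply (x : X) : (0 : SmoothFun V X) x = 0 := rfl
@[simp] theorem smul_apply (c : ℂ) (f : SmoothFun V X) (x : X) : (c • f) x = c * f x := rfl
@[simp] theorem algebraMap_apply (c : ℂ) (x : X) : (algebraMap ℂ (SmoothFun V X) c) x = c := rfl

end SmoothFun

/-- The `C^∞(X)`-module `Γ(T^{0,1} X)` of smooth vector fields of type `(0,1)`: the complex vector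
fields on `X`, as derivations of `C^∞(X)`, that annihilate holomorphic functions, i.e. `Z f = 0` on
every open set on which `f` is holomorphic. -/
def vectorFields01 :
    LieRinehartSubalgebra (SmoothFun V X) (Derivation ℂ (SmoothFun V X) (SmoothFun V X)) where
  carrier := {Z | ∀ (f : SmoothFun V X) (U : Set X), IsOpen U →
    MDifferentiableOn 𝓘(ℂ, V) 𝓘(ℂ, ℂ) (f : X → ℂ) U → ∀ x ∈ U, Z f x = 0}
  zero_mem' := by intro f U _ _ x _; rfl
  add_mem' := by
    intro Z Z' hZ hZ' f U hU hf x hx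
    rw [Derivation.add_apply, SmoothFun.add_apply, hZ f U hU hf x hx, hZ' f U hU hf x hx, add_zero]
  smul_mem' := by
    intro g Z hZ f U hU hf x hx
    rw [Derivation.smul_apply, smul_eq_mul, SmoothFun.mul_apply, hZ f U hU hf x hx, mul_zero]
  lie_mem' := by
    intro Z Z' hZ hZ' f U hU hf x hx
    have h₁ : MDifferentiableOn 𝓘(ℂ, V) 𝓘(ℂ, ℂ) (Z f : X → ℂ) U :=
      (mdifferentiableOn_const (c := (0 : ℂ))).congr fun y hy => hZ f U hU hf y hy
    have h₂ : MDifferentiableOn 𝓘(ℂ, V) 𝓘(ℂ, ℂ) (Z' f : X → ℂ) U :=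
      (mdifferentiableOn_const (c := (0 : ℂ))).congr fun y hy => hZ' f U hU hf y hy
    rw [Derivation.commutator_apply, SmoothFun.sub_apply, hZ (Z' f) U hU h₂ x hx,
      hZ' (Z f) U hU h₁ x hx, sub_zero]

/-- The type of smooth vector fields of type `(0,1)`. -/
def VectorField01 : Type u₂ := vectorFields01 V X

namespace VectorField01

instance : LieRing (VectorField01 V X) := inferInstanceAs (LieRing (vectorFields01 V X))

instance : Module (SmoothFun V X) (VectorField01 V X) :=
  inferInstanceAs (Module (SmoothFun V X) (vectorFields01 V X))

instance : LieRingModule (VectorField01 V X) (SmoothFun V X) :=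
  inferInstanceAs (LieRingModule (vectorFields01 V X) (SmoothFun V X))

instance : LieRinehartRing (SmoothFun V X) (VectorField01 V X) :=
  inferInstanceAs (LieRinehartRing (SmoothFun V X) (vectorFields01 V X))

instance : LieAlgebra ℂ (VectorField01 V X) :=
  inferInstanceAs (LieAlgebra ℂ (vectorFields01 V X))

instance : LieRinehartAlgebra ℂ (SmoothFun V X) (VectorField01 V X) :=
  inferInstanceAs (LieRinehartAlgebra ℂ (SmoothFun V X) (vectorFields01 V X))

variable {V X}

/-- `⁅Z, f⁆` is the derivative `Z f` of the function `f` along `Z`. -/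
theorem lie_eq (Z : VectorField01 V X) (f : SmoothFun V X) : ⁅Z, f⁆ = Z.1 f := rfl

theorem lie_val (Z Z' : VectorField01 V X) : (⁅Z, Z'⁆ : VectorField01 V X).1 = ⁅Z.1, Z'.1⁆ := rfl

theorem smul_val (f : SmoothFun V X) (Z : VectorField01 V X) : (f • Z).1 = f • Z.1 := rfl

end VectorField01

variable (F : Type u₃) [NormedAddCommGroup F] [NormedSpace ℂ F]
  (E : X → Type u₄) [∀ x, AddCommGroup (E x)] [∀ x, Module ℂ (E x)]
  [∀ x, TopologicalSpace (E x)] [TopologicalSpace (Bundle.TotalSpace F E)]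
  [FiberBundle F E] [VectorBundle ℂ F E]

/-- Functions on `X` act pointwise on (not necessarily continuous) sections of `E`. -/
instance : Module (SmoothFun V X) (∀ x, E x) where
  smul f s := fun x => f x • s x
  one_smul s := funext fun x => one_smul ℂ (s x)
  mul_smul f g s := funext fun x => mul_smul (f x) (g x) (s x)
  smul_zero f := funext fun x => smul_zero (f x)
  smul_add f s t := funext fun x => smul_add (f x) (s x) (t x)
  add_smul f g s := funext fun x => add_smul (f x) (g x) (s x)
  zero_smul s := funext fun x => zero_smul ℂ (s x)

instance : IsScalarTower ℂ (SmoothFun V X) (∀ x, E x) :=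
  ⟨fun c f s => funext fun x => mul_smul c (f x) (s x)⟩

/-- A section is smooth if its local expressions in the trivializations are. -/
theorem contMDiff_section_iff (s : ∀ x, E x) :
    ContMDiff 𝓘(ℝ, V) (𝓘(ℝ, V).prod 𝓘(ℝ, F)) ∞ (fun x => Bundle.TotalSpace.mk' F x (s x)) ↔
      ∀ x₀, ContMDiffAt 𝓘(ℝ, V) 𝓘(ℝ, F) ∞ (fun x => (trivializationAt F E x₀ ⟨x, s x⟩).2) x₀ :=
  forall_congr' fun x₀ => Bundle.contMDiffAt_section x₀

/-- The `C^∞(X)`-module `Γ(E) = A^{0,0}(E)` of smooth sections of the complex vector bundle `E`. -/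
def smoothSections : Submodule (SmoothFun V X) (∀ x, E x) where
  carrier := {s | ContMDiff 𝓘(ℝ, V) (𝓘(ℝ, V).prod 𝓘(ℝ, F)) ∞
    (fun x => Bundle.TotalSpace.mk' F x (s x))}
  zero_mem' := by
    rw [Set.mem_ofPred_eq, contMDiff_section_iff]
    intro x₀
    refine (contMDiffAt_const (c := (0 : F))).congr_of_eventuallyEq ?_
    filter_upwards [(trivializationAt F E x₀).open_baseSet.mem_nhds
      (FiberBundle.mem_baseSet_trivializationAt' x₀)] with x hx
    exact ((trivializationAt F E x₀).linear ℂ hx).map_zero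
  add_mem' := by
    intro s t hs ht
    rw [Set.mem_ofPred_eq, contMDiff_section_iff] at *
    intro x₀
    refine ((hs x₀).add (ht x₀)).congr_of_eventuallyEq ?_
    filter_upwards [(trivializationAt F E x₀).open_baseSet.mem_nhds
      (FiberBundle.mem_baseSet_trivializationAt' x₀)] with x hx
    exact ((trivializationAt F E x₀).linear ℂ hx).map_add (s x) (t x)
  smul_mem' := by
    intro f s hs
    rw [Set.mem_ofPred_eq, contMDiff_section_iff] at *
    intro x₀
    have h := ((isBoundedBilinearMap_smul (𝕜 := ℝ) (A := ℂ) (E := F)).contDiff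
      (n := ∞)).contMDiff.contMDiffAt.comp x₀ (f.contMDiff.contMDiffAt.prodMk_space (hs x₀))
    refine h.congr_of_eventuallyEq ?_
    filter_upwards [(trivializationAt F E x₀).open_baseSet.mem_nhds
      (FiberBundle.mem_baseSet_trivializationAt' x₀)] with x hx
    exact ((trivializationAt F E x₀).linear ℂ hx).map_smul (f x) (s x)

/-- The type of smooth sections of `E`. -/
def SmoothSection : Type (max u₂ u₄) := smoothSections V X F E

namespace SmoothSection

instance : AddCommGroup (SmoothSection V X F E) :=
  inferInstanceAs (AddCommGroup (smoothSections V X F E))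

instance : Module (SmoothFun V X) (SmoothSection V X F E) :=
  inferInstanceAs (Module (SmoothFun V X) (smoothSections V X F E))

instance : Module ℂ (SmoothSection V X F E) :=
  inferInstanceAs (Module ℂ (smoothSections V X F E))

instance : IsScalarTower ℂ (SmoothFun V X) (SmoothSection V X F E) :=
  inferInstanceAs (IsScalarTower ℂ (SmoothFun V X) (smoothSections V X F E))

end SmoothSection

/-- The complex vector bundle `E` is a smooth complex vector bundle: its transition functions are
smooth in the real sense. -/
class SmoothComplexVectorBundle : Prop where
  contMDiffOn_coordChangeL : ∀ (e e' : Bundle.Trivialization F (Bundle.TotalSpace.proj :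
      Bundle.TotalSpace F E → X)) [MemTrivializationAtlas e] [MemTrivializationAtlas e'],
    ContMDiffOn 𝓘(ℝ, V) 𝓘(ℝ, F →L[ℂ] F) ∞
      (fun x => (e.coordChangeL ℂ e' x : F →L[ℂ] F)) (e.baseSet ∩ e'.baseSet)

/-- The space `A^{0,q}(E)` of smooth `(0,q)`-forms with values in `E`, as alternating
`C^∞(X)`-multilinear maps from vector fields of type `(0,1)` to sections. -/
abbrev BundleForm (q : ℕ) : Type _ :=
  Form (SmoothFun V X) (VectorField01 V X) (SmoothSection V X F E) q

/-- The space `A^{0,q}(End E)` of smooth `(0,q)`-forms with values in `End E`; the smooth sections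
of `End E` are the `C^∞(X)`-linear endomorphisms of `Γ(E)`. -/
abbrev EndForm (q : ℕ) : Type _ :=
  Form (SmoothFun V X) (VectorField01 V X)
    (Module.End (SmoothFun V X) (SmoothSection V X F E)) q

/-- A holomorphic structure on a smooth complex vector bundle `E`: a semi-connection
`D_E : A^{0,0}(E) → A^{0,1}(E)`, i.e. a `ℂ`-linear map with `D_E (f s) = (∂̄ f) s + f D_E s`, such
that `D_E ∘ D_E = 0`. -/
structure HolomorphicStructure where
  semiConnection :
    SemiConnection (SmoothFun V X) (VectorField01 V X) (SmoothSection V X F E)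
  integrable : semiConnection.IsIntegrable

variable {V X F E}

namespace HolomorphicStructure

/-- The dgLa `A^{0,*}(End E)` with the differential `D_E` and the graded commutator. -/
def dgla (D : HolomorphicStructure V X F E) : GradedLieData := D.semiConnection.endForms

/-- The functor `Def_E` of deformations of `E`. -/
def Def (D : HolomorphicStructure V X F E) :
    CategoryTheory.Functor ArtAlg.{u₅} (Type (max u₂ u₄ u₅)) := D.semiConnection.defFunctor

/-- The Maurer–Cartan functor modulo gauge of the dgLa `A^{0,*}(End E)`. -/
def MC (D : HolomorphicStructure V X F E) :
    CategoryTheory.Functor ArtAlg.{u₅} (Type (max u₂ u₄ u₅)) := D.dgla.mcFunctor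

end HolomorphicStructure

end Geometry

end DolbeaultDeformation

end

noncomputable section

set_option linter.unusedSectionVars false

namespace DolbeaultDeformation

/-! ### Sums over permutations of `Fin (n + 1)` -/

/-! The theorem is a statement about conjugation. Let `D` and left multiplication by
endomorphism-valued forms act on the endomorphism-valued forms of all degrees, with coefficients in
`A`. In this associative algebra of operators `D² = 0`, and multiplication by `Dφ` is the graded
commutator of `D` with `φ`. Hence `Dα + α ∧ α` and `Dα + ½[α, α]` are both `(D + α)²`
(`isMaurerCartan_iff`, `isDeformation_iff`), and the two functors are quotients of the same set.

The relations agree as well. Since `[a, D] = -Da`, the series `e^{ad a}(D + x)` is `D + e^a * x`, so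
a gauge transformation is conjugation of `D + x` by `e^a` (`exp_mul_diffOp_add`). As `𝔪_A` is
nilpotent, every element of `1 + A⁰(End E) ⊗ 𝔪_A` is an exponential (`NilFiltration.exists_exp_eq`);
this is proved by successive approximation and takes the place of the logarithm and of the
Baker–Campbell–Hausdorff formula. Gauge equivalence is therefore conjugacy under the group `1 +
A⁰(End E) ⊗ 𝔪_A` (`isConjugate_iff`), which yields the composition law, the equivalence relation and
the invariance of the Maurer–Cartan equation. On the other side `ρ⁻¹(D + α)ρ = D + ρ⁻¹(Dρ + αρ)` on
sections, and a one-form that kills all sections is zero, so `∼` is the same conjugacy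
(`defRel_iff`).

What remains is that the forms are a differential graded algebra. Forms of all degrees are put into
one ring `TotalForm`, and every identity (associativity, the commutation rules of the Lie
derivative, `d² = 0`, Leibniz) is proved by induction on the degree: a form of positive degree
vanishes if all its contractions do (`apply_succ_eq_zero`), and contracting the defect of an
identity gives defects one degree lower. The inputs are that contraction is an antiderivation
(`curryLeft_wedgeTo`), the only place where shuffles enter the induction, and Cartan's formula
(`d_succ_apply_cons`). Flatness of the semi-connection is used in degree zero of `[L_Z, L_Y] =
L_[Z,Y]`. -/

/-- The permutations of `Fin (n + 1)`: the position `i` of `0` and the permutation of the rest. -/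
def permFinSuccEquiv (n : ℕ) :
    Fin (n + 1) × Equiv.Perm (Fin n) ≃ Equiv.Perm (Fin (n + 1)) :=
  Equiv.ofBijective
    (fun x => Equiv.Perm.decomposeFin.symm (0, x.2) * Fin.cycleRange x.1) (by
      rw [Fintype.bijective_iff_injective_and_card]
      constructor
      · rintro ⟨i, τ⟩ ⟨j, τ'⟩ h
        -- The position `k` is recovered as the preimage of `0`: `cycleRange k` carries `k` to `0`,
        -- and the other factor fixes `0`.
        have key : ∀ (k : Fin (n + 1)) (ρ : Equiv.Perm (Fin n)),
            (Equiv.Perm.decomposeFin.symm (0, ρ) * Fin.cycleRange k).symm 0 = k := by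
          intro k ρ
          rw [Equiv.symm_apply_eq, Equiv.Perm.mul_apply, Fin.cycleRange_self,
            Equiv.Perm.decomposeFin_symm_apply_zero]
        have hij : i = j := by rw [← key i τ, ← key j τ']; exact congrArg (fun e => e.symm 0) h
        subst hij
        have := Equiv.Perm.decomposeFin.symm.injective (mul_right_cancel h)
        simpa using this
      · simp [Fintype.card_perm, Nat.factorial_succ])

theorem sign_permFinSuccEquiv {n : ℕ} (i : Fin (n + 1)) (τ : Equiv.Perm (Fin n)) :
    Equiv.Perm.sign (permFinSuccEquiv n (i, τ)) = (-1) ^ (i : ℕ) * Equiv.Perm.sign τ := by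
  simp [permFinSuccEquiv, Fin.sign_cycleRange, mul_comm]

/-- Separates the slot that receives the first vector from the arrangement of the others, so that a
sum over permutations can be sorted by the slot of the contracted vector. -/
theorem cons_comp_permFinSuccEquiv {α : Type*} {n : ℕ} (i : Fin (n + 1))
    (τ : Equiv.Perm (Fin n)) (x : α) (t : Fin n → α) :
    (Fin.cons x t : Fin (n + 1) → α) ∘ permFinSuccEquiv n (i, τ) =
      i.insertNth x (t ∘ τ) := by
  rw [← Fin.cons_comp_cycleRange]
  funext k
  simp only [permFinSuccEquiv, Equiv.ofBijective_apply, Function.comp_apply,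
    Equiv.Perm.mul_apply]
  refine Fin.cases ?_ (fun l => ?_) (Fin.cycleRange i k)
  · simp
  · simp

theorem Form.map_insertNth_eq_curryLeft {R : Type u₁} [CommRing R]
    {L : Type u₂} [AddCommGroup L] [Module R L] {B : Type u₃} [AddCommGroup B] [Module R B]
    {q : ℕ} (θ : L [⋀^Fin (q + 1)]→ₗ[R] B) (i : Fin (q + 1)) (x : L) (t : Fin q → L) :
    θ (i.insertNth x t) = (-1 : ℤ) ^ (i : ℕ) • θ.curryLeft x t := by
  rw [AlternatingMap.map_insertNth]
  rfl

/-! ### Contraction of wedge products -/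

section Forms

variable {R : Type u₁} [CommRing R] [Algebra ℂ R]
  {L : Type u₂} [LieRing L] [Module R L] [LieRingModule L R] [LieRinehartRing R L]
  [LieAlgebra ℂ L] [LieRinehartAlgebra ℂ R L]
  {B : Type u₃} [Ring B] [Algebra R B] [Module ℂ B] [IsScalarTower ℂ R B]

/-- The inclusions of the first `p` and of the last `q` indices. -/
abbrev splitFin {p q n : ℕ} (h : p + q = n) : Fin p ⊕ Fin q ≃ Fin n :=
  finSumFinEquiv.trans (finCongr h)

/-- The wedge product, up to the factor `p! q!`, as a sum over all permutations. -/
theorem factorial_smul_wedge_pairing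
    {W₁ : Type u₃} [AddCommGroup W₁] [Module R W₁] [Module ℂ W₁] [IsScalarTower ℂ R W₁]
    {W₂ : Type u₄} [AddCommGroup W₂] [Module R W₂] [Module ℂ W₂] [IsScalarTower ℂ R W₂]
    {W₃ : Type u₅} [AddCommGroup W₃] [Module R W₃] [Module ℂ W₃] [IsScalarTower ℂ R W₃]
    (μ : W₁ →ₗ[R] W₂ →ₗ[R] W₃) {p q n : ℕ} (h : p + q = n)
    (θ : Form R L W₁ p) (η : Form R L W₂ q) (v : Fin n → L) :
    (p.factorial * q.factorial) • wedge μ h θ η v =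
      ∑ σ : Equiv.Perm (Fin n), Equiv.Perm.sign σ •
        μ (θ (fun i => (v ∘ σ) (splitFin h (Sum.inl i))))
          (η (fun j => (v ∘ σ) (splitFin h (Sum.inr j)))) := by
  have h1 : (p.factorial * q.factorial) • wedge μ h θ η v =
      TensorProduct.lift μ
        (((p.factorial * q.factorial) • θ.domCoprod η) (v ∘ splitFin h)) := by
    rw [AlternatingMap.smul_apply, map_nsmul]
    rfl
  -- Shuffles are cosets of `S_p × S_q`. As both forms are alternating, the sum over the whole
  -- symmetric group counts each coset `p! q!` times.
  have h2 := MultilinearMap.domCoprod_alternization_eq θ η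
  rw [Fintype.card_fin, Fintype.card_fin] at h2
  rw [h1, ← h2, MultilinearMap.alternatization_apply, map_sum]
  refine Fintype.sum_equiv (splitFin h).permCongr _ _ fun σ => ?_
  rw [map_zsmul_unit, Equiv.Perm.sign_permCongr]
  congr 1
  simp only [MultilinearMap.domDomCongr_apply, MultilinearMap.domCoprod_apply,
    TensorProduct.lift.tmul, Equiv.permCongr_apply, Function.comp_apply,
    Equiv.symm_apply_apply]
  rfl

theorem factorial_smul_wedge {p q n : ℕ} (h : p + q = n)
    (θ : Form R L B p) (η : Form R L B q) (v : Fin n → L) :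
    (p.factorial * q.factorial) • wedge (LinearMap.mul R B) h θ η v =
      ∑ σ : Equiv.Perm (Fin n), Equiv.Perm.sign σ •
        (θ (fun i => (v ∘ σ) (splitFin h (Sum.inl i))) *
          η (fun j => (v ∘ σ) (splitFin h (Sum.inr j)))) :=
  factorial_smul_wedge_pairing (LinearMap.mul R B) h θ η v

/-- The wedge product in total degree at most one. -/
theorem wedge_apply_of_le_one
    {W₁ : Type u₃} [AddCommGroup W₁] [Module R W₁] [Module ℂ W₁] [IsScalarTower ℂ R W₁]
    {W₂ : Type u₄} [AddCommGroup W₂] [Module R W₂] [Module ℂ W₂] [IsScalarTower ℂ R W₂]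
    {W₃ : Type u₅} [AddCommGroup W₃] [Module R W₃] [Module ℂ W₃] [IsScalarTower ℂ R W₃]
    (μ : W₁ →ₗ[R] W₂ →ₗ[R] W₃) {p q n : ℕ} (h : p + q = n) (hn : n ≤ 1)
    (θ : Form R L W₁ p) (η : Form R L W₂ q) (v : Fin n → L) :
    wedge μ h θ η v = μ (θ (fun i => v (splitFin h (Sum.inl i))))
      (η (fun j => v (splitFin h (Sum.inr j)))) := by
  have : Subsingleton (Fin n) := Fin.subsingleton_iff_le_one.2 hn
  have hp : p.factorial = 1 := Nat.factorial_eq_one.2 (by omega)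
  have hq : q.factorial = 1 := Nat.factorial_eq_one.2 (by omega)
  have key := factorial_smul_wedge_pairing μ h θ η v
  rw [hp, hq, mul_one, one_smul, Fintype.sum_subsingleton _ (1 : Equiv.Perm (Fin n)),
    Equiv.Perm.sign_one, one_smul] at key
  exact key

/-- Contraction with a vector; it vanishes in degree zero. -/
def Form.contractPred (Z : L) : ∀ {p : ℕ}, Form R L B p → Form R L B (p - 1)
  | 0, _ => 0
  | _ + 1, θ => θ.curryLeft Z

/-- The wedge product of forms of degrees `p` and `q`, seen in degree `n`: it is zero unless
`p + q = n`. -/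
def wedgeTo (R : Type u₁) [CommRing R] [Algebra ℂ R]
    (L : Type u₂) [LieRing L] [Module R L]
    (B : Type u₃) [Ring B] [Algebra R B] [Module ℂ B] [IsScalarTower ℂ R B]
    (p q n : ℕ) : Form R L B p →ₗ[ℂ] Form R L B q →ₗ[ℂ] Form R L B n :=
  if h : p + q = n then wedge (LinearMap.mul R B) h else 0

theorem wedgeTo_eq {p q n : ℕ} (h : p + q = n) :
    wedgeTo R L B p q n = wedge (LinearMap.mul R B) h := dif_pos h

/-- These are the permutations that place `Z` in a slot of `θ`. All `p` slots contribute equally: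
the sign `(-1)^i` of the permutation cancels the sign of moving `Z` to the front of `θ`, and `p · (p
- 1)! = p!`. For `p = 0` both sides are zero. -/
theorem factorial_smul_contract_left {p q n : ℕ} (h : p + q = n + 1)
    (θ : Form R L B p) (η : Form R L B q) (Z : L) (t : Fin n → L) :
    (p.factorial * q.factorial) • wedgeTo R L B (p - 1) q n (θ.contractPred Z) η t =
      ∑ i : Fin p, ∑ τ : Equiv.Perm (Fin n),
        Equiv.Perm.sign (permFinSuccEquiv n (splitFin h (Sum.inl i), τ)) •
        (θ (fun k => ((splitFin h (Sum.inl i)).insertNth Z (t ∘ τ) : Fin (n + 1) → L)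
            (splitFin h (Sum.inl k))) *
          η (fun k => ((splitFin h (Sum.inl i)).insertNth Z (t ∘ τ) : Fin (n + 1) → L)
            (splitFin h (Sum.inr k)))) := by
  cases p with
  | zero => simp [Form.contractPred]
  | succ p =>
    have h' : p + q = n := by omega
    have key : ∀ (i : Fin (p + 1)) (s : Fin n → L),
        (fun k => ((splitFin h (Sum.inl i)).insertNth Z s : Fin (n + 1) → L)
            (splitFin h (Sum.inl k))) =
          i.insertNth Z (fun k => s (splitFin h' (Sum.inl k))) ∧
        (fun k => ((splitFin h (Sum.inl i)).insertNth Z s : Fin (n + 1) → L)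
            (splitFin h (Sum.inr k))) = fun k => s (splitFin h' (Sum.inr k)) := by
      intro i s
      constructor
      · funext k
        refine Fin.succAboveCases i ?_ (fun l => ?_) k
        · simp
        · have : splitFin h (Sum.inl (i.succAbove l)) =
              (splitFin h (Sum.inl i)).succAbove (splitFin h' (Sum.inl l)) := by
            ext
            simp [Fin.succAbove, Fin.lt_def]
            split_ifs <;> simp
          rw [this]
          simp
      · funext k
        have : splitFin h (Sum.inr k) =
            (splitFin h (Sum.inl i)).succAbove (splitFin h' (Sum.inr k)) := by
          ext
          simp [Fin.succAbove, Fin.lt_def]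
          have := i.2
          split_ifs <;> simp <;> omega
        rw [this]
        simp
    have term : ∀ i : Fin (p + 1), ∑ τ : Equiv.Perm (Fin n),
        Equiv.Perm.sign (permFinSuccEquiv n (splitFin h (Sum.inl i), τ)) •
        (θ (fun k => ((splitFin h (Sum.inl i)).insertNth Z (t ∘ τ) : Fin (n + 1) → L)
            (splitFin h (Sum.inl k))) *
          η (fun k => ((splitFin h (Sum.inl i)).insertNth Z (t ∘ τ) : Fin (n + 1) → L)
            (splitFin h (Sum.inr k)))) =
        (p.factorial * q.factorial) • wedgeTo R L B p q n (θ.curryLeft Z) η t := by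
      intro i
      rw [wedgeTo_eq h', factorial_smul_wedge]
      refine Finset.sum_congr rfl fun τ _ => ?_
      rw [(key i _).1, (key i _).2, Form.map_insertNth_eq_curryLeft, sign_permFinSuccEquiv, mul_comm,
        mul_smul, smul_mul_assoc, Units.smul_def ((-1 : ℤˣ) ^ _)]
      congr 1
      simp only [smul_smul, Units.val_pow_eq_pow_val, Units.val_neg, Units.val_one]
      have : ((splitFin h (Sum.inl i) : Fin (n + 1)) : ℕ) = i := by simp
      rw [this, ← mul_pow]
      simp
    rw [Finset.sum_congr rfl fun i _ => term i, Finset.sum_const, Finset.card_univ,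
      Fintype.card_fin, smul_smul, Nat.factorial_succ, mul_assoc]
    rfl

/-- The remaining permutations, with `Z` in a slot of `η`. Slot `i` of `η` is slot `p + i` overall,
so after the cancellation of `(-1)^i` the sign `(-1)^p` survives. -/
theorem factorial_smul_contract_right {p q n : ℕ} (h : p + q = n + 1)
    (θ : Form R L B p) (η : Form R L B q) (Z : L) (t : Fin n → L) :
    (p.factorial * q.factorial) •
        ((-1 : ℤ) ^ p • wedgeTo R L B p (q - 1) n θ (η.contractPred Z) t) =
      ∑ i : Fin q, ∑ τ : Equiv.Perm (Fin n),
        Equiv.Perm.sign (permFinSuccEquiv n (splitFin h (Sum.inr i), τ)) •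
        (θ (fun k => ((splitFin h (Sum.inr i)).insertNth Z (t ∘ τ) : Fin (n + 1) → L)
            (splitFin h (Sum.inl k))) *
          η (fun k => ((splitFin h (Sum.inr i)).insertNth Z (t ∘ τ) : Fin (n + 1) → L)
            (splitFin h (Sum.inr k)))) := by
  cases q with
  | zero => simp [Form.contractPred]
  | succ q =>
    have h' : p + q = n := by omega
    have key : ∀ (i : Fin (q + 1)) (s : Fin n → L),
        (fun k => ((splitFin h (Sum.inr i)).insertNth Z s : Fin (n + 1) → L)
            (splitFin h (Sum.inr k))) =
          i.insertNth Z (fun k => s (splitFin h' (Sum.inr k))) ∧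
        (fun k => ((splitFin h (Sum.inr i)).insertNth Z s : Fin (n + 1) → L)
            (splitFin h (Sum.inl k))) = fun k => s (splitFin h' (Sum.inl k)) := by
      intro i s
      constructor
      · funext k
        refine Fin.succAboveCases i ?_ (fun l => ?_) k
        · simp
        · have : splitFin h (Sum.inr (i.succAbove l)) =
              (splitFin h (Sum.inr i)).succAbove (splitFin h' (Sum.inr l)) := by
            ext
            simp [Fin.succAbove, Fin.lt_def]
            split_ifs <;> simp; omega
          rw [this]
          simp
      · funext k
        have : splitFin h (Sum.inl k) =
            (splitFin h (Sum.inr i)).succAbove (splitFin h' (Sum.inl k)) := by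
          ext
          simp [Fin.succAbove, Fin.lt_def]
          have := k.2
          split_ifs <;> simp; omega
        rw [this]
        simp
    have term : ∀ i : Fin (q + 1), ∑ τ : Equiv.Perm (Fin n),
        Equiv.Perm.sign (permFinSuccEquiv n (splitFin h (Sum.inr i), τ)) •
        (θ (fun k => ((splitFin h (Sum.inr i)).insertNth Z (t ∘ τ) : Fin (n + 1) → L)
            (splitFin h (Sum.inl k))) *
          η (fun k => ((splitFin h (Sum.inr i)).insertNth Z (t ∘ τ) : Fin (n + 1) → L)
            (splitFin h (Sum.inr k)))) =
        (-1 : ℤ) ^ p • (p.factorial * q.factorial) •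
          wedgeTo R L B p q n θ (η.curryLeft Z) t := by
      intro i
      rw [wedgeTo_eq h', factorial_smul_wedge, Finset.smul_sum]
      refine Finset.sum_congr rfl fun τ _ => ?_
      rw [(key i _).1, (key i _).2, Form.map_insertNth_eq_curryLeft, sign_permFinSuccEquiv, mul_comm,
        mul_smul, mul_smul_comm, Units.smul_def ((-1 : ℤˣ) ^ _), smul_comm ((-1 : ℤ) ^ p)]
      congr 1
      simp only [smul_smul, Units.val_pow_eq_pow_val, Units.val_neg, Units.val_one]
      have : ((splitFin h (Sum.inr i) : Fin (n + 1)) : ℕ) = p + i := by simp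
      rw [this, pow_add, mul_assoc, ← mul_pow]
      simp
    rw [Finset.sum_congr rfl fun i _ => term i, Finset.sum_const, Finset.card_univ,
      Fintype.card_fin, smul_comm, smul_comm (q + 1), smul_smul, Nat.factorial_succ,
      mul_left_comm]
    rfl

/-- Contraction with a vector is an antiderivation of the wedge product. -/
theorem curryLeft_wedgeTo {p q n : ℕ} (h : p + q = n + 1)
    (θ : Form R L B p) (η : Form R L B q) (Z : L) :
    (wedgeTo R L B p q (n + 1) θ η).curryLeft Z =
      wedgeTo R L B (p - 1) q n (θ.contractPred Z) η +
        (-1 : ℂ) ^ p • wedgeTo R L B p (q - 1) n θ (η.contractPred Z) := by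
  ext t
  have hne : ((p.factorial * q.factorial : ℕ) : ℂ) ≠ 0 := by
    exact_mod_cast (Nat.mul_pos p.factorial_pos q.factorial_pos).ne'
  -- Over `ℂ` the identity may be checked after multiplication by `p! q!`, where both sides are sums
  -- over all permutations.
  refine smul_right_injective B hne ?_
  have hsign : (-1 : ℂ) ^ p • wedgeTo R L B p (q - 1) n θ (η.contractPred Z) t =
      (-1 : ℤ) ^ p • wedgeTo R L B p (q - 1) n θ (η.contractPred Z) t := by
    rcases neg_one_pow_eq_or ℤ p with hp | hp
    · rw [hp, ((neg_one_pow_eq_one_iff_even (by decide)).1 hp).neg_one_pow]; simp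
    · rw [hp, ((neg_one_pow_eq_neg_one_iff_odd (by decide)).1 hp).neg_one_pow]; simp
  simp only [Nat.cast_smul_eq_nsmul ℂ, AlternatingMap.add_apply, AlternatingMap.smul_apply,
    smul_add, hsign]
  -- The slots of `θ` and those of `η` together are all the slots of `Fin (n + 1)`; a slot and a
  -- permutation of the rest amount to a permutation of `Fin (n + 1)`.
  rw [factorial_smul_contract_left h, factorial_smul_contract_right h, wedgeTo_eq h,
    AlternatingMap.curryLeft_apply_apply, factorial_smul_wedge,
    ← Fintype.sum_sum_type (fun x : Fin p ⊕ Fin q => ∑ τ : Equiv.Perm (Fin n),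
        Equiv.Perm.sign (permFinSuccEquiv n (splitFin h x, τ)) •
        (θ (fun k => ((splitFin h x).insertNth Z (t ∘ τ) : Fin (n + 1) → L)
            (splitFin h (Sum.inl k))) *
          η (fun k => ((splitFin h x).insertNth Z (t ∘ τ) : Fin (n + 1) → L)
            (splitFin h (Sum.inr k))))),
    (splitFin h).sum_comp (fun i : Fin (n + 1) => ∑ τ : Equiv.Perm (Fin n),
        Equiv.Perm.sign (permFinSuccEquiv n (i, τ)) •
        (θ (fun k => (i.insertNth Z (t ∘ τ) : Fin (n + 1) → L) (splitFin h (Sum.inl k))) *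
          η (fun k => (i.insertNth Z (t ∘ τ) : Fin (n + 1) → L) (splitFin h (Sum.inr k))))),
    ← Fintype.sum_prod_type' (fun (i : Fin (n + 1)) (τ : Equiv.Perm (Fin n)) =>
        Equiv.Perm.sign (permFinSuccEquiv n (i, τ)) •
        (θ (fun k => (i.insertNth Z (t ∘ τ) : Fin (n + 1) → L) (splitFin h (Sum.inl k))) *
          η (fun k => (i.insertNth Z (t ∘ τ) : Fin (n + 1) → L) (splitFin h (Sum.inr k)))))]
  refine (Fintype.sum_equiv (permFinSuccEquiv n) _ _ fun x => ?_).symm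
  obtain ⟨i, τ⟩ := x
  simp only [← cons_comp_permFinSuccEquiv]
  rfl

theorem wedge_zero_zero {n : ℕ} (h : 0 + 0 = n) (θ η : Form R L B 0) (v : Fin n → L) :
    wedge (LinearMap.mul R B) h θ η v = θ ![] * η ![] := by
  rw [wedge_apply_of_le_one _ h (by omega)]
  simp [Subsingleton.elim _ (![] : Fin 0 → L)]

end Forms

/-! ### Forms of all degrees: contraction and the sign involution -/

section Forms

variable (R : Type u₁) [CommRing R] [Algebra ℂ R]
  (L : Type u₂) [LieRing L] [Module R L]
  (B : Type u₃) [AddCommGroup B] [Module R B] [Module ℂ B] [IsScalarTower ℂ R B]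

/-- Forms of all degrees: families of forms, one in each degree. -/
def TotalForm : Type _ := ∀ n, Form R L B n

namespace TotalForm

instance : AddCommGroup (TotalForm R L B) := inferInstanceAs (AddCommGroup (∀ n, Form R L B n))

instance : Module ℂ (TotalForm R L B) := inferInstanceAs (Module ℂ (∀ n, Form R L B n))

variable {R L B}

theorem ext {χ η : TotalForm R L B} (h : ∀ n, χ n = η n) : χ = η := funext h

theorem add_apply (χ η : TotalForm R L B) (n : ℕ) : (χ + η) n = χ n + η n := rfl
theorem sub_apply (χ η : TotalForm R L B) (n : ℕ) : (χ - η) n = χ n - η n := rfl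
theorem neg_apply (χ : TotalForm R L B) (n : ℕ) : (-χ) n = -χ n := rfl
theorem zero_apply (n : ℕ) : (0 : TotalForm R L B) n = 0 := rfl
theorem smul_apply (c : ℂ) (χ : TotalForm R L B) (n : ℕ) : (c • χ) n = c • χ n := rfl

/-- Contraction with a vector. -/
def contract (Z : L) : TotalForm R L B →ₗ[ℂ] TotalForm R L B where
  toFun χ n := (χ (n + 1)).curryLeft Z
  map_add' _ _ := rfl
  map_smul' _ _ := rfl

theorem contract_apply (Z : L) (χ : TotalForm R L B) (n : ℕ) :
    contract Z χ n = (χ (n + 1)).curryLeft Z := rfl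

/-- The sign involution: `(-1)ⁿ` in degree `n`. -/
def alt : TotalForm R L B →ₗ[ℂ] TotalForm R L B where
  toFun χ n := (-1 : ℂ) ^ n • χ n
  map_add' _ _ := TotalForm.ext fun _ => smul_add _ _ _
  map_smul' c χ := TotalForm.ext fun n => smul_comm ((-1 : ℂ) ^ n) c (χ n)

theorem alt_apply (χ : TotalForm R L B) (n : ℕ) : alt χ n = (-1 : ℂ) ^ n • χ n := rfl

theorem alt_alt (χ : TotalForm R L B) : alt (alt χ) = χ := by
  refine TotalForm.ext fun n => ?_
  rw [alt_apply, alt_apply, smul_smul, ← mul_pow]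
  simp

theorem contract_alt (Z : L) (χ : TotalForm R L B) :
    contract Z (alt χ) = -alt (contract Z χ) := by
  refine TotalForm.ext fun n => ?_
  ext t
  simp [contract_apply, alt_apply, neg_apply, pow_succ]

/-- A form is determined by its contractions, and by its value in degree zero. -/
theorem apply_succ_eq_zero {χ : TotalForm R L B} {n : ℕ} (h : ∀ Z, contract Z χ n = 0) :
    χ (n + 1) = 0 := by
  ext v
  have := congrArg (fun θ => θ (Fin.tail v)) (h (v 0))
  have hv : (Matrix.vecCons (v 0) (Fin.tail v) : Fin (n + 1) → L) = v := Fin.cons_self_tail v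
  rw [contract_apply, AlternatingMap.curryLeft_apply_apply, hv] at this
  simpa using this

/-- A homogeneous form. -/
def single (p : ℕ) : Form R L B p →ₗ[ℂ] TotalForm R L B :=
  LinearMap.single ℂ (fun n => Form R L B n) p

theorem single_same (p : ℕ) (θ : Form R L B p) : single p θ p = θ :=
  Pi.single_eq_same p θ

theorem single_ne {p n : ℕ} (h : n ≠ p) (θ : Form R L B p) : single p θ n = 0 :=
  Pi.single_eq_of_ne h θ

theorem single_injective (p : ℕ) : Function.Injective (single (R := R) (L := L) (B := B) p) :=
  Pi.single_injective p

theorem alt_single (p : ℕ) (θ : Form R L B p) :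
    alt (single p θ) = (-1 : ℂ) ^ p • single p θ := by
  refine TotalForm.ext fun n => ?_
  rw [alt_apply, smul_apply]
  rcases eq_or_ne n p with rfl | h
  · rfl
  · rw [single_ne h, smul_zero, smul_zero]

end TotalForm

end Forms

/-! ### The ring of algebra-valued forms -/

section Product

variable (R : Type u₁) [CommRing R] [Algebra ℂ R]
  (L : Type u₂) [LieRing L] [Module R L] [LieRingModule L R] [LieRinehartRing R L]
  [LieAlgebra ℂ L] [LieRinehartAlgebra ℂ R L]
  (B : Type u₃) [Ring B] [Algebra R B] [Module ℂ B] [IsScalarTower ℂ R B]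

namespace TotalForm

variable {R L B} in
/-- The wedge product of forms with values in an algebra. -/
def mulFun (χ η : TotalForm R L B) : TotalForm R L B := fun n =>
  ∑ x ∈ Finset.HasAntidiagonal.antidiagonal n, wedgeTo R L B x.1 x.2 n (χ x.1) (η x.2)

variable {R L B} in
theorem mulFun_apply (χ η : TotalForm R L B) (n : ℕ) :
    mulFun χ η n = ∑ x ∈ Finset.HasAntidiagonal.antidiagonal n,
      wedgeTo R L B x.1 x.2 n (χ x.1) (η x.2) := rfl

/-- The wedge product as a bilinear map. -/
def mulMap : TotalForm R L B →ₗ[ℂ] TotalForm R L B →ₗ[ℂ] TotalForm R L B :=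
  LinearMap.mk₂ ℂ mulFun
    (fun χ χ' η => TotalForm.ext fun n => by
      simp only [mulFun_apply, add_apply, map_add, LinearMap.add_apply, Finset.sum_add_distrib])
    (fun c χ η => TotalForm.ext fun n => by
      simp only [mulFun_apply, smul_apply, map_smul, LinearMap.smul_apply, Finset.smul_sum])
    (fun χ η η' => TotalForm.ext fun n => by
      simp only [mulFun_apply, add_apply, map_add, Finset.sum_add_distrib])
    (fun c χ η => TotalForm.ext fun n => by
      simp only [mulFun_apply, smul_apply, map_smul, Finset.smul_sum])

instance : Mul (TotalForm R L B) := ⟨fun χ η => mulMap R L B χ η⟩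

/-- The constant function `1`. -/
instance : One (TotalForm R L B) :=
  ⟨single 0 (AlternatingMap.constOfIsEmpty R L (Fin 0) (1 : B))⟩

variable {R L B}

theorem mul_apply (χ η : TotalForm R L B) (n : ℕ) :
    (χ * η) n = ∑ x ∈ Finset.HasAntidiagonal.antidiagonal n,
      wedgeTo R L B x.1 x.2 n (χ x.1) (η x.2) := rfl

theorem one_def :
    (1 : TotalForm R L B) = single 0 (AlternatingMap.constOfIsEmpty R L (Fin 0) (1 : B)) := rfl

theorem mul_apply_zero (χ η : TotalForm R L B) (v : Fin 0 → L) :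
    (χ * η) 0 v = χ 0 v * η 0 v := by
  rw [mul_apply]
  simp [wedgeTo_eq, wedge_zero_zero, Subsingleton.elim v ![]]

/-- Summing the homogeneous rule over the pairs of total degree `n + 1`, the terms that contract a
factor of degree zero drop out, which leaves two sums over the pairs of total degree `n`. -/
theorem contract_mul (Z : L) (χ η : TotalForm R L B) :
    contract Z (χ * η) = contract Z χ * η + alt χ * contract Z η := by
  refine TotalForm.ext fun n => ?_
  have h1 : contract Z (χ * η) n = ∑ x ∈ Finset.HasAntidiagonal.antidiagonal (n + 1),
      (wedgeTo R L B x.1 x.2 (n + 1) (χ x.1) (η x.2)).curryLeft Z := by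
    rw [contract_apply, mul_apply]
    exact map_sum ((LinearMap.applyₗ Z).comp AlternatingMap.curryLeftLinearMap) _ _
  rw [h1, Finset.sum_congr rfl fun x hx =>
    curryLeft_wedgeTo (Finset.HasAntidiagonal.mem_antidiagonal.1 hx) (χ x.1) (η x.2) Z,
    Finset.sum_add_distrib, add_apply, mul_apply, mul_apply,
    Finset.Nat.sum_antidiagonal_succ, Finset.Nat.sum_antidiagonal_succ']
  simp only [Form.contractPred, map_zero, LinearMap.zero_apply, zero_add, smul_zero,
    alt_apply, map_smul, LinearMap.smul_apply]
  rfl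

theorem contract_one (Z : L) : contract Z (1 : TotalForm R L B) = 0 := by
  refine TotalForm.ext fun n => ?_
  rw [contract_apply, one_def, single_ne (Nat.succ_ne_zero n)]
  rfl

theorem alt_one : alt (1 : TotalForm R L B) = 1 := by
  rw [one_def, alt_single, pow_zero, one_smul]

theorem alt_mul (χ η : TotalForm R L B) : alt (χ * η) = alt χ * alt η := by
  refine TotalForm.ext fun n => ?_
  rw [alt_apply, mul_apply, mul_apply, Finset.smul_sum]
  refine Finset.sum_congr rfl fun x hx => ?_
  rw [alt_apply, alt_apply, map_smul, map_smul, LinearMap.smul_apply, smul_smul, ← pow_add,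
    add_comm x.2, Finset.HasAntidiagonal.mem_antidiagonal.1 hx]

theorem one_mul_apply_zero (χ : TotalForm R L B) (v : Fin 0 → L) :
    (1 * χ) 0 v = χ 0 v := by
  rw [mul_apply_zero, one_def, single_same]
  simp

theorem mul_one_apply_zero (χ : TotalForm R L B) (v : Fin 0 → L) :
    (χ * 1) 0 v = χ 0 v := by
  rw [mul_apply_zero, one_def, single_same]
  simp

theorem mul_add' (χ η ζ : TotalForm R L B) : χ * (η + ζ) = χ * η + χ * ζ := map_add _ _ _

theorem add_mul' (χ η ζ : TotalForm R L B) : (χ + η) * ζ = χ * ζ + η * ζ :=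
  LinearMap.map_add₂ _ _ _ _

theorem mul_zero' (χ : TotalForm R L B) : χ * 0 = 0 := map_zero _

theorem zero_mul' (χ : TotalForm R L B) : 0 * χ = 0 := LinearMap.map_zero₂ _ _

theorem one_mul' (χ : TotalForm R L B) : 1 * χ = χ := by
  have key : ∀ (n : ℕ) (χ : TotalForm R L B), (1 * χ - χ) n = 0 := by
    intro n
    induction n with
    | zero =>
      intro χ
      ext v
      simp [sub_apply, one_mul_apply_zero]
    | succ n ih =>
      intro χ
      refine apply_succ_eq_zero fun Z => ?_
      rw [map_sub, contract_mul, contract_one, zero_mul', zero_add, alt_one, ih]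
  exact TotalForm.ext fun n => sub_eq_zero.1 (key n χ)

theorem mul_one' (χ : TotalForm R L B) : χ * 1 = χ := by
  have key : ∀ (n : ℕ) (χ : TotalForm R L B), (χ * 1 - χ) n = 0 := by
    intro n
    induction n with
    | zero =>
      intro χ
      ext v
      simp [sub_apply, mul_one_apply_zero]
    | succ n ih =>
      intro χ
      refine apply_succ_eq_zero fun Z => ?_
      rw [map_sub, contract_mul, contract_one, mul_zero', add_zero, ih]
  exact TotalForm.ext fun n => sub_eq_zero.1 (key n χ)

/-- Induction on the degree, for all arguments at once since contraction changes them: the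
contraction of an associator is a sum of three associators, and in degree zero the product is that
of `B`. -/
theorem mul_assoc' (χ η ζ : TotalForm R L B) : χ * η * ζ = χ * (η * ζ) := by
  have key : ∀ (n : ℕ) (χ η ζ : TotalForm R L B), (χ * η * ζ - χ * (η * ζ)) n = 0 := by
    intro n
    induction n with
    | zero =>
      intro χ η ζ
      ext v
      simp [sub_apply, mul_apply_zero, mul_assoc]
    | succ n ih =>
      intro χ η ζ
      refine apply_succ_eq_zero fun Z => ?_
      have : contract Z (χ * η * ζ - χ * (η * ζ)) =
          (contract Z χ * η * ζ - contract Z χ * (η * ζ)) +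
          (alt χ * contract Z η * ζ - alt χ * (contract Z η * ζ)) +
          (alt χ * alt η * contract Z ζ - alt χ * (alt η * contract Z ζ)) := by
        simp only [map_sub, contract_mul, alt_mul, mul_add', add_mul']
        abel
      rw [this, add_apply, add_apply, ih, ih, ih, add_zero, add_zero]
  exact TotalForm.ext fun n => sub_eq_zero.1 (key n χ η ζ)

instance : Ring (TotalForm R L B) where
  mul_assoc := mul_assoc'
  one_mul := one_mul'
  mul_one := mul_one'
  left_distrib := mul_add'
  right_distrib := add_mul'
  zero_mul := zero_mul'
  mul_zero := mul_zero'
  neg_add_cancel := neg_add_cancel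
  zsmul := (· • ·)
  zsmul_zero' := zero_zsmul
  zsmul_succ' := SubNegMonoid.zsmul_succ'
  zsmul_neg' := SubNegMonoid.zsmul_neg'
  nsmul := (· • ·)
  nsmul_zero := zero_nsmul
  nsmul_succ := AddMonoid.nsmul_succ
  sub_eq_add_neg := sub_eq_add_neg

instance : Algebra ℂ (TotalForm R L B) :=
  Algebra.ofModule (fun c χ η => LinearMap.map_smul₂ _ c χ η) (fun c _ η => map_smul _ c η)

/-- With `single_injective`, identities between wedge products of fixed degrees become identities in
the ring, where no degree has to be transported along an equation. -/
theorem single_mul_single {p q n : ℕ} (h : p + q = n) (θ : Form R L B p) (η : Form R L B q) :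
    single p θ * single q η = single n (wedge (LinearMap.mul R B) h θ η) := by
  refine TotalForm.ext fun m => ?_
  rw [mul_apply]
  rcases eq_or_ne m n with rfl | hm
  · rw [single_same, Finset.sum_eq_single (p, q)]
    · rw [single_same, single_same, wedgeTo_eq h]
    · rintro ⟨i, j⟩ hij hne
      rw [Finset.HasAntidiagonal.mem_antidiagonal] at hij
      have : i ≠ p := by
        rintro rfl
        exact hne (by ext <;> simp at *; omega)
      rw [single_ne this, map_zero, LinearMap.zero_apply]
    · intro hne
      exact absurd (Finset.HasAntidiagonal.mem_antidiagonal.2 h) hne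
  · rw [single_ne hm]
    refine Finset.sum_eq_zero ?_
    rintro ⟨i, j⟩ hij
    rw [Finset.HasAntidiagonal.mem_antidiagonal] at hij
    rcases eq_or_ne i p with rfl | hi
    · have : j ≠ q := by rintro rfl; exact hm (by rw [← h, ← hij])
      rw [single_ne this, map_zero]
    · rw [single_ne hi, map_zero, LinearMap.zero_apply]

end TotalForm

end Product

/-! ### Cartan calculus and `d² = 0` -/

section Differential

variable {R : Type u₁} [CommRing R] [Algebra ℂ R]
  {L : Type u₂} [LieRing L] [Module R L] [LieRingModule L R] [LieRinehartRing R L]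
  [LieAlgebra ℂ L] [LieRinehartAlgebra ℂ R L]
  {W : Type u₃} [AddCommGroup W] [Module R W] [Module ℂ W] [IsScalarTower ℂ R W]

/-- The curvature of the semi-connection vanishes. -/
def SemiConnection.IsFlat (D : SemiConnection R L W) : Prop :=
  ∀ (Z Y : L) (s : W), D.nabla Z (D.nabla Y s) - D.nabla Y (D.nabla Z s) = D.nabla ⁅Z, Y⁆ s

theorem SemiConnection.d_apply (D : SemiConnection R L W) {q : ℕ} (θ : Form R L W q)
    (v : Fin (q + 1) → L) : D.d q θ v = koszul D θ v := rfl

theorem SemiConnection.d_zero_apply_cons (D : SemiConnection R L W) (θ : Form R L W 0) (Z : L)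
    (t : Fin 0 → L) : D.d 0 θ (Fin.cons Z t) = D.nabla Z (θ t) := by
  rw [D.d_apply, koszul_apply]
  simp [Subsingleton.elim _ t]

/-- Cartan's formula for the Lie derivative of a form of positive degree. -/
theorem SemiConnection.d_succ_apply_cons (D : SemiConnection R L W) {q : ℕ}
    (θ : Form R L W (q + 1)) (Z : L) (t : Fin (q + 1) → L) :
    D.d (q + 1) θ (Fin.cons Z t) + D.d q (θ.curryLeft Z) t =
      D.nabla Z (θ t) - ∑ j, θ (Function.update t j ⁅Z, t j⁆) := by
  have hc : ∀ s : Fin q → L, θ.curryLeft Z s = θ (Fin.cons Z s) := fun _ => rfl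
  -- The term with `[Z, t k]` occurs twice in the Koszul double sum, with `Z` as outer and as inner
  -- vector. Here the second occurrence is matched to the first, so that the factor `½` disappears.
  have e : ∀ k : Fin (q + 1), (-1) ^ (k : ℕ) • θ (Fin.cons ⁅t k, Z⁆ (k.removeNth t)) =
      -θ (Function.update t k ⁅Z, t k⁆) := by
    intro k
    rw [← Form.map_update_eq, ← lie_skew, AlternatingMap.map_update_neg]
  have e' : ∀ k : Fin (q + 1), ∑ j, θ (Function.update (Fin.cons Z (k.removeNth t) :
          Fin (q + 1) → L) j ⁅t k, (Fin.cons Z (k.removeNth t) : Fin (q + 1) → L) j⁆) =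
      θ (Fin.cons ⁅t k, Z⁆ (k.removeNth t)) +
        ∑ j, θ (Fin.cons Z (Function.update (k.removeNth t) j ⁅t k, k.removeNth t j⁆)) := by
    intro k
    rw [Fin.sum_univ_succ]
    simp only [Fin.cons_zero, Fin.cons_succ, Fin.update_cons_zero, ← Fin.cons_update]
  rw [D.d_apply, D.d_apply, koszul_apply, koszul_apply, Fin.sum_univ_succ (n := q + 1),
    Fin.sum_univ_succ (n := q + 1)]
  simp only [removeNth_succ_cons, removeNth_zero_cons, Fin.cons_zero, Fin.cons_succ, e', hc]
  simp only [Fin.val_zero, pow_zero, one_smul, Fin.val_succ, pow_succ, mul_neg_one, neg_smul,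
    smul_add, Finset.sum_add_distrib, Finset.sum_neg_distrib, e, smul_neg, neg_neg]
  module

namespace TotalForm

/-- The differential on forms of all degrees. -/
def diff (D : SemiConnection R L W) : TotalForm R L W →ₗ[ℂ] TotalForm R L W where
  toFun χ
    | 0 => 0
    | n + 1 => D.d n (χ n)
  map_add' χ η := TotalForm.ext fun n => by
    cases n with
    | zero => exact (add_zero _).symm
    | succ n => exact map_add _ _ _
  map_smul' c χ := TotalForm.ext fun n => by
    cases n with
    | zero => exact (smul_zero c).symm
    | succ n => exact (D.d n).map_smul c (χ n)

theorem diff_apply_zero (D : SemiConnection R L W) (χ : TotalForm R L W) :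
    diff D χ 0 = 0 := rfl

theorem diff_apply_succ (D : SemiConnection R L W) (χ : TotalForm R L W) (n : ℕ) :
    diff D χ (n + 1) = D.d n (χ n) := rfl

theorem diff_single (D : SemiConnection R L W) (p : ℕ) (θ : Form R L W p) :
    diff D (single p θ) = single (p + 1) (D.d p θ) := by
  refine TotalForm.ext fun n => ?_
  cases n with
  | zero => rw [diff_apply_zero, single_ne (Nat.succ_ne_zero p).symm]
  | succ n =>
    rw [diff_apply_succ]
    rcases eq_or_ne n p with rfl | h
    · rw [single_same, single_same]
    · rw [single_ne h, single_ne (by omega), map_zero]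

theorem diff_alt (D : SemiConnection R L W) (χ : TotalForm R L W) :
    diff D (alt χ) = -alt (diff D χ) := by
  refine TotalForm.ext fun n => ?_
  cases n with
  | zero =>
    rw [neg_apply, alt_apply, diff_apply_zero, diff_apply_zero, smul_zero, neg_zero]
  | succ n =>
    rw [neg_apply, alt_apply, diff_apply_succ, diff_apply_succ, alt_apply, map_smul, pow_succ,
      mul_neg_one, neg_smul, neg_neg]

/-- The Lie derivative along a vector, defined by Cartan's formula. -/
def lieDeriv (D : SemiConnection R L W) (Z : L) : TotalForm R L W →ₗ[ℂ] TotalForm R L W :=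
  contract Z ∘ₗ diff D + diff D ∘ₗ contract Z

variable (D : SemiConnection R L W)

theorem contract_diff (Z : L) (χ : TotalForm R L W) :
    contract Z (diff D χ) = lieDeriv D Z χ - diff D (contract Z χ) := by
  rw [lieDeriv, LinearMap.add_apply, LinearMap.comp_apply, LinearMap.comp_apply,
    add_sub_cancel_right]

theorem lieDeriv_apply (Z : L) (χ : TotalForm R L W) (n : ℕ) (t : Fin n → L) :
    lieDeriv D Z χ n t =
      D.nabla Z (χ n t) - ∑ j, χ n (Function.update t j ⁅Z, t j⁆) := by
  rw [lieDeriv, LinearMap.add_apply, LinearMap.comp_apply, LinearMap.comp_apply, add_apply,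
    AlternatingMap.add_apply, contract_apply, diff_apply_succ]
  cases n with
  | zero =>
    rw [diff_apply_zero, AlternatingMap.zero_apply, add_zero, Finset.univ_eq_empty,
      Finset.sum_empty, sub_zero]
    exact D.d_zero_apply_cons (χ 0) Z t
  | succ n => exact D.d_succ_apply_cons (χ (n + 1)) Z t

/-- In the explicit formula for the Lie derivative at `(Y, t)`, the summand that brackets the first
argument is the contraction with `[Z, Y]`. -/
theorem contract_lieDeriv (Z Y : L) (χ : TotalForm R L W) :
    contract Y (lieDeriv D Z χ) =
      lieDeriv D Z (contract Y χ) - contract ⁅Z, Y⁆ χ := by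
  refine TotalForm.ext fun n => ?_
  ext t
  have hc : ∀ (X : L) (s : Fin n → L), contract X χ n s = χ (n + 1) (Fin.cons X s) :=
    fun _ _ => rfl
  have h1 : contract Y (lieDeriv D Z χ) n t = lieDeriv D Z χ (n + 1) (Fin.cons Y t) := rfl
  rw [sub_apply, AlternatingMap.sub_apply, h1, lieDeriv_apply, lieDeriv_apply,
    Fin.sum_univ_succ]
  simp only [hc, Fin.cons_zero, Fin.cons_succ, Fin.update_cons_zero, ← Fin.cons_update]
  abel

theorem lieDeriv_alt (Z : L) (χ : TotalForm R L W) :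
    lieDeriv D Z (alt χ) = alt (lieDeriv D Z χ) := by
  simp only [lieDeriv, LinearMap.add_apply, LinearMap.comp_apply, diff_alt, contract_alt,
    map_neg, neg_neg, map_add]

variable {D}

/-- In degree zero this is flatness. In higher degree the defect commutes with contraction, because
the contractions with iterated brackets cancel by the Jacobi identity of `L`. -/
theorem lieDeriv_lieDeriv (hD : D.IsFlat) (Z Y : L) (χ : TotalForm R L W) :
    lieDeriv D Z (lieDeriv D Y χ) - lieDeriv D Y (lieDeriv D Z χ) = lieDeriv D ⁅Z, Y⁆ χ := by
  have key : ∀ (n : ℕ) (χ : TotalForm R L W), (lieDeriv D Z (lieDeriv D Y χ) -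
      lieDeriv D Y (lieDeriv D Z χ) - lieDeriv D ⁅Z, Y⁆ χ) n = 0 := by
    intro n
    induction n with
    | zero =>
      intro χ
      ext t
      simp [sub_apply, lieDeriv_apply, ← hD Z Y]
    | succ n ih =>
      intro χ
      refine apply_succ_eq_zero fun X => ?_
      have h : contract ⁅⁅Z, Y⁆, X⁆ χ =
          contract ⁅Z, ⁅Y, X⁆⁆ χ - contract ⁅Y, ⁅Z, X⁆⁆ χ := by
        rw [lie_lie]
        refine TotalForm.ext fun m => ?_
        exact map_sub (χ (m + 1)).curryLeft _ _
      have : contract X (lieDeriv D Z (lieDeriv D Y χ) - lieDeriv D Y (lieDeriv D Z χ) -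
          lieDeriv D ⁅Z, Y⁆ χ) = lieDeriv D Z (lieDeriv D Y (contract X χ)) -
          lieDeriv D Y (lieDeriv D Z (contract X χ)) - lieDeriv D ⁅Z, Y⁆ (contract X χ) := by
        simp only [map_sub, contract_lieDeriv, h]
        abel
      rw [this, ih]
  exact TotalForm.ext fun n => sub_eq_zero.1 (key n χ)

/-- Both sides vanish in degree zero. Contraction with `Y` turns the commutator `[L_Z, d]` into
minus the commutator on the contracted form, plus the defect of `lieDeriv_lieDeriv`, which is zero.
-/
theorem lieDeriv_diff (hD : D.IsFlat) (Z : L) (χ : TotalForm R L W) :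
    lieDeriv D Z (diff D χ) = diff D (lieDeriv D Z χ) := by
  have key : ∀ (n : ℕ) (χ : TotalForm R L W),
      (lieDeriv D Z (diff D χ) - diff D (lieDeriv D Z χ)) n = 0 := by
    intro n
    induction n with
    | zero =>
      intro χ
      ext t
      simp [sub_apply, lieDeriv_apply, diff_apply_zero]
    | succ n ih =>
      intro χ
      refine apply_succ_eq_zero fun Y => ?_
      have : contract Y (lieDeriv D Z (diff D χ) - diff D (lieDeriv D Z χ)) =
          -(lieDeriv D Z (diff D (contract Y χ)) - diff D (lieDeriv D Z (contract Y χ))) := by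
        simp only [map_sub, contract_lieDeriv, contract_diff, ← lieDeriv_lieDeriv hD Z Y χ]
        abel
      rw [this, neg_apply, ih, neg_zero]
  exact TotalForm.ext fun n => sub_eq_zero.1 (key n χ)

/-- From `ι_Z d = L_Z - d ι_Z` and `L_Z d = d L_Z` follows `ι_Z d² = d² ι_Z`, which lowers the
degree. -/
theorem diff_diff (hD : D.IsFlat) (χ : TotalForm R L W) : diff D (diff D χ) = 0 := by
  have key : ∀ (n : ℕ) (χ : TotalForm R L W), (diff D (diff D χ)) n = 0 := by
    intro n
    induction n with
    | zero => intro χ; rfl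
    | succ n ih =>
      intro χ
      refine apply_succ_eq_zero fun Z => ?_
      rw [contract_diff, contract_diff, map_sub, lieDeriv_diff hD, sub_sub_cancel, ih]
  exact TotalForm.ext fun n => key n χ

end TotalForm

/-- Evaluate `D (D s) = 0` at the pair `(Z, Y)` by Cartan's formula: the result is the curvature of
the pair applied to `s`. -/
theorem SemiConnection.IsIntegrable.isFlat {D : SemiConnection R L W} (hD : D.IsIntegrable) :
    D.IsFlat := by
  intro Z Y s
  have h1 := D.d_succ_apply_cons (D.toFun s) Z (fun _ => Y)
  have h2 : ∀ θ : Form R L W 0, D.d 0 θ (fun _ => Y) = D.nabla Y (θ ![]) := by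
    intro θ
    rw [← D.d_zero_apply_cons θ Y ![]]
    congr 1
    funext i
    exact Fin.cases rfl (fun j => j.elim0) i
  have h3 : (D.toFun s).curryLeft Z ![] = D.nabla Z s := by
    rw [D.nabla_apply, AlternatingMap.curryLeft_apply_apply]
    congr 1
    funext i
    exact Fin.cases rfl (fun j => j.elim0) i
  have h4 : ∑ j : Fin (0 + 1), D.toFun s (Function.update (fun _ => Y) j ⁅Z, Y⁆) =
      D.nabla ⁅Z, Y⁆ s := by
    refine (Fin.sum_univ_one _).trans ?_
    rw [update_fin_one, D.nabla_apply]
  rw [hD s, h2, h3, h4, AlternatingMap.zero_apply, zero_add, ← D.nabla_apply,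
    eq_sub_iff_add_eq'] at h1
  rw [← h1, add_sub_cancel_right]

theorem SemiConnection.onEnd_nabla_apply (D : SemiConnection R L W) (Z : L)
    (φ : Module.End R W) (s : W) :
    D.onEnd.nabla Z φ s = D.nabla Z (φ s) - φ (D.nabla Z s) := rfl

theorem SemiConnection.onEnd_nabla_mul (D : SemiConnection R L W) (Z : L)
    (φ ψ : Module.End R W) :
    D.onEnd.nabla Z (φ * ψ) = D.onEnd.nabla Z φ * ψ + φ * D.onEnd.nabla Z ψ := by
  ext s
  simp only [LinearMap.add_apply, Module.End.mul_apply, onEnd_nabla_apply, map_sub]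
  abel

/-- The curvature on endomorphisms is the commutator with the curvature on `W`. -/
theorem SemiConnection.IsFlat.onEnd {D : SemiConnection R L W} (hD : D.IsFlat) :
    D.onEnd.IsFlat := by
  intro Z Y φ
  ext s
  simp only [LinearMap.sub_apply, SemiConnection.onEnd_nabla_apply, map_sub, ← hD Z Y]
  abel

end Differential

/-! ### The graded Leibniz rule -/

section Leibniz

variable {R : Type u₁} [CommRing R] [Algebra ℂ R]
  {L : Type u₂} [LieRing L] [Module R L] [LieRingModule L R] [LieRinehartRing R L]
  [LieAlgebra ℂ L] [LieRinehartAlgebra ℂ R L]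
  {B : Type u₃} [Ring B] [Algebra R B] [Module ℂ B] [IsScalarTower ℂ R B]

/-- A semi-connection on an algebra acting by derivations. -/
def SemiConnection.IsDerivation (D : SemiConnection R L B) : Prop :=
  ∀ (Z : L) (a b : B), D.nabla Z (a * b) = D.nabla Z a * b + a * D.nabla Z b

namespace TotalForm

variable {D : SemiConnection R L B}

/-- The contraction of the defect is the sum of two defects of lower degree; the terms with `[Z, Y]`
cancel because contraction with `[Z, Y]` is an antiderivation too. -/
theorem lieDeriv_mul (hD : D.IsDerivation) (Z : L) (χ η : TotalForm R L B) :
    lieDeriv D Z (χ * η) = lieDeriv D Z χ * η + χ * lieDeriv D Z η := by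
  have key : ∀ (n : ℕ) (χ η : TotalForm R L B),
      (lieDeriv D Z (χ * η) - (lieDeriv D Z χ * η + χ * lieDeriv D Z η)) n = 0 := by
    intro n
    induction n with
    | zero =>
      intro χ η
      ext t
      simp [sub_apply, add_apply, lieDeriv_apply, mul_apply_zero, hD Z]
    | succ n ih =>
      intro χ η
      refine apply_succ_eq_zero fun Y => ?_
      have : contract Y (lieDeriv D Z (χ * η) - (lieDeriv D Z χ * η + χ * lieDeriv D Z η)) =
          (lieDeriv D Z (contract Y χ * η) -
            (lieDeriv D Z (contract Y χ) * η + contract Y χ * lieDeriv D Z η)) +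
          (lieDeriv D Z (alt χ * contract Y η) -
            (lieDeriv D Z (alt χ) * contract Y η + alt χ * lieDeriv D Z (contract Y η))) := by
        simp only [map_sub, map_add, contract_lieDeriv, contract_mul, lieDeriv_alt, mul_sub,
          sub_mul]
        abel
      rw [this, add_apply, ih, ih, add_zero]
  exact TotalForm.ext fun n => sub_eq_zero.1 (key n χ η)

/-- Cartan's formula rewrites each contracted derivative; the Lie derivatives cancel by
`lieDeriv_mul`, and two Leibniz defects of lower degree remain. -/
theorem diff_mul (hD : D.IsDerivation) (χ η : TotalForm R L B) :
    diff D (χ * η) = diff D χ * η + alt χ * diff D η := by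
  have key : ∀ (n : ℕ) (χ η : TotalForm R L B),
      (diff D (χ * η) - (diff D χ * η + alt χ * diff D η)) n = 0 := by
    intro n
    induction n with
    | zero =>
      intro χ η
      ext t
      simp [sub_apply, add_apply, diff_apply_zero, mul_apply_zero]
    | succ n ih =>
      intro χ η
      refine apply_succ_eq_zero fun Z => ?_
      have : contract Z (diff D (χ * η) - (diff D χ * η + alt χ * diff D η)) =
          -(diff D (contract Z χ * η) -
            (diff D (contract Z χ) * η + alt (contract Z χ) * diff D η)) -
          (diff D (alt χ * contract Z η) -
            (diff D (alt χ) * contract Z η + alt (alt χ) * diff D (contract Z η))) := by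
        simp only [map_sub, map_add, contract_diff, contract_mul, lieDeriv_mul hD, diff_alt,
          contract_alt, mul_sub, sub_mul, alt_alt, neg_mul]
        abel
      rw [this, sub_apply, neg_apply, ih, ih, neg_zero, sub_zero]
  exact TotalForm.ext fun n => sub_eq_zero.1 (key n χ η)

end TotalForm

end Leibniz

/-! ### The differential graded Lie algebra of endomorphism-valued forms -/

section EndForms

variable {R : Type u₁} [CommRing R] [Algebra ℂ R]
  {L : Type u₂} [LieRing L] [Module R L] [LieRingModule L R] [LieRinehartRing R L]
  [LieAlgebra ℂ L] [LieRinehartAlgebra ℂ R L]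
  {W : Type u₃} [AddCommGroup W] [Module R W] [Module ℂ W] [IsScalarTower ℂ R W]

namespace SemiConnection

theorem onEnd_isDerivation (D : SemiConnection R L W) : D.onEnd.IsDerivation :=
  fun Z φ ψ => D.onEnd_nabla_mul Z φ ψ

theorem single_mulForm {p q n : ℕ} (h : p + q = n) (x : Form R L (Module.End R W) p)
    (y : Form R L (Module.End R W) q) :
    TotalForm.single n (mulForm R L W h x y) = TotalForm.single p x * TotalForm.single q y :=
  (TotalForm.single_mul_single h x y).symm

theorem gradedCommutator_apply {p q n : ℕ} (h : p + q = n) (x : Form R L (Module.End R W) p)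
    (y : Form R L (Module.End R W) q) :
    gradedCommutator R L W h x y = mulForm R L W h x y -
      (-1 : ℂ) ^ (p * q) • mulForm R L W ((add_comm q p).trans h) y x := rfl

theorem single_gradedCommutator {p q n : ℕ} (h : p + q = n) (x : Form R L (Module.End R W) p)
    (y : Form R L (Module.End R W) q) :
    TotalForm.single n (gradedCommutator R L W h x y) =
      TotalForm.single p x * TotalForm.single q y -
        (-1 : ℂ) ^ (p * q) • (TotalForm.single q y * TotalForm.single p x) := by
  rw [gradedCommutator_apply, map_sub, map_smul, single_mulForm, single_mulForm]

theorem IsFlat.onEnd_d_d {D : SemiConnection R L W} (hD : D.IsFlat) {n : ℕ}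
    (x : Form R L (Module.End R W) n) : D.onEnd.d (n + 1) (D.onEnd.d n x) = 0 := by
  refine TotalForm.single_injective (n + 1 + 1) ?_
  rw [← TotalForm.diff_single, ← TotalForm.diff_single, TotalForm.diff_diff hD.onEnd, map_zero]

theorem gradedCommutator_antisymm {p q n : ℕ} (h : p + q = n) (h' : q + p = n)
    (x : Form R L (Module.End R W) p) (y : Form R L (Module.End R W) q) :
    gradedCommutator R L W h x y = -((-1 : ℂ) ^ (p * q) • gradedCommutator R L W h' y x) := by
  refine TotalForm.single_injective n ?_
  rw [map_neg, map_smul, single_gradedCommutator, single_gradedCommutator, mul_comm q p,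
    smul_sub, smul_smul, ← mul_pow, neg_one_mul, neg_neg, one_pow, one_smul, neg_sub]

/-- In the associative ring `TotalForm` both sides expand into signed products of the three forms,
and only the signs have to be compared. -/
theorem gradedCommutator_jacobi {p q r pq qr pr n : ℕ} (hpq : p + q = pq) (hqr : q + r = qr)
    (hpr : p + r = pr) (h₁ : p + qr = n) (h₂ : pq + r = n) (h₃ : q + pr = n)
    (x : Form R L (Module.End R W) p) (y : Form R L (Module.End R W) q)
    (z : Form R L (Module.End R W) r) :
    gradedCommutator R L W h₁ x (gradedCommutator R L W hqr y z) =
      gradedCommutator R L W h₂ (gradedCommutator R L W hpq x y) z +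
        (-1 : ℂ) ^ (p * q) • gradedCommutator R L W h₃ y (gradedCommutator R L W hpr x z) := by
  refine TotalForm.single_injective n ?_
  subst hpq hqr hpr
  have hs : ∀ k : ℕ, (-1 : ℂ) ^ k * (-1 : ℂ) ^ k = 1 := fun k => by
    rw [← mul_pow, neg_one_mul, neg_neg, one_pow]
  simp only [map_add, map_smul, single_gradedCommutator, mul_sub, sub_mul, mul_add, add_mul,
    smul_sub, mul_smul_comm, smul_mul_assoc, smul_smul, mul_assoc, pow_add, mul_comm q p]
  -- Once repeated signs are cancelled, the remaining ones can be treated as independent scalars.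
  have e1 : (-1 : ℂ) ^ (p * q) * ((-1) ^ (p * q) * (-1) ^ (q * r)) = (-1) ^ (q * r) := by
    rw [← mul_assoc, hs, one_mul]
  have e2 : (-1 : ℂ) ^ (p * q) * ((-1) ^ (p * q) * ((-1) ^ (q * r) * (-1) ^ (p * r))) =
      (-1) ^ (q * r) * (-1) ^ (p * r) := by
    rw [← mul_assoc, hs, one_mul]
  simp only [e1, e2]
  module

theorem onEnd_d_gradedCommutator (D : SemiConnection R L W) {p q n : ℕ} (h : p + q = n)
    (h₁ : p + 1 + q = n + 1) (h₂ : p + (q + 1) = n + 1)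
    (x : Form R L (Module.End R W) p) (y : Form R L (Module.End R W) q) :
    D.onEnd.d n (gradedCommutator R L W h x y) =
      gradedCommutator R L W h₁ (D.onEnd.d p x) y +
        (-1 : ℂ) ^ p • gradedCommutator R L W h₂ x (D.onEnd.d q y) := by
  refine TotalForm.single_injective (n + 1) ?_
  have e : (-1 : ℂ) ^ p * ((-1) ^ (p * q) * (-1) ^ p) = (-1) ^ (p * q) := by
    rw [mul_left_comm, ← mul_pow, neg_one_mul, neg_neg, one_pow, mul_one]
  simp only [map_add, map_smul, single_gradedCommutator, ← TotalForm.diff_single, map_sub,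
    TotalForm.diff_mul D.onEnd_isDerivation, TotalForm.alt_single,
    smul_sub, smul_mul_assoc, smul_smul, add_mul, mul_add, pow_add, one_mul,
    mul_one, smul_add, e]
  module

/-- Endomorphism-valued forms are a differential graded Lie algebra. -/
theorem IsFlat.isDGLA_endForms {D : SemiConnection R L W} (hD : D.IsFlat) :
    D.endForms.IsDGLA where
  d_d _ x := hD.onEnd_d_d x
  antisymm h h' x y := gradedCommutator_antisymm (W := W) h h' x y
  jacobi hpq hqr hpr h₁ h₂ h₃ x y z :=
    gradedCommutator_jacobi (W := W) hpq hqr hpr h₁ h₂ h₃ x y z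
  leibniz h h₁ h₂ x y := D.onEnd_d_gradedCommutator h h₁ h₂ x y

end SemiConnection

end EndForms

/-! ### Exponentials of nilpotent elements -/

section Exponential

variable {S : Type*} [Ring S] [Algebra ℂ S]

/-- The partial sum `∑_{i < N} aⁱ / i!` of the exponential series. -/
def expSum (N : ℕ) (a : S) : S := ∑ i ∈ Finset.range N, ((i.factorial : ℂ)⁻¹) • a ^ i

/-- Gives access to the exponential laws of `IsNilpotent.exp`, which has rational coefficients;
`expSum` has complex ones and a truncation `N` that does not depend on `a`. -/
theorem expSum_eq_exp [Module ℚ S] {N : ℕ} {a : S} (h : a ^ N = 0) :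
    expSum N a = IsNilpotent.exp a := by
  rw [IsNilpotent.exp_eq_sum h, expSum]
  refine Finset.sum_congr rfl fun i _ => ?_
  rw [← Rat.cast_smul_eq_qsmul ℂ, Rat.cast_inv, Rat.cast_natCast]

theorem expSum_neg_mul_expSum {N : ℕ} {a : S} (h : a ^ N = 0) :
    expSum N (-a) * expSum N a = 1 := by
  let _ : Module ℚ S := Module.compHom S (algebraMap ℚ ℂ)
  have h' : (-a) ^ N = 0 := by rw [neg_pow, h, mul_zero]
  rw [expSum_eq_exp h, expSum_eq_exp h', IsNilpotent.exp_neg_mul_exp_self ⟨N, h⟩]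

theorem expSum_mul_expSum_neg {N : ℕ} {a : S} (h : a ^ N = 0) :
    expSum N a * expSum N (-a) = 1 := by
  let _ : Module ℚ S := Module.compHom S (algebraMap ℚ ℂ)
  have h' : (-a) ^ N = 0 := by rw [neg_pow, h, mul_zero]
  rw [expSum_eq_exp h, expSum_eq_exp h', IsNilpotent.exp_mul_exp_neg_self ⟨N, h⟩]

/-- The commutator `y ↦ a y - y a`. -/
def commLeft (a : S) : Module.End ℂ S := LinearMap.mulLeft ℂ a - LinearMap.mulRight ℂ a

theorem commLeft_apply (a y : S) : commLeft a y = a * y - y * a := rfl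

/-- `e^a y = (e^{ad a} y) e^a`. -/
theorem expSum_mul {N M : ℕ} {a : S} (h : a ^ N = 0) (hM : commLeft a ^ M = 0) (y : S) :
    expSum N a * y =
      (∑ n ∈ Finset.range M, ((n.factorial : ℂ)⁻¹) • (commLeft a ^ n) y) * expSum N a := by
  let _ : Module ℚ S := Module.compHom S (algebraMap ℚ ℂ)
  let _ : Module ℚ (Module.End ℂ S) := Module.compHom _ (algebraMap ℚ ℂ)
  have hl : LinearMap.mulLeft ℂ a ^ N = 0 := by rw [LinearMap.pow_mulLeft, h]; ext; simp
  have hr : LinearMap.mulRight ℂ a ^ N = 0 := by rw [LinearMap.pow_mulRight, h]; ext; simp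
  -- Left multiplication is right multiplication plus the commutator, and these two operators
  -- commute, so the exponential of the sum factors.
  have hcomm : Commute (LinearMap.mulRight ℂ a) (commLeft a) :=
    (LinearMap.commute_mulLeft_right a a).symm.sub_right (Commute.refl _)
  have key := IsNilpotent.exp_add_of_commute hcomm ⟨N, hr⟩ ⟨M, hM⟩
  rw [commLeft, add_sub_cancel, ← commLeft, ← expSum_eq_exp hl, ← expSum_eq_exp hM,
    ← expSum_eq_exp hr] at key
  have h1 : expSum N (LinearMap.mulLeft ℂ a) y = expSum N a * y := by
    simp [expSum, LinearMap.pow_mulLeft, Finset.sum_mul]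
  have h2 : ∀ z, expSum N (LinearMap.mulRight ℂ a) z = z * expSum N a := by
    intro z
    simp [expSum, LinearMap.pow_mulRight, Finset.mul_sum]
  have h3 : expSum M (commLeft a) y =
      ∑ n ∈ Finset.range M, ((n.factorial : ℂ)⁻¹) • (commLeft a ^ n) y := by
    simp [expSum]
  rw [← h1, key, Module.End.mul_apply, h2, h3]

/-- A decreasing filtration `N₀ ⊇ N₁ ⊇ …` of a subspace `N₀` of an algebra, such that the product
of an element of `N₀` and an element of `N_k` lies in `N_{k+1}`, and `N_K = 0`. -/
structure NilFiltration (S : Type*) [Ring S] [Algebra ℂ S] where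
  N : ℕ → Submodule ℂ S
  K : ℕ
  anti : ∀ k, N (k + 1) ≤ N k
  mul_left : ∀ {k : ℕ} {a b : S}, a ∈ N 0 → b ∈ N k → a * b ∈ N (k + 1)
  mul_right : ∀ {k : ℕ} {a b : S}, b ∈ N k → a ∈ N 0 → b * a ∈ N (k + 1)
  eq_bot : N K = ⊥

namespace NilFiltration

variable (F : NilFiltration S)

theorem le_zero (k : ℕ) : F.N k ≤ F.N 0 := by
  induction k with
  | zero => exact le_rfl
  | succ k ih => exact (F.anti k).trans ih

theorem pow_succ_mem {a : S} (ha : a ∈ F.N 0) (k : ℕ) : a ^ (k + 1) ∈ F.N k := by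
  induction k with
  | zero => simpa using ha
  | succ k ih => rw [pow_succ']; exact F.mul_left ha ih

theorem pow_succ_mem_zero {a : S} (ha : a ∈ F.N 0) (k : ℕ) : a ^ (k + 1) ∈ F.N 0 :=
  F.le_zero k (F.pow_succ_mem ha k)

/-- The exponent `K + 1` would do; with `K + 2` the truncated exponential always contains the terms
`1` and `a`, which `exp_eq` splits off. -/
theorem pow_eq_zero {a : S} (ha : a ∈ F.N 0) : a ^ (F.K + 2) = 0 := by
  have := F.pow_succ_mem ha F.K
  rw [F.eq_bot, Submodule.mem_bot] at this
  rw [pow_succ, this, zero_mul]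

/-- The exponential of an element of `N₀`. -/
def exp (a : S) : S := expSum (F.K + 2) a

theorem exp_neg_mul_exp {a : S} (ha : a ∈ F.N 0) : F.exp (-a) * F.exp a = 1 :=
  expSum_neg_mul_expSum (F.pow_eq_zero ha)

theorem exp_mul_exp_neg {a : S} (ha : a ∈ F.N 0) : F.exp a * F.exp (-a) = 1 :=
  expSum_mul_expSum_neg (F.pow_eq_zero ha)

theorem exp_eq (a : S) : F.exp a = 1 + a +
    ∑ i ∈ Finset.range F.K, (((i + 2).factorial : ℂ)⁻¹) • a ^ (i + 2) := by
  rw [exp, expSum, Finset.sum_range_succ', Finset.sum_range_succ']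
  simp
  abel

theorem exp_sub_one_mem {a : S} (ha : a ∈ F.N 0) : F.exp a - 1 ∈ F.N 0 := by
  rw [exp_eq, add_assoc, add_sub_cancel_left]
  exact add_mem ha (Submodule.sum_mem _ fun i _ =>
    Submodule.smul_mem _ _ (F.pow_succ_mem_zero ha (i + 1)))

/-- A perturbation in `N_k` changes the powers of exponent at least two only by elements of
`N_{k+1}`, since each term of the difference has a further factor in `N₀`. -/
theorem pow_succ_sub_mem {k : ℕ} {a r : S} (ha : a ∈ F.N 0) (hr : r ∈ F.N k) (i : ℕ) :
    (a - r) ^ (i + 1) - a ^ (i + 1) ∈ F.N k ∧ (a - r) ^ (i + 2) - a ^ (i + 2) ∈ F.N (k + 1) := by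
  have step : ∀ j, (a - r) ^ (j + 1) - a ^ (j + 1) ∈ F.N k →
      (a - r) ^ (j + 2) - a ^ (j + 2) ∈ F.N (k + 1) := by
    intro j hj
    have : (a - r) ^ (j + 2) - a ^ (j + 2) =
        (a - r) * ((a - r) ^ (j + 1) - a ^ (j + 1)) - r * a ^ (j + 1) := by
      rw [pow_succ' (a - r) (j + 1), pow_succ' a (j + 1)]
      noncomm_ring
    rw [this]
    exact sub_mem (F.mul_left (sub_mem ha (F.le_zero k hr)) hj)
      (F.mul_right hr (F.pow_succ_mem_zero ha j))
  have anti : F.N (k + 1) ≤ F.N k := F.anti k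
  induction i with
  | zero =>
    have h0 : (a - r) ^ (0 + 1) - a ^ (0 + 1) ∈ F.N k := by simpa using neg_mem hr
    exact ⟨h0, step 0 h0⟩
  | succ i ih => exact ⟨anti ih.2, step (i + 1) (anti ih.2)⟩

/-- Every element of `1 + N₀` is an exponential. -/
theorem exists_exp_eq {u : S} (hu : u - 1 ∈ F.N 0) : ∃ a ∈ F.N 0, F.exp a = u := by
  have key : ∀ k, ∃ a ∈ F.N 0, F.exp a - u ∈ F.N k := by
    intro k
    induction k with
    | zero =>
      refine ⟨0, zero_mem _, ?_⟩
      have : F.exp 0 = 1 := by simp [exp_eq]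
      rw [this, ← neg_sub]
      exact neg_mem hu
    | succ k ih =>
      obtain ⟨a, ha, hr⟩ := ih
      -- Subtracting the error from `a` removes it through the linear term of the exponential; the
      -- higher terms change only in `N_{k+1}`.
      refine ⟨a - (F.exp a - u), sub_mem ha (F.le_zero k hr), ?_⟩
      set r := F.exp a - u with hrdef
      have : F.exp (a - r) - u = ∑ i ∈ Finset.range F.K, (((i + 2).factorial : ℂ)⁻¹) •
          ((a - r) ^ (i + 2) - a ^ (i + 2)) := by
        have hu' : u = F.exp a - r := by rw [hrdef, sub_sub_cancel]
        rw [hu', exp_eq, exp_eq]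
        simp only [smul_sub, Finset.sum_sub_distrib]
        abel
      rw [this]
      exact Submodule.sum_mem _ fun i _ =>
        Submodule.smul_mem _ _ (F.pow_succ_sub_mem ha hr i).2
  obtain ⟨a, ha, h⟩ := key F.K
  rw [F.eq_bot, Submodule.mem_bot, sub_eq_zero] at h
  exact ⟨a, ha, h⟩

/-- Together with `exists_exp_eq` this makes a product of two exponentials an exponential. -/
theorem mul_sub_one_mem {u v : S} (hu : u - 1 ∈ F.N 0) (hv : v - 1 ∈ F.N 0) :
    u * v - 1 ∈ F.N 0 := by
  have : u * v - 1 = (u - 1) * (v - 1) + (u - 1) + (v - 1) := by noncomm_ring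
  rw [this]
  exact add_mem (add_mem (F.le_zero 1 (F.mul_left hu hv)) hu) hv

theorem exists_inverse {u : S} (hu : u - 1 ∈ F.N 0) :
    ∃ v, v - 1 ∈ F.N 0 ∧ u * v = 1 ∧ v * u = 1 := by
  obtain ⟨a, ha, rfl⟩ := F.exists_exp_eq hu
  exact ⟨F.exp (-a), F.exp_sub_one_mem (neg_mem ha), F.exp_mul_exp_neg ha, F.exp_neg_mul_exp ha⟩

end NilFiltration

end Exponential

/-! ### Endomorphism-valued forms as operators -/

section Operators

variable (R : Type u₁) [CommRing R] [Algebra ℂ R]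
  (L : Type u₂) [LieRing L] [Module R L] [LieRingModule L R] [LieRinehartRing R L]
  [LieAlgebra ℂ L] [LieRinehartAlgebra ℂ R L]
  (W : Type u₃) [AddCommGroup W] [Module R W] [Module ℂ W] [IsScalarTower ℂ R W]

/-- The operators on endomorphism-valued forms of all degrees. -/
abbrev FormOp : Type _ := Module.End ℂ (TotalForm R L (Module.End R W))

/-- The operators on endomorphism-valued forms, with coefficients in `A`. -/
abbrev FormOpAlg (A : ArtAlg.{u₄}) : Type _ := FormOp R L W ⊗[ℂ] A

/-- Endomorphism-valued forms act on each other by multiplication from the left. -/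
def leftOp (q : ℕ) : Form R L (Module.End R W) q →ₗ[ℂ] FormOp R L W :=
  (Algebra.lmul ℂ (TotalForm R L (Module.End R W))).toLinearMap ∘ₗ TotalForm.single q

variable {R L W}

theorem leftOp_apply {q : ℕ} (θ : Form R L (Module.End R W) q)
    (χ : TotalForm R L (Module.End R W)) :
    leftOp R L W q θ χ = TotalForm.single q θ * χ := rfl

theorem leftOp_mulForm {p q n : ℕ} (h : p + q = n) (x : Form R L (Module.End R W) p)
    (y : Form R L (Module.End R W) q) :
    leftOp R L W n (SemiConnection.mulForm R L W h x y) =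
      leftOp R L W p x * leftOp R L W q y := by
  ext1 χ
  rw [Module.End.mul_apply, leftOp_apply, leftOp_apply, leftOp_apply,
    SemiConnection.single_mulForm, mul_assoc]

theorem leftOp_oneForm : leftOp R L W 0 (SemiConnection.oneForm R L W) = 1 := by
  ext1 χ
  exact one_mul χ

/-- The Leibniz rule read as a commutation relation between operators. -/
theorem diff_mul_leftOp (D : SemiConnection R L W) {q : ℕ} (x : Form R L (Module.End R W) q) :
    (TotalForm.diff D.onEnd : FormOp R L W) * leftOp R L W q x =
      leftOp R L W (q + 1) (D.onEnd.d q x) +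
        (-1 : ℂ) ^ q • (leftOp R L W q x * (TotalForm.diff D.onEnd : FormOp R L W)) := by
  ext1 χ
  rw [LinearMap.add_apply, LinearMap.smul_apply, Module.End.mul_apply, Module.End.mul_apply,
    leftOp_apply, leftOp_apply, leftOp_apply, TotalForm.diff_mul D.onEnd_isDerivation,
    TotalForm.diff_single, TotalForm.alt_single, smul_mul_assoc]

/-- The component of degree `q` of the value of an operator at `1`. -/
def evalOne (q : ℕ) : FormOp R L W →ₗ[ℂ] Form R L (Module.End R W) q where
  toFun T := T 1 q
  map_add' _ _ := rfl
  map_smul' _ _ := rfl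

theorem evalOne_comp_leftOp (q : ℕ) : evalOne q ∘ₗ leftOp R L W q = LinearMap.id := by
  ext1 θ
  change leftOp R L W q θ 1 q = θ
  rw [leftOp_apply, mul_one, TotalForm.single_same]

theorem incl_injective (M : Type u₂) [AddCommGroup M] [Module ℂ M] (A : ArtAlg.{u₁}) :
    Function.Injective (incl M A) :=
  Module.Flat.lTensor_preserves_injective_linearMap A.inclMax Subtype.val_injective

/-- The operator of multiplication by a form with coefficients in `A`. -/
def opAlg (q : ℕ) (A : ArtAlg.{u₄}) :
    Form R L (Module.End R W) q ⊗[ℂ] A →ₗ[ℂ] FormOpAlg R L W A :=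
  (leftOp R L W q).rTensor A

/-- The operator of multiplication by a form with coefficients in `𝔪_A`. -/
def opMax (q : ℕ) (A : ArtAlg.{u₄}) :
    TensorMax (Form R L (Module.End R W) q) A →ₗ[ℂ] FormOpAlg R L W A :=
  opAlg q A ∘ₗ incl _ A

theorem opMax_apply (q : ℕ) (A : ArtAlg.{u₄}) (x : TensorMax (Form R L (Module.End R W) q) A) :
    opMax q A x = opAlg q A (incl _ A x) := rfl

theorem opAlg_tmul (q : ℕ) (A : ArtAlg.{u₄}) (θ : Form R L (Module.End R W) q) (a : A) :
    opAlg q A (θ ⊗ₜ a) = leftOp R L W q θ ⊗ₜ a := rfl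

theorem opMax_tmul (q : ℕ) (A : ArtAlg.{u₄}) (θ : Form R L (Module.End R W) q)
    (a : A.maxIdeal) : opMax q A (θ ⊗ₜ a) = leftOp R L W q θ ⊗ₜ (a : A) := rfl

/-- Evaluation at `1` is a left inverse before tensoring, and left inverses survive the tensor
product with `A`. -/
theorem opAlg_injective (q : ℕ) (A : ArtAlg.{u₄}) :
    Function.Injective (opAlg (R := R) (L := L) (W := W) q A) := by
  refine Function.LeftInverse.injective (g := (evalOne q).rTensor A) fun x => ?_
  rw [opAlg, ← LinearMap.comp_apply, ← LinearMap.rTensor_comp, evalOne_comp_leftOp,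
    LinearMap.rTensor_id, LinearMap.id_apply]

theorem opMax_injective (q : ℕ) (A : ArtAlg.{u₄}) :
    Function.Injective (opMax (R := R) (L := L) (W := W) q A) :=
  (opAlg_injective q A).comp (incl_injective _ A)

theorem opAlg_oneForm (A : ArtAlg.{u₄}) :
    opAlg 0 A (SemiConnection.oneForm R L W ⊗ₜ[ℂ] (1 : A)) = 1 := by
  rw [opAlg_tmul, leftOp_oneForm]
  rfl

theorem opAlg_mulForm {p q n : ℕ} (h : p + q = n) {A : ArtAlg.{u₄}}
    (x : Form R L (Module.End R W) p ⊗[ℂ] A) (y : Form R L (Module.End R W) q ⊗[ℂ] A) :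
    opAlg n A (extAlg₂ A (SemiConnection.mulForm R L W h) x y) = opAlg p A x * opAlg q A y := by
  induction x using TensorProduct.induction_on with
  | zero => simp
  | add x x' hx hx' => simp only [map_add, LinearMap.add_apply, hx, hx', add_mul]
  | tmul m a =>
    induction y using TensorProduct.induction_on with
    | zero => simp
    | add y y' hy hy' => simp only [map_add, hy, hy', mul_add]
    | tmul m' b =>
      rw [extAlg₂, TensorProduct.map₂_apply_tmul, TensorProduct.map_tmul, opAlg_tmul,
        opAlg_tmul, opAlg_tmul, leftOp_mulForm, Algebra.TensorProduct.tmul_mul_tmul, LinearMap.mul_apply']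

theorem incl_extMax₂ {M : Type u₁} [AddCommGroup M] [Module ℂ M]
    {N : Type u₂} [AddCommGroup N] [Module ℂ N] {P : Type u₃} [AddCommGroup P] [Module ℂ P]
    (A : ArtAlg.{u₄}) (β : M →ₗ[ℂ] N →ₗ[ℂ] P) (x : TensorMax M A) (y : TensorMax N A) :
    incl P A (extMax₂ A β x y) = extAlg₂ A β (incl M A x) (incl N A y) := by
  induction x using TensorProduct.induction_on with
  | zero => simp
  | add x x' hx hx' => simp only [map_add, LinearMap.add_apply, hx, hx']
  | tmul m a =>
    induction y using TensorProduct.induction_on with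
    | zero => simp
    | add y y' hy hy' => simp only [map_add, hy, hy']
    | tmul n b => rfl

theorem opMax_mulForm {p q n : ℕ} (h : p + q = n) {A : ArtAlg.{u₄}}
    (x : TensorMax (Form R L (Module.End R W) p) A)
    (y : TensorMax (Form R L (Module.End R W) q) A) :
    opMax n A (extMax₂ A (SemiConnection.mulForm R L W h) x y) = opMax p A x * opMax q A y := by
  rw [opMax_apply, incl_extMax₂, opAlg_mulForm]
  rfl

theorem opMax_gradedCommutator {p q n : ℕ} (h : p + q = n) {A : ArtAlg.{u₄}}
    (x : TensorMax (Form R L (Module.End R W) p) A)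
    (y : TensorMax (Form R L (Module.End R W) q) A) :
    opMax n A (extMax₂ A (SemiConnection.gradedCommutator R L W h) x y) =
      opMax p A x * opMax q A y - (-1 : ℂ) ^ (p * q) • (opMax q A y * opMax p A x) := by
  induction x using TensorProduct.induction_on with
  | zero => simp
  | add x x' hx hx' =>
    simp only [map_add, LinearMap.add_apply, hx, hx', add_mul, mul_add, smul_add]
    abel
  | tmul m a =>
    induction y using TensorProduct.induction_on with
    | zero => simp
    | add y y' hy hy' =>
      simp only [map_add, hy, hy', mul_add, add_mul, smul_add]
      abel
    | tmul m' b =>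
      rw [extMax₂, TensorProduct.map₂_apply_tmul, TensorProduct.map_tmul, opMax_tmul, opMax_tmul,
        opMax_tmul,
        SemiConnection.gradedCommutator_apply, map_sub, map_smul, leftOp_mulForm, leftOp_mulForm,
        Algebra.TensorProduct.tmul_mul_tmul, Algebra.TensorProduct.tmul_mul_tmul,
        TensorProduct.sub_tmul, TensorProduct.smul_tmul', ArtAlg.coe_mulMax,
        mul_comm (b : A)]

/-- The differential as an operator with coefficients in `A`. -/
def diffOp (D : SemiConnection R L W) (A : ArtAlg.{u₄}) : FormOpAlg R L W A :=
  (TotalForm.diff D.onEnd : FormOp R L W) ⊗ₜ[ℂ] (1 : A)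

theorem diffOp_mul_diffOp {D : SemiConnection R L W} (hD : D.IsFlat) (A : ArtAlg.{u₄}) :
    diffOp D A * diffOp D A = 0 := by
  have : (TotalForm.diff D.onEnd : FormOp R L W) * TotalForm.diff D.onEnd = 0 := by
    ext1 χ
    exact TotalForm.diff_diff hD.onEnd χ
  rw [diffOp, Algebra.TensorProduct.tmul_mul_tmul, this, TensorProduct.zero_tmul]

/-- The differential becomes the graded commutator with the square-zero operator `diffOp`, so that
`D + α` makes sense as an element of an associative algebra. -/
theorem opAlg_d (D : SemiConnection R L W) {q : ℕ} {A : ArtAlg.{u₄}}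
    (x : Form R L (Module.End R W) q ⊗[ℂ] A) :
    opAlg (q + 1) A (extAlg A (D.onEnd.d q) x) =
      diffOp D A * opAlg q A x - (-1 : ℂ) ^ q • (opAlg q A x * diffOp D A) := by
  induction x using TensorProduct.induction_on with
  | zero => simp
  | add x x' hx hx' =>
    simp only [map_add, hx, hx', add_mul, mul_add, smul_add]
    abel
  | tmul m a =>
    rw [extAlg, LinearMap.rTensor_tmul, opAlg_tmul, opAlg_tmul, diffOp,
      Algebra.TensorProduct.tmul_mul_tmul, Algebra.TensorProduct.tmul_mul_tmul, one_mul, mul_one,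
      diff_mul_leftOp, TensorProduct.add_tmul, TensorProduct.smul_tmul', add_sub_cancel_right]

theorem incl_extMax {M : Type u₁} [AddCommGroup M] [Module ℂ M]
    {N : Type u₂} [AddCommGroup N] [Module ℂ N] (A : ArtAlg.{u₄}) (φ : M →ₗ[ℂ] N)
    (x : TensorMax M A) : incl N A (extMax A φ x) = extAlg A φ (incl M A x) := by
  induction x using TensorProduct.induction_on with
  | zero => simp
  | add x x' hx hx' => simp only [map_add, hx, hx']
  | tmul m a => rfl

theorem opMax_d (D : SemiConnection R L W) {q : ℕ} {A : ArtAlg.{u₄}}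
    (x : TensorMax (Form R L (Module.End R W) q) A) :
    opMax (q + 1) A (extMax A (D.onEnd.d q) x) =
      diffOp D A * opMax q A x - (-1 : ℂ) ^ q • (opMax q A x * diffOp D A) := by
  rw [opMax_apply, incl_extMax, opAlg_d]
  rfl

end Operators

/-! ### Gauge transformations as conjugation by exponentials -/

section Gauge

theorem filt_anti (M : Type u₂) [AddCommGroup M] [Module ℂ M] (A : ArtAlg.{u₁}) (k : ℕ) :
    filt M A (k + 1) ≤ filt M A k := by
  refine Submodule.span_mono ?_
  rintro _ ⟨m, a, ha, rfl⟩
  exact ⟨m, a, Ideal.pow_le_pow_right (Nat.le_succ _) ha, rfl⟩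

/-- Holds because `𝔪_A` is commutative; it carries the filtration estimate `extMax₂_mem_filt` over
to the other argument. -/
theorem extMax₂_flip {M : Type u₂} [AddCommGroup M] [Module ℂ M]
    {N : Type u₃} [AddCommGroup N] [Module ℂ N] {P : Type u₄} [AddCommGroup P] [Module ℂ P]
    (A : ArtAlg.{u₁}) (β : M →ₗ[ℂ] N →ₗ[ℂ] P) (x : TensorMax M A) (y : TensorMax N A) :
    extMax₂ A β.flip y x = extMax₂ A β x y := by
  induction x using TensorProduct.induction_on with
  | zero => simp
  | add x x' hx hx' => simp only [map_add, LinearMap.add_apply, hx, hx']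
  | tmul m a =>
    induction y using TensorProduct.induction_on with
    | zero => simp
    | add y y' hy hy' => simp only [map_add, LinearMap.add_apply, hy, hy']
    | tmul n b =>
      have : A.mulMax b a = A.mulMax a b := Subtype.ext (mul_comm _ _)
      simp only [extMax₂, TensorProduct.map₂_apply_tmul, TensorProduct.map_tmul,
        LinearMap.flip_apply, this]

variable {R : Type u₁} [CommRing R] [Algebra ℂ R]
  {L : Type u₂} [LieRing L] [Module R L] [LieRingModule L R] [LieRinehartRing R L]
  [LieAlgebra ℂ L] [LieRinehartAlgebra ℂ R L]
  {W : Type u₃} [AddCommGroup W] [Module R W] [Module ℂ W] [IsScalarTower ℂ R W]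

open SemiConnection

variable (R L W) in
/-- The operators of multiplication by elements of `A⁰(End W) ⊗ 𝔪_A ^ (k + 1)`. -/
def opFiltration (A : ArtAlg.{u₄}) : NilFiltration (FormOpAlg R L W A) where
  N k := (filt (Form R L (Module.End R W) 0) A k).map (opMax 0 A)
  K := (exists_filt_eq_bot (Form R L (Module.End R W) 0) A).choose
  anti k := Submodule.map_mono (filt_anti _ A k)
  mul_left := by
    rintro k _ _ ⟨x, -, rfl⟩ ⟨y, hy, rfl⟩
    exact ⟨extMax₂ A (mulForm R L W (add_zero 0)) x y, extMax₂_mem_filt A _ x hy,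
      opMax_mulForm (add_zero 0) x y⟩
  mul_right := by
    rintro k _ _ ⟨y, hy, rfl⟩ ⟨x, -, rfl⟩
    refine ⟨extMax₂ A (mulForm R L W (add_zero 0)) y x, ?_, opMax_mulForm (add_zero 0) y x⟩
    rw [← extMax₂_flip]
    exact extMax₂_mem_filt A _ x hy
  eq_bot := by
    rw [(exists_filt_eq_bot (Form R L (Module.End R W) 0) A).choose_spec _ le_rfl,
      Submodule.map_bot]

theorem opMax_mem_opFiltration {A : ArtAlg.{u₄}}
    (x : TensorMax (Form R L (Module.End R W) 0) A) : opMax 0 A x ∈ (opFiltration R L W A).N 0 :=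
  ⟨x, mem_filt_zero A x, rfl⟩

theorem mem_opFiltration_zero {A : ArtAlg.{u₄}} {u : FormOpAlg R L W A} :
    u ∈ (opFiltration R L W A).N 0 ↔ ∃ x, opMax 0 A x = u :=
  ⟨fun ⟨x, _, hx⟩ => ⟨x, hx⟩, fun ⟨x, hx⟩ => ⟨x, mem_filt_zero A x, hx⟩⟩

/-- `[a, -]` on endomorphism-valued one-forms with coefficients in `𝔪_A`. -/
def adForm {A : ArtAlg.{u₄}} (a : TensorMax (Form R L (Module.End R W) 0) A) :
    Module.End ℂ (TensorMax (Form R L (Module.End R W) 1) A) :=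
  extMax₂ A (gradedCommutator R L W (zero_add 1)) a

variable (D : SemiConnection R L W)

/-- The gauge transformation `e^a` of endomorphism-valued one-forms. -/
def gaugeForm {A : ArtAlg.{u₄}} (a : TensorMax (Form R L (Module.End R W) 0) A)
    (x : TensorMax (Form R L (Module.End R W) 1) A) :
    TensorMax (Form R L (Module.End R W) 1) A :=
  D.endForms.gauge A a x

theorem opMax_adForm {A : ArtAlg.{u₄}} (a : TensorMax (Form R L (Module.End R W) 0) A)
    (x : TensorMax (Form R L (Module.End R W) 1) A) :
    opMax 1 A (adForm a x) = commLeft (opMax 0 A a) (opMax 1 A x) := by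
  rw [adForm, opMax_gradedCommutator, zero_mul, pow_zero, one_smul, commLeft_apply]

theorem opMax_adForm_pow {A : ArtAlg.{u₄}} (a : TensorMax (Form R L (Module.End R W) 0) A)
    (x : TensorMax (Form R L (Module.End R W) 1) A) (n : ℕ) :
    opMax 1 A ((adForm a ^ n) x) = (commLeft (opMax 0 A a) ^ n) (opMax 1 A x) := by
  induction n with
  | zero => rfl
  | succ n ih =>
    rw [pow_succ', pow_succ', Module.End.mul_apply, Module.End.mul_apply, opMax_adForm, ih]

/-- The origin of the term `-Da` in the gauge action: `[a, D + x] = [a, x] - Da`. -/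
theorem commLeft_diffOp {A : ArtAlg.{u₄}} (a : TensorMax (Form R L (Module.End R W) 0) A) :
    commLeft (opMax 0 A a) (diffOp D A) = -opMax 1 A (extMax A (D.onEnd.d 0) a) := by
  have := opMax_d D a
  rw [pow_zero, one_smul] at this
  rw [commLeft_apply]
  refine Eq.trans ?_ (congrArg Neg.neg this.symm)
  rw [neg_sub]

/-- Any sufficiently large truncation is allowed, so that it can be matched with the truncation of
`e^{ad a}`. -/
theorem exists_gaugeForm_eq_sum {A : ArtAlg.{u₄}}
    (a : TensorMax (Form R L (Module.End R W) 0) A)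
    (x : TensorMax (Form R L (Module.End R W) 1) A) :
    ∃ N, ∀ M, N ≤ M → gaugeForm D a x = x + ∑ n ∈ Finset.range M,
      (((n + 1).factorial : ℂ)⁻¹) • (adForm a ^ n)
        (adForm a x - extMax A (D.onEnd.d 0) a) := by
  obtain ⟨N, hN⟩ := exists_filt_eq_bot (Form R L (Module.End R W) 1) A
  refine ⟨N, fun M hM => ?_⟩
  have hg : gaugeForm D a x = x + ∑ᶠ n : ℕ, (((n + 1).factorial : ℂ)⁻¹) • (adForm a ^ n)
        (adForm a x - extMax A (D.onEnd.d 0) a) := rfl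
  rw [hg, finsum_eq_sum_of_support_subset]
  intro n hn
  rw [Finset.coe_range, Set.mem_Iio]
  by_contra h
  refine hn ?_
  have h0 := D.endForms.ad_pow_mem A a (adForm a x - extMax A (D.onEnd.d 0) a) n
  have h1 : (adForm a ^ n) (adForm a x - extMax A (D.onEnd.d 0) a) ∈
      filt (Form R L (Module.End R W) 1) A n := h0
  rw [hN n (hM.trans (not_lt.mp h)), Submodule.mem_bot] at h1
  exact (congrArg _ h1).trans (smul_zero _)

theorem isNilpotent_commLeft {S : Type*} [Ring S] [Algebra ℂ S] {a : S} (ha : IsNilpotent a) :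
    IsNilpotent (commLeft a) := by
  obtain ⟨N, h⟩ := ha
  have hl : IsNilpotent (LinearMap.mulLeft ℂ a) :=
    ⟨N, by rw [LinearMap.pow_mulLeft, h]; ext; simp⟩
  have hr : IsNilpotent (LinearMap.mulRight ℂ a) :=
    ⟨N, by rw [LinearMap.pow_mulRight, h]; ext; simp⟩
  exact (LinearMap.commute_mulLeft_right a a).isNilpotent_sub hl hr

/-- `e^a (D + x) = (D + e^a * x) e^a`. -/
theorem exp_mul_diffOp_add {A : ArtAlg.{u₄}} (a : TensorMax (Form R L (Module.End R W) 0) A)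
    (x : TensorMax (Form R L (Module.End R W) 1) A) :
    (opFiltration R L W A).exp (opMax 0 A a) * (diffOp D A + opMax 1 A x) =
      (diffOp D A + opMax 1 A (gaugeForm D a x)) *
        (opFiltration R L W A).exp (opMax 0 A a) := by
  have hnil := (opFiltration R L W A).pow_eq_zero (opMax_mem_opFiltration a)
  obtain ⟨M₁, hM₁⟩ := isNilpotent_commLeft ⟨_, hnil⟩
  obtain ⟨M₂, hM₂⟩ := exists_gaugeForm_eq_sum D a x
  -- One extra term, because the `n`-th term of the gauge series is the `(n + 1)`-st term of `e^{ad
  -- a}(D + x)`; the term of index zero is `D + x` itself.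
  have hM : commLeft (opMax 0 A a) ^ (M₁ + M₂ + 1) = 0 :=
    pow_eq_zero_of_le (by omega) hM₁
  rw [NilFiltration.exp, expSum_mul hnil hM, hM₂ (M₁ + M₂) (by omega), Finset.sum_range_succ',
    Nat.factorial_zero, Nat.cast_one, inv_one, one_smul, pow_zero, Module.End.one_apply]
  congr 1
  rw [map_add, add_comm, add_assoc, map_sum]
  congr 2
  refine Finset.sum_congr rfl fun n _ => ?_
  rw [map_smul, opMax_adForm_pow, map_sub, opMax_adForm, pow_succ, Module.End.mul_apply,
    map_add (commLeft _), commLeft_diffOp, neg_add_eq_sub]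

variable {D}

/-- Expand the square: `D² = 0`, the mixed terms `Dx + xD` represent the derivative of `x`, and `[x,
x] = 2x²` in odd degree. -/
theorem isMaurerCartan_iff (hD : D.IsFlat) {A : ArtAlg.{u₄}}
    (x : TensorMax (Form R L (Module.End R W) 1) A) :
    D.endForms.IsMaurerCartan A x ↔
      (diffOp D A + opMax 1 A x) * (diffOp D A + opMax 1 A x) = 0 := by
  have h : D.endForms.IsMaurerCartan A x ↔ extMax A (D.onEnd.d 1) x +
      (1 / 2 : ℂ) • extMax₂ A (gradedCommutator R L W (rfl : 1 + 1 = 1 + 1)) x x = 0 := Iff.rfl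
  rw [h, ← map_eq_zero_iff _ (opMax_injective (1 + 1) A), map_add, map_smul, opMax_d,
    opMax_gradedCommutator, mul_add, add_mul, add_mul, diffOp_mul_diffOp hD]
  refine Eq.congr ?_ rfl
  module

theorem isDeformation_iff (hD : D.IsFlat) {A : ArtAlg.{u₄}}
    (x : TensorMax (Form R L (Module.End R W) 1) A) :
    D.IsDeformation x ↔
      (diffOp D A + opMax 1 A x) * (diffOp D A + opMax 1 A x) = 0 := by
  rw [IsDeformation, ← map_eq_zero_iff _ (opMax_injective (1 + 1) A), map_add, opMax_d,
    opMax_mulForm, mul_add, add_mul, add_mul, diffOp_mul_diffOp hD]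
  refine Eq.congr ?_ rfl
  module

variable (D) in
/-- `D + x` and `D + y` are conjugate by an element of `1 + A⁰(End W) ⊗ 𝔪_A`. -/
def IsConjugate {A : ArtAlg.{u₄}} (x y : TensorMax (Form R L (Module.End R W) 1) A) : Prop :=
  ∃ u : FormOpAlg R L W A, u - 1 ∈ (opFiltration R L W A).N 0 ∧
    u * (diffOp D A + opMax 1 A x) = (diffOp D A + opMax 1 A y) * u

theorem IsConjugate.refl {A : ArtAlg.{u₄}} (x : TensorMax (Form R L (Module.End R W) 1) A) :
    IsConjugate D x x :=
  ⟨1, by rw [sub_self]; exact zero_mem _, by rw [one_mul, mul_one]⟩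

theorem IsConjugate.symm {A : ArtAlg.{u₄}} {x y : TensorMax (Form R L (Module.End R W) 1) A}
    (h : IsConjugate D x y) : IsConjugate D y x := by
  obtain ⟨u, hu, huxy⟩ := h
  obtain ⟨v, hv, huv, hvu⟩ := (opFiltration R L W A).exists_inverse hu
  refine ⟨v, hv, ?_⟩
  calc v * (diffOp D A + opMax 1 A y)
      = v * ((diffOp D A + opMax 1 A y) * u) * v := by
        rw [mul_assoc, mul_assoc, huv, mul_one]
    _ = (diffOp D A + opMax 1 A x) * v := by rw [← huxy, ← mul_assoc v, hvu, one_mul]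

theorem IsConjugate.trans {A : ArtAlg.{u₄}} {x y z : TensorMax (Form R L (Module.End R W) 1) A}
    (h : IsConjugate D x y) (h' : IsConjugate D y z) : IsConjugate D x z := by
  obtain ⟨u, hu, huxy⟩ := h
  obtain ⟨v, hv, hvyz⟩ := h'
  exact ⟨v * u, (opFiltration R L W A).mul_sub_one_mem hv hu, by
    rw [mul_assoc, huxy, ← mul_assoc, hvyz, mul_assoc]⟩

theorem exp_sub_one_mem_opFiltration {A : ArtAlg.{u₄}}
    (a : TensorMax (Form R L (Module.End R W) 0) A) :
    (opFiltration R L W A).exp (opMax 0 A a) - 1 ∈ (opFiltration R L W A).N 0 :=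
  (opFiltration R L W A).exp_sub_one_mem (opMax_mem_opFiltration a)

theorem exists_exp_opMax_eq {A : ArtAlg.{u₄}} {u : FormOpAlg R L W A}
    (hu : u - 1 ∈ (opFiltration R L W A).N 0) :
    ∃ a, (opFiltration R L W A).exp (opMax 0 A a) = u := by
  obtain ⟨b, hb, hbu⟩ := (opFiltration R L W A).exists_exp_eq hu
  obtain ⟨a, rfl⟩ := mem_opFiltration_zero.1 hb
  exact ⟨a, hbu⟩

/-- `D + y` is determined by a conjugating element and `D + x`. -/
theorem eq_of_conjugate {A : ArtAlg.{u₄}} {x y z : TensorMax (Form R L (Module.End R W) 1) A}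
    {u : FormOpAlg R L W A} (hu : u - 1 ∈ (opFiltration R L W A).N 0)
    (hy : u * (diffOp D A + opMax 1 A x) = (diffOp D A + opMax 1 A y) * u)
    (hz : u * (diffOp D A + opMax 1 A x) = (diffOp D A + opMax 1 A z) * u) : y = z := by
  obtain ⟨v, -, huv, -⟩ := (opFiltration R L W A).exists_inverse hu
  have h := congrArg (· * v) (hy.symm.trans hz)
  simp only [mul_assoc, huv, mul_one] at h
  exact opMax_injective 1 A (add_left_cancel h)

theorem isConjugate_gaugeForm {A : ArtAlg.{u₄}}
    (a : TensorMax (Form R L (Module.End R W) 0) A)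
    (x : TensorMax (Form R L (Module.End R W) 1) A) : IsConjugate D x (gaugeForm D a x) :=
  ⟨_, exp_sub_one_mem_opFiltration a, exp_mul_diffOp_add D a x⟩

/-- The conjugating element is an exponential `e^a`, and `e^a` and `x` determine the conjugate,
which is therefore `e^a * x`. -/
theorem isConjugate_iff {A : ArtAlg.{u₄}} (x y : TensorMax (Form R L (Module.End R W) 1) A) :
    IsConjugate D x y ↔ ∃ a, y = gaugeForm D a x := by
  constructor
  · rintro ⟨u, hu, huxy⟩
    obtain ⟨a, rfl⟩ := exists_exp_opMax_eq hu
    exact ⟨a, eq_of_conjugate hu huxy (exp_mul_diffOp_add D a x)⟩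
  · rintro ⟨a, rfl⟩
    exact isConjugate_gaugeForm a x

/-- Choosing `c` with `e^c = e^a e^b` involves no `x`, hence the order of the quantifiers. -/
theorem exists_gaugeForm_gaugeForm {A : ArtAlg.{u₄}}
    (a b : TensorMax (Form R L (Module.End R W) 0) A) :
    ∃ c, ∀ x, gaugeForm D a (gaugeForm D b x) = gaugeForm D c x := by
  have hu := (opFiltration R L W A).mul_sub_one_mem (exp_sub_one_mem_opFiltration a)
    (exp_sub_one_mem_opFiltration b)
  obtain ⟨c, hc⟩ := exists_exp_opMax_eq hu
  refine ⟨c, fun x => eq_of_conjugate (D := D) hu (x := x) ?_ ?_⟩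
  · rw [mul_assoc, exp_mul_diffOp_add, ← mul_assoc, exp_mul_diffOp_add, mul_assoc]
  · rw [← hc, exp_mul_diffOp_add]

/-- Conjugate operators have conjugate squares. -/
theorem IsConjugate.isMaurerCartan (hD : D.IsFlat) {A : ArtAlg.{u₄}}
    {x y : TensorMax (Form R L (Module.End R W) 1) A} (h : IsConjugate D x y)
    (hx : D.endForms.IsMaurerCartan A x) : D.endForms.IsMaurerCartan A y := by
  rw [isMaurerCartan_iff hD] at hx ⊢
  obtain ⟨u, hu, huxy⟩ := h
  obtain ⟨v, -, huv, -⟩ := (opFiltration R L W A).exists_inverse hu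
  calc (diffOp D A + opMax 1 A y) * (diffOp D A + opMax 1 A y)
      = (diffOp D A + opMax 1 A y) * ((diffOp D A + opMax 1 A y) * u) * v := by
        rw [mul_assoc, mul_assoc, huv, mul_one]
    _ = u * ((diffOp D A + opMax 1 A x) * (diffOp D A + opMax 1 A x)) * v := by
        rw [← huxy, ← mul_assoc, ← huxy, mul_assoc u]
    _ = 0 := by rw [hx, mul_zero, zero_mul]

end Gauge

/-! ### Equivalence of deformations as conjugation -/

section Extension

variable {M₁ : Type*} [AddCommGroup M₁] [Module ℂ M₁] {M₂ : Type*} [AddCommGroup M₂] [Module ℂ M₂]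
  {M₃ : Type*} [AddCommGroup M₃] [Module ℂ M₃] {M₁₂ : Type*} [AddCommGroup M₁₂] [Module ℂ M₁₂]
  {M₂₃ : Type*} [AddCommGroup M₂₃] [Module ℂ M₂₃] {P : Type*} [AddCommGroup P] [Module ℂ P]

theorem extAlg₂_tmul (A : ArtAlg.{u₁}) (β : M₁ →ₗ[ℂ] M₂ →ₗ[ℂ] P) (m : M₁) (n : M₂) (a b : A) :
    extAlg₂ A β (m ⊗ₜ a) (n ⊗ₜ b) = β m n ⊗ₜ (a * b) := rfl

theorem extAlg_tmul (A : ArtAlg.{u₁}) (φ : M₁ →ₗ[ℂ] P) (m : M₁) (a : A) :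
    extAlg A φ (m ⊗ₜ a) = φ m ⊗ₜ a := rfl

theorem extAlg₂_assoc (A : ArtAlg.{u₁}) {β₁ : M₁ →ₗ[ℂ] M₂ →ₗ[ℂ] M₁₂}
    {β₂ : M₁₂ →ₗ[ℂ] M₃ →ₗ[ℂ] P} {β₃ : M₂ →ₗ[ℂ] M₃ →ₗ[ℂ] M₂₃} {β₄ : M₁ →ₗ[ℂ] M₂₃ →ₗ[ℂ] P}
    (h : ∀ x y z, β₄ x (β₃ y z) = β₂ (β₁ x y) z)
    (x : M₁ ⊗[ℂ] A) (y : M₂ ⊗[ℂ] A) (z : M₃ ⊗[ℂ] A) :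
    extAlg₂ A β₄ x (extAlg₂ A β₃ y z) = extAlg₂ A β₂ (extAlg₂ A β₁ x y) z := by
  induction x using TensorProduct.induction_on with
  | zero => simp
  | add x x' hx hx' => simp only [map_add, LinearMap.add_apply, hx, hx']
  | tmul m a =>
    induction y using TensorProduct.induction_on with
    | zero => simp
    | add y y' hy hy' => simp only [map_add, LinearMap.add_apply, hy, hy']
    | tmul n b =>
      induction z using TensorProduct.induction_on with
      | zero => simp
      | add z z' hz hz' => simp only [map_add, hz, hz']
      | tmul l c => simp only [extAlg₂_tmul, h, mul_assoc]

/-- An element of `M ⊗ A` vanishes if its images under enough linear maps on `M` do. -/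
theorem eq_zero_of_forall_extAlg {ι : Type*} (f : ι → M₁ →ₗ[ℂ] P)
    (hf : ∀ m, (∀ i, f i m = 0) → m = 0) (A : ArtAlg.{u₁}) {x : M₁ ⊗[ℂ] A}
    (hx : ∀ i, extAlg A (f i) x = 0) : x = 0 := by
  -- A basis of `A` over `ℂ` gives coordinates in `M₁`, on which the extended maps act one
  -- coordinate at a time.
  let b := Module.Free.chooseBasis ℂ A
  have nat : ∀ (i : ι) (x : M₁ ⊗[ℂ] A) k,
      TensorProduct.equivFinsuppOfBasisRight b (extAlg A (f i) x) k =
        f i (TensorProduct.equivFinsuppOfBasisRight b x k) := by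
    intro i x k
    induction x using TensorProduct.induction_on with
    | zero => simp
    | add x y hx hy => simp only [map_add, Finsupp.add_apply, hx, hy]
    | tmul m a =>
      rw [extAlg_tmul, TensorProduct.equivFinsuppOfBasisRight_apply_tmul_apply,
        TensorProduct.equivFinsuppOfBasisRight_apply_tmul_apply, map_smul]
  refine (TensorProduct.equivFinsuppOfBasisRight b).map_eq_zero_iff.1 ?_
  ext k
  refine hf _ fun i => ?_
  rw [← nat, hx, map_zero, Finsupp.zero_apply]

end Extension

/-! ### The action on sections and the relation `∼` -/

section Deformations

variable {R : Type u₁} [CommRing R] [Algebra ℂ R]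
  {L : Type u₂} [LieRing L] [Module R L] [LieRingModule L R] [LieRinehartRing R L]
  [LieAlgebra ℂ L] [LieRinehartAlgebra ℂ R L]
  {W : Type u₃} [AddCommGroup W] [Module R W] [Module ℂ W] [IsScalarTower ℂ R W]

namespace SemiConnection

theorem actForm_apply {p q n : ℕ} (h : p + q = n) (hn : n ≤ 1)
    (φ : Form R L (Module.End R W) p) (s : Form R L W q) (v : Fin n → L) :
    actForm R L W h φ s v = φ (fun i => v (splitFin h (Sum.inl i)))
      (s (fun j => v (splitFin h (Sum.inr j)))) :=
  wedge_apply_of_le_one _ h hn φ s v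

theorem mulForm_apply {p q n : ℕ} (h : p + q = n) (hn : n ≤ 1)
    (φ : Form R L (Module.End R W) p) (ψ : Form R L (Module.End R W) q) (v : Fin n → L) :
    mulForm R L W h φ ψ v = φ (fun i => v (splitFin h (Sum.inl i))) *
      ψ (fun j => v (splitFin h (Sum.inr j))) :=
  wedge_apply_of_le_one _ h hn φ ψ v

/-- In total degree at most one each wedge product is a single term, and the claim is that
composition of endomorphisms is associative with evaluation. -/
theorem actForm_actForm {p q r m k n : ℕ} (h₁ : p + k = n) (h₂ : q + r = k) (h₃ : m + r = n)
    (h₄ : p + q = m) (hn : n ≤ 1) (φ : Form R L (Module.End R W) p)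
    (ψ : Form R L (Module.End R W) q) (s : Form R L W r) :
    actForm R L W h₁ φ (actForm R L W h₂ ψ s) = actForm R L W h₃ (mulForm R L W h₄ φ ψ) s := by
  ext v
  rw [actForm_apply h₁ hn, actForm_apply h₂ (by omega), actForm_apply h₃ hn,
    mulForm_apply h₄ (by omega), Module.End.mul_apply]
  have : Subsingleton (Fin n) := Fin.subsingleton_iff_le_one.2 hn
  congr! 4
  all_goals exact congrArg v (Subsingleton.elim _ _)

theorem actForm_oneForm {q : ℕ} (h : 0 + q = q) (hq : q ≤ 1) (s : Form R L W q) :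
    actForm R L W h (oneForm R L W) s = s := by
  ext v
  have : Subsingleton (Fin q) := Fin.subsingleton_iff_le_one.2 hq
  rw [actForm_apply h hq, oneForm, AlternatingMap.constOfIsEmpty_apply, Function.const_apply,
    Module.End.one_apply]
  congr! 2
  exact congrArg v (Subsingleton.elim _ _)

theorem d_zero_apply {B : Type*} [AddCommGroup B] [Module R B] [Module ℂ B] [IsScalarTower ℂ R B]
    (D : SemiConnection R L B) (θ : Form R L B 0) (v : Fin (0 + 1) → L) :
    D.d 0 θ v = D.nabla (v 0) (θ ![]) := by
  rw [← D.d_zero_apply_cons θ (v 0) ![]]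
  congr 1
  funext i
  exact Fin.cases rfl (fun j => j.elim0) i

theorem d_actForm (D : SemiConnection R L W) (φ : Form R L (Module.End R W) 0)
    (s : Form R L W 0) :
    D.d 0 (actForm R L W (add_zero 0) φ s) =
      actForm R L W (add_comm 1 0) (D.onEnd.d 0 φ) s +
        actForm R L W (zero_add (0 + 1)) φ (D.d 0 s) := by
  ext v
  rw [AlternatingMap.add_apply, actForm_apply (add_comm 1 0) le_rfl,
    actForm_apply (zero_add (0 + 1)) le_rfl, d_zero_apply, d_zero_apply, d_zero_apply]
  rw [actForm_apply (add_zero 0) zero_le_one]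
  rw [onEnd_nabla_apply]
  have h2 : ∀ w w' : Fin 0 → L, w = w' := fun w w' => Subsingleton.elim _ _
  rw [h2 (fun j => v (splitFin (add_comm 1 0) (Sum.inr j))) ![],
    h2 (fun j => ![] (splitFin (add_zero 0) (Sum.inl j))) ![],
    h2 (fun j => ![] (splitFin (add_zero 0) (Sum.inr j))) ![],
    h2 (fun j => v (splitFin (zero_add (0 + 1)) (Sum.inl j))) ![]]
  have h3 : v (splitFin (add_comm 1 0) (Sum.inl 0)) = v 0 := rfl
  have h4 : v (splitFin (zero_add (0 + 1)) (Sum.inr 0)) = v 0 := rfl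
  rw [h3, h4, sub_add_cancel]

/-- Zero-forms with values in `W` are the elements of `W`, and an endomorphism that kills all of
them is zero. -/
theorem eq_zero_of_actForm_eq_zero {A : ArtAlg.{u₄}}
    {γ : Form R L (Module.End R W) 1 ⊗[ℂ] A}
    (h : ∀ s : Form R L W 0 ⊗[ℂ] A,
      extAlg₂ A (actForm R L W (add_comm 1 0)) γ s = 0) : γ = 0 := by
  refine eq_zero_of_forall_extAlg (actForm R L W (add_comm 1 0)).flip ?_ A fun s => ?_
  · intro β hβ
    ext v w
    have h1 := congrArg (fun θ : Form R L W (0 + 1) => θ v)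
      (hβ (AlternatingMap.constOfIsEmpty R L (Fin 0) w))
    rw [LinearMap.flip_apply] at h1
    exact (actForm_apply (add_comm 1 0) le_rfl β _ v).symm.trans h1
  · rw [← h (s ⊗ₜ 1)]
    generalize γ = x
    induction x using TensorProduct.induction_on with
    | zero => simp
    | add x y hx hy => simp only [map_add, LinearMap.add_apply, hx, hy]
    | tmul β a => rw [extAlg_tmul, extAlg₂_tmul, mul_one, LinearMap.flip_apply]

variable (D : SemiConnection R L W) {A : ArtAlg.{u₄}}

theorem extAlg_d_actForm (ρ : Form R L (Module.End R W) 0 ⊗[ℂ] A) (s : Form R L W 0 ⊗[ℂ] A) :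
    extAlg A (D.d 0) (extAlg₂ A (actForm R L W (add_zero 0)) ρ s) =
      extAlg₂ A (actForm R L W (add_comm 1 0)) (extAlg A (D.onEnd.d 0) ρ) s +
        extAlg₂ A (actForm R L W (zero_add (0 + 1))) ρ (extAlg A (D.d 0) s) := by
  induction ρ using TensorProduct.induction_on with
  | zero => simp
  | add x y hx hy =>
    simp only [map_add, LinearMap.add_apply, hx, hy]
    abel
  | tmul φ a =>
    induction s using TensorProduct.induction_on with
    | zero => simp
    | add x y hx hy =>
      simp only [map_add, hx, hy]
      abel
    | tmul s b =>
      rw [extAlg_tmul, extAlg_tmul, extAlg₂_tmul, extAlg₂_tmul, extAlg_tmul, d_actForm,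
        TensorProduct.add_tmul]
      rfl

theorem extAlg₂_oneForm (t : Form R L W (0 + 1) ⊗[ℂ] A) :
    extAlg₂ A (actForm R L W (zero_add (0 + 1))) (oneForm R L W ⊗ₜ[ℂ] (1 : A)) t = t := by
  induction t using TensorProduct.induction_on with
  | zero => simp
  | add x y hx hy => simp only [map_add, hx, hy]
  | tmul t b => rw [extAlg₂_tmul, actForm_oneForm _ le_rfl, one_mul]

/-- The form `ρ⁻¹ (D ρ + α ρ)`; the second argument stands for `ρ⁻¹`. -/
def conjForm (ρ ρ' : Form R L (Module.End R W) 0 ⊗[ℂ] A)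
    (α : TensorMax (Form R L (Module.End R W) 1) A) : Form R L (Module.End R W) 1 ⊗[ℂ] A :=
  extAlg₂ A (mulForm R L W (zero_add 1)) ρ'
    (extAlg A (D.onEnd.d 0) ρ + extAlg₂ A (mulForm R L W (add_zero 1)) (incl _ A α) ρ)

/-- By the Leibniz rule the conjugate of `D + α` is again `D` plus a one-form, so equality of
operators on sections can be tested on one-forms. -/
theorem conj_perturb {ρ ρ' : Form R L (Module.End R W) 0 ⊗[ℂ] A}
    (h : extAlg₂ A (mulForm R L W (add_zero 0)) ρ' ρ = oneForm R L W ⊗ₜ[ℂ] (1 : A))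
    (α : TensorMax (Form R L (Module.End R W) 1) A) (s : Form R L W 0 ⊗[ℂ] A) :
    extAlg₂ A (actForm R L W (zero_add (0 + 1))) ρ'
        (D.perturb α (extAlg₂ A (actForm R L W (add_zero 0)) ρ s)) =
      extAlg A (D.d 0) s +
        extAlg₂ A (actForm R L W (add_comm 1 0)) (D.conjForm ρ ρ' α) s := by
  have a1 := extAlg₂_assoc A (actForm_actForm (R := R) (L := L) (W := W) (add_comm 1 0)
    (add_zero 0) (add_comm 1 0) (add_zero 1) le_rfl) (incl _ A α) ρ s
  have a2 := fun β => extAlg₂_assoc A (actForm_actForm (R := R) (L := L) (W := W)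
    (zero_add (0 + 1)) (add_comm 1 0) (add_comm 1 0) (zero_add 1) le_rfl) ρ' β s
  have a3 := extAlg₂_assoc A (actForm_actForm (R := R) (L := L) (W := W)
    (zero_add (0 + 1)) (zero_add (0 + 1)) (zero_add (0 + 1)) (add_zero 0) le_rfl) ρ' ρ
    (extAlg A (D.d 0) s)
  rw [h, extAlg₂_oneForm] at a3
  rw [perturb, LinearMap.add_apply, extAlg_d_actForm, a1, map_add, map_add, a3, conjForm,
    map_add, map_add, LinearMap.add_apply, ← a2, ← a2]
  abel

theorem opAlg_conjForm (ρ ρ' : Form R L (Module.End R W) 0 ⊗[ℂ] A)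
    (α : TensorMax (Form R L (Module.End R W) 1) A) :
    opAlg 1 A (D.conjForm ρ ρ' α) = opAlg 0 A ρ' *
      ((diffOp D A + opMax 1 A α) * opAlg 0 A ρ - opAlg 0 A ρ * diffOp D A) := by
  have h1 := opAlg_d D ρ
  rw [pow_zero, one_smul] at h1
  rw [conjForm, opAlg_mulForm, map_add, opAlg_mulForm]
  refine congrArg (opAlg 0 A ρ' * ·) ((congrArg (· + _) h1).trans ?_)
  rw [add_mul, opMax_apply]
  abel

/-- Both relations say that `ρ⁻¹(Dρ + α₂ρ) = α₁`: on sections because one-forms act faithfully,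
among operators because `opAlg` is injective. -/
theorem defRel_iff (α₁ α₂ : D.Deformation A) :
    D.DefRel A α₁ α₂ ↔ IsConjugate D α₁.1 α₂.1 := by
  have key : ∀ {ρ ρ' : Form R L (Module.End R W) 0 ⊗[ℂ] A},
      opAlg 0 A ρ * opAlg 0 A ρ' = 1 → opAlg 0 A ρ' * opAlg 0 A ρ = 1 →
      (D.conjForm ρ ρ' α₂.1 = incl _ A α₁.1 ↔
        opAlg 0 A ρ * (diffOp D A + opMax 1 A α₁.1) =
          (diffOp D A + opMax 1 A α₂.1) * opAlg 0 A ρ) := by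
    intro ρ ρ' h₁ h₂
    rw [← (opAlg_injective 1 A).eq_iff, opAlg_conjForm, ← opMax_apply]
    constructor
    · intro h
      have h' := congrArg (opAlg 0 A ρ * ·) h
      simp only [← mul_assoc, h₁, one_mul] at h'
      rw [mul_add, ← h']
      abel
    · intro h
      rw [← h, mul_add, add_sub_cancel_left, ← mul_assoc, h₂, one_mul]
  have one_iff : ∀ ρ ρ' : Form R L (Module.End R W) 0 ⊗[ℂ] A,
      extAlg₂ A (mulForm R L W (add_zero 0)) ρ ρ' = oneForm R L W ⊗ₜ[ℂ] (1 : A) ↔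
        opAlg 0 A ρ * opAlg 0 A ρ' = 1 := by
    intro ρ ρ'
    rw [← opAlg_oneForm, ← opAlg_mulForm (add_zero 0), (opAlg_injective 0 A).eq_iff]
  constructor
  · rintro ⟨ρ, ρ', ⟨r, rfl⟩, h₁, h₂, h₃⟩
    refine ⟨opAlg 0 A (oneForm R L W ⊗ₜ[ℂ] (1 : A) + incl _ A r), ?_, ?_⟩
    · rw [map_add, opAlg_oneForm, add_sub_cancel_left]
      exact opMax_mem_opFiltration r
    · refine (key ((one_iff _ _).1 h₁) ((one_iff _ _).1 h₂)).1 (sub_eq_zero.1 ?_)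
      refine eq_zero_of_actForm_eq_zero fun s => ?_
      have h := h₃ s
      rw [D.conj_perturb h₂, perturb, LinearMap.add_apply] at h
      rw [map_sub, LinearMap.sub_apply, add_left_cancel h, sub_self]
  · rintro ⟨u, hu, huα⟩
    obtain ⟨v, hv, huv, hvu⟩ := (opFiltration R L W A).exists_inverse hu
    -- The inverse of the conjugating element also lies in `1 + N₀`, so both are multiplications by
    -- zero-forms and can serve as `ρ` and `ρ⁻¹`.
    have lift : ∀ {w : FormOpAlg R L W A}, w - 1 ∈ (opFiltration R L W A).N 0 →
        ∃ r, opAlg 0 A (oneForm R L W ⊗ₜ[ℂ] (1 : A) + incl _ A r) = w := by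
      intro w hw
      obtain ⟨r, hr⟩ := mem_opFiltration_zero.1 hw
      exact ⟨r, by rw [map_add, opAlg_oneForm, ← opMax_apply, hr, add_sub_cancel]⟩
    obtain ⟨r, rfl⟩ := lift hu
    obtain ⟨r', rfl⟩ := lift hv
    refine ⟨_, _, ⟨r, rfl⟩, (one_iff _ _).2 huv, (one_iff _ _).2 hvu, fun s => ?_⟩
    rw [D.conj_perturb ((one_iff _ _).2 hvu), (key huv hvu).2 huα, perturb, LinearMap.add_apply]

end SemiConnection

end Deformations

end DolbeaultDeformation

end

/-! ### The main theorem -/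

theorem mainTheorem4
    {V : Type u₁} [NormedAddCommGroup V] [NormedSpace ℂ V] [FiniteDimensional ℂ V]
    {X : Type u₂} [TopologicalSpace X] [T2Space X] [CompactSpace X] [ChartedSpace V X]
    [IsManifold 𝓘(ℂ, V) ω X]
    {F : Type u₃} [NormedAddCommGroup F] [NormedSpace ℂ F] [FiniteDimensional ℂ F]
    {E : X → Type u₄} [∀ x, AddCommGroup (E x)] [∀ x, Module ℂ (E x)]
    [∀ x, TopologicalSpace (E x)] [TopologicalSpace (Bundle.TotalSpace F E)]
    [FiberBundle F E] [VectorBundle ℂ F E]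
    [DolbeaultDeformation.SmoothComplexVectorBundle V X F E]
    (D : DolbeaultDeformation.HolomorphicStructure V X F E) :
    -- `A^{0,*}(End E)` is a differential graded Lie algebra
    D.dgla.IsDGLA ∧
    -- over every `A`, the transformations `e^a` preserve the Maurer–Cartan equation and compose as
    -- a group, and the two quotients are quotients by equivalence relations
    (∀ A : DolbeaultDeformation.ArtAlg.{u₅},
      (∀ a x, D.dgla.IsMaurerCartan A x → D.dgla.IsMaurerCartan A (D.dgla.gauge A a x)) ∧
      (∀ a b, ∃ c, ∀ x, D.dgla.gauge A a (D.dgla.gauge A b x) = D.dgla.gauge A c x) ∧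
      Equivalence (D.dgla.GaugeRel A) ∧ Equivalence (D.semiConnection.DefRel A)) ∧
    -- `MC ≅ Def_E`, by an isomorphism that is the identity on representatives
    ∃ φ : D.MC ≅ D.Def,
      ∀ (A : DolbeaultDeformation.ArtAlg.{u₅})
        (α : DolbeaultDeformation.TensorMax (DolbeaultDeformation.EndForm V X F E 1) A)
        (hα : D.dgla.IsMaurerCartan A α),
        ∃ hα' : D.semiConnection.IsDeformation α,
          φ.hom.app A (Quot.mk _ ⟨α, hα⟩) = (Quot.mk _ ⟨α, hα'⟩ : D.Def.obj A) := by
  have hD : D.semiConnection.IsFlat := D.integrable.isFlat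
  have gaugeRel : ∀ (A : DolbeaultDeformation.ArtAlg.{u₅}) (x y : D.dgla.MCSet A),
      D.dgla.GaugeRel A x y ↔ DolbeaultDeformation.IsConjugate D.semiConnection x.1 y.1 :=
    fun A x y => (DolbeaultDeformation.isConjugate_iff x.1 y.1).symm
  have mc : ∀ (A : DolbeaultDeformation.ArtAlg.{u₅})
      (x : DolbeaultDeformation.TensorMax (DolbeaultDeformation.EndForm V X F E 1) A),
      D.dgla.IsMaurerCartan A x ↔ D.semiConnection.IsDeformation x := fun A x =>
    (DolbeaultDeformation.isMaurerCartan_iff hD x).trans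
      (DolbeaultDeformation.isDeformation_iff hD x).symm
  refine ⟨hD.isDGLA_endForms, fun A => ⟨fun a x hx => ?_, fun a b => ?_, ?_, ?_⟩, ?_⟩
  · exact (DolbeaultDeformation.isConjugate_gaugeForm a x).isMaurerCartan hD hx
  · exact DolbeaultDeformation.exists_gaugeForm_gaugeForm (D := D.semiConnection) a b
  · exact ⟨fun x => (gaugeRel A x x).2 (.refl _),
      fun {x y} h => (gaugeRel A y x).2 ((gaugeRel A x y).1 h).symm,
      fun {x y z} h h' =>
        (gaugeRel A x z).2 (((gaugeRel A x y).1 h).trans ((gaugeRel A y z).1 h'))⟩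
  · have defRel := D.semiConnection.defRel_iff (A := A)
    exact ⟨fun x => (defRel x x).2 (.refl _),
      fun {x y} h => (defRel y x).2 ((defRel x y).1 h).symm,
      fun {x y z} h h' => (defRel x z).2 (((defRel x y).1 h).trans ((defRel y z).1 h'))⟩
  -- Both equations say `(D + α)² = 0` and both relations are conjugacy, so the identity on
  -- representatives descends to a bijection of quotients.
  · let e : ∀ A : DolbeaultDeformation.ArtAlg.{u₅},
        D.dgla.MCSet A ≃ D.semiConnection.Deformation A :=
      fun A => Equiv.subtypeEquivRight (mc A)
    have he : ∀ A (x y : D.dgla.MCSet A),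
        D.dgla.GaugeRel A x y ↔ D.semiConnection.DefRel A (e A x) (e A y) := fun A x y =>
      (gaugeRel A x y).trans (D.semiConnection.defRel_iff (e A x) (e A y)).symm
    refine ⟨CategoryTheory.NatIso.ofComponents
      (fun A => (Quot.congr (e A) (he A)).toIso) ?_, ?_⟩
    -- Naturality is definitional, since both functors act on representatives by `baseMap`.
    · intro A B f
      ext x
      induction x using Quot.ind with
      | mk x => rfl
    · intro A α hα
      exact ⟨(mc A α).1 hα, rfl⟩
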